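/- **Definitions.** Let $\mathbb N_\omega=\mathbb N\uplus\{\omega\}$, and for $x,y\in\mathbb N_\omega$ write $x\sqsubseteq y$ if $y\in\{x,\omega\}$; orders are extended component-wise to the \emph{configurations} in $\mathbb N_\omega^d$. The norm $\|\mathbf x\|$ of a configuration is the sum of its finite components, and $\|\mathbf a\|=\sum_i|\mathbf a(i)|$ for an \emph{action} $\mathbf a\in\mathbb Z^d$. For an action, $\mathbf x\xrightarrow{\mathbf a}\mathbf y$ means $\mathbf y=\mathbf x+\mathbf a$ (with $\omega+z=\omega$); this extends to words of actions, all intermediate vectors being in $\mathbb N_\omega^d$. A \emph{VASS} of dimension $d\in\mathbb N$ is $G=(Q,q_{in},q_{out},T)$ with $Q$ a finite set of states, $q_{in},q_{out}\in Q$ and $T\subseteq Q\times\mathbb Z^d\times Q$ finite. Its size is $|G|=|Q|+|T|+\sum_{(p,\mathbf a,q)\in T}\|\mathbf a\|$. A \emph{complete path} is a path from $q_{in}$ to $q_{out}$; $G$ is \emph{strongly connected} if there is a path between any two states in both directions. We write $p(\mathbf x)\xrightarrow{*}_G q(\mathbf y)$ if some path of $G$ from $p$ to $q$ is labelled by a word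 $\sigma$ with $\mathbf x\xrightarrow{\sigma}\mathbf y$. A \emph{KLM sequence} of dimension $d$ is $\xi=(\mathbf x_0G_0\mathbf y_0)\mathbf a_1(\mathbf x_1G_1\mathbf y_1)\cdots\mathbf a_k(\mathbf x_kG_k\mathbf y_k)$, where the $\mathbf x_j,\mathbf y_j$ are configurations, the $G_j=(Q_j,q_{in,j},q_{out,j},T_j)$ VASSes of dimension $d$ and the $\mathbf a_j$ actions. Its size is $$|\xi|=2(d+1)^{d+1}\Bigl(k+\sum_{j=1}^k\|\mathbf a_j\|+\sum_{j=0}^k\bigl(\|\mathbf x_j\|+|G_j|+\|\mathbf y_j\|\bigr)\Bigr).$$ Its \emph{action language} $L_\xi$ is the set of words $\sigma_0\mathbf a_1\sigma_1\cdots\mathbf a_k\sigma_k$ such that each $\sigma_j$ is the label of a complete path of $G_j$ and there are $\mathbf m_j\sqsubseteq\mathbf x_j$ and $\mathbf n_j\sqsubseteq\mathbf y_j$ in $\mathbb N^d$ with $\mathbf m_0\xrightarrow{\sigma_0}\mathbf n_0\xrightarrow{\mathbf a_1}\mathbf m_1\cdots\mathbf m_k\xrightarrow{\sigma_k}\mathbf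 n_k$. The \emph{characteristic system} $E_\xi$ has as models the sequences $(\mathbf m_j,\phi_j,\mathbf n_j)_{0\le j\le k}$ in $\mathbb N^d\times\mathbb N^{T_j}\times\mathbb N^d$ such that, for all $j$, $\mathbf m_j\sqsubseteq\mathbf x_j$, $\mathbf n_j\sqsubseteq\mathbf y_j$, $\mathbf n_j=\mathbf m_j+\sum_{t=(p,\mathbf a,q)\in T_j}\phi_j(t)\,\mathbf a$, $\mathbb 1_{q_{out,j}}-\mathbb 1_{q_{in,j}}=\sum_{t=(p,\mathbf a,q)\in T_j}\phi_j(t)(\mathbb 1_q-\mathbb 1_p)$, and $\mathbf n_{j-1}\xrightarrow{\mathbf a_j}\mathbf m_j$ if $j\ge1$. - $\xi$ is \emph{clean} if $E_\xi$ has a model, every $G_j$ is strongly connected, and $\xi$ is \emph{saturated}: for all $j,i$, if $\mathbf x_j(i)=\omega$ (resp. $\mathbf y_j(i)=\omega$) then the values $\mathbf m_j(i)$ (resp. $\mathbf n_j(i)$) over the models of $E_\xi$ are unbounded. - A component $i$ is \emph{fixed} by $G$ if some $f:Q\to\mathbb N$ satisfies $f(q)=f(p)+\mathbf a(i)$ for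 all $(p,\mathbf a,q)\in T$. $\xi$ is \emph{rigid} if for every $j$ and every $i$ fixed by $G_j$ there is such an $f$ (for $G_j$) with moreover $f(q_{in,j})\sqsubseteq\mathbf x_j(i)$ and $f(q_{out,j})\sqsubseteq\mathbf y_j(i)$. - $\xi$ is \emph{pumpable} if for every $j$ and every $i$ not fixed by $G_j$: either $\mathbf x_j(i)=\omega$ or there is $\mathbf x'\ge\mathbf x_j$ with $\mathbf x'(i)>\mathbf x_j(i)$ and $q_{in,j}(\mathbf x_j)\xrightarrow{*}_{G_j}q_{in,j}(\mathbf x')$; and either $\mathbf y_j(i)=\omega$ or there is $\mathbf y'\ge\mathbf y_j$ with $\mathbf y'(i)>\mathbf y_j(i)$ and $q_{out,j}(\mathbf y')\xrightarrow{*}_{G_j}q_{out,j}(\mathbf y_j)$. - $\xi$ is \emph{unbounded} if for every $j$ and $t\in T_j$ the values $\phi_j(t)$ over the models of $E_\xi$ are unbounded. - $\xi$ is \emph{normal} if it is clean, rigid, pumpable and unbounded. **Lemma (Bounded Witness).** Let $\ell(x)=x^{3x}$. For every normal KLM sequence $\xi$, the language $L_\xi$ contains a word $\sigma$ with $|\sigma|\le\ell(|\xi|)$;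 in particular $L_\xi\neq\emptyset$. Moreover, such a word can be computed in space $O(\ell(|\xi|))$: there are a single deterministic multi-stack Turing machine, with finite control and finite alphabets, and a constant $C$ such that, for every dimension $d$ and every normal KLM sequence $\xi$ of dimension $d$, on every presentation of $\xi$ (numbers in unary, states numbered $0,\dots,|Q_j|-1$ in any way, transitions listed in any order without repetition) the machine halts with output a word $\sigma\in L_\xi$ with $|\sigma|\le\ell(|\xi|)$, its components being written in unary, and uses at most $C\cdot\ell(|\xi|)$ cells in total (input and output included). -/

import Mathlib

universe u

namespace KLMReach

/-- Actions of dimension `d`: vectors of `ℤ^d`. -/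
abbrev Action (d : ℕ) : Type := Fin d → ℤ

/-- Configurations: vectors of `ℕ_ω^d`, where `ω` is the top element of `ℕ∞`. -/
abbrev Config (d : ℕ) : Type := Fin d → ℕ∞

/-- A finite vector of `ℕ^d`, seen as a configuration. -/
def finConfig {d : ℕ} (m : Fin d → ℕ) : Config d := fun i => (m i : ℕ∞)

/-- The order `x ⊑ y` on `ℕ_ω`: `y ∈ {x, ω}`. -/
def SqLe (x y : ℕ∞) : Prop := y = x ∨ y = ⊤

/-- The relation `y = x + a` on `ℕ_ω`, with the convention `ω + a = ω` for `a ∈ ℤ`. -/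
def AddRel (x : ℕ∞) (a : ℤ) (y : ℕ∞) : Prop :=
  (x = ⊤ ∧ y = ⊤) ∨ ∃ m n : ℕ, x = (m : ℕ∞) ∧ y = (n : ℕ∞) ∧ (n : ℤ) = (m : ℤ) + a

/-- The step relation of an action on configurations. -/
def Step {d : ℕ} (x : Config d) (a : Action d) (y : Config d) : Prop :=
  ∀ i, AddRel (x i) (a i) (y i)

/-- The step relation of a word of actions on configurations. -/
def Run {d : ℕ} : Config d → List (Action d) → Config d → Prop
  | x, [], y => x = y
  | x, a :: σ, y => ∃ c, Step x a c ∧ Run c σ y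

/-- Norm of a configuration: the sum of its finite components (`ENat.toNat ⊤ = 0`). -/
def configNorm {d : ℕ} (x : Config d) : ℕ := ∑ i, (x i).toNat

/-- Norm of an action: the sum of the absolute values of its components. -/
def actionNorm {d : ℕ} (a : Action d) : ℕ := ∑ i, (a i).natAbs

/-- Vector addition systems with states of dimension `d`. -/
structure VASS (d : ℕ) where
  /-- the finite set of states, non-empty because of `qin` -/
  Q : Type u
  [finQ : Finite Q]
  /-- the input state -/
  qin : Q
  /-- the output state -/
  qout : Q
  /-- the finite set of transitions -/
  T : Finset (Q × Action d × Q)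

attribute [instance] VASS.finQ

namespace VASS

variable {d : ℕ} (G : VASS.{u} d)

/-- `G.Path p π q`: the word `π` of transitions is a path of `G` from `p` to `q`. -/
def Path : G.Q → List (G.Q × Action d × G.Q) → G.Q → Prop
  | p, [], q => p = q
  | p, t :: π, q => t ∈ G.T ∧ t.1 = p ∧ Path t.2.2 π q

/-- The word of actions that labels a word of transitions. -/
def label (π : List (G.Q × Action d × G.Q)) : List (Action d) := π.map fun t => t.2.1

/-- `σ` is the label of a complete path, that is, one from the input to the output state. -/
def IsCompleteLabel (σ : List (Action d)) : Prop :=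
  ∃ π, G.Path G.qin π G.qout ∧ G.label π = σ

/-- The step relation `p(x) → q(y)` of a word of actions on state-configurations. -/
def SRun : G.Q → Config d → List (Action d) → G.Q → Config d → Prop
  | p, x, [], q, y => p = q ∧ x = y
  | p, x, a :: σ, q, y => ∃ r c, (p, a, r) ∈ G.T ∧ Step x a c ∧ SRun r c σ q y

/-- Reachability between state-configurations. -/
def Reach (p : G.Q) (x : Config d) (q : G.Q) (y : Config d) : Prop := ∃ σ, G.SRun p x σ q y

/-- All the states are in the same strongly connected component. -/
def StronglyConnected : Prop := ∀ p q : G.Q, ∃ π, G.Path p π q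

/-- The size `|Q| + |T| + ∑ ‖Δ(t)‖`. -/
noncomputable def size : ℕ := Nat.card G.Q + G.T.card + ∑ t ∈ G.T, actionNorm t.2.1

/-- The displacement of a function `φ : T → ℕ`. -/
def displacement (φ : {t // t ∈ G.T} → ℕ) : Action d :=
  fun i => ∑ t : {t // t ∈ G.T}, (φ t : ℤ) * t.1.2.1 i

open Classical in
/-- The characteristic function of a state. -/
noncomputable def ind (q : G.Q) : G.Q → ℤ := fun p => if p = q then 1 else 0

/-- `φ` is a model of the Kirchhoff system of `G`. -/
def Kirchhoff (φ : {t // t ∈ G.T} → ℕ) : Prop :=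
  ∀ r : G.Q, G.ind G.qout r - G.ind G.qin r =
    ∑ t : {t // t ∈ G.T}, (φ t : ℤ) * (G.ind t.1.2.2 r - G.ind t.1.1 r)

/-- `f` follows the component `i` of the actions along every transition of `G`. -/
def Tracks (i : Fin d) (f : G.Q → ℕ) : Prop :=
  ∀ t ∈ G.T, (f t.2.2 : ℤ) = (f t.1 : ℤ) + t.2.1 i

/-- The component `i` is fixed by `G`. -/
def Fixed (i : Fin d) : Prop := ∃ f : G.Q → ℕ, G.Tracks i f

/-- The triple `x G y` is rigid. -/
def RigidTriple (x y : Config d) : Prop :=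
  ∀ i, G.Fixed i → ∃ g : G.Q → ℕ, G.Tracks i g ∧
    SqLe (g G.qin : ℕ∞) (x i) ∧ SqLe (g G.qout : ℕ∞) (y i)

open Classical in
/-- The forward acceleration. -/
noncomputable def facc (x : Config d) : Config d := fun i =>
  if ∃ x', x ≤ x' ∧ x i < x' i ∧ G.Reach G.qin x G.qin x' then ⊤ else x i

open Classical in
/-- The backward acceleration. -/
noncomputable def bacc (y : Config d) : Config d := fun i =>
  if ∃ y', y ≤ y' ∧ y i < y' i ∧ G.Reach G.qout y' G.qout y then ⊤ else y i

/-- The triple `x G y` is pumpable. -/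
def PumpableTriple (x y : Config d) : Prop :=
  ∀ i, ¬ G.Fixed i → G.facc x i = ⊤ ∧ G.bacc y i = ⊤

end VASS

/-- KLM sequences `(x₀ G₀ y₀) a₁ (x₁ G₁ y₁) … a_k (x_k G_k y_k)` of dimension `d`.
The action `a_{j+1}` is `a j`, for `j : Fin k`. -/
structure KLM (d : ℕ) where
  /-- the number of actions between the triples -/
  k : ℕ
  /-- the input configurations -/
  x : Fin (k + 1) → Config d
  /-- the VASSes -/
  G : Fin (k + 1) → VASS.{u} d
  /-- the output configurations -/
  y : Fin (k + 1) → Config d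
  /-- the actions between the triples -/
  a : Fin k → Action d

namespace KLM

variable {d : ℕ} (ξ : KLM.{u} d)

/-- The action language of a KLM sequence. -/
def language : Set (List (Action d)) :=
  {w | ∃ (σ : Fin (ξ.k + 1) → List (Action d)) (m n : Fin (ξ.k + 1) → Fin d → ℕ),
    w = σ 0 ++ (List.ofFn fun j : Fin ξ.k => ξ.a j :: σ j.succ).flatten ∧
    (∀ j, (ξ.G j).IsCompleteLabel (σ j)) ∧
    (∀ j, Run (finConfig (m j)) (σ j) (finConfig (n j))) ∧
    (∀ j : Fin ξ.k, Step (finConfig (n j.castSucc)) (ξ.a j) (finConfig (m j.succ))) ∧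
    (∀ j i, SqLe (m j i : ℕ∞) (ξ.x j i)) ∧
    (∀ j i, SqLe (n j i : ℕ∞) (ξ.y j i))}

/-- The size of a KLM sequence. -/
noncomputable def size : ℕ :=
  2 * (d + 1) ^ (d + 1) * (ξ.k + ∑ j, actionNorm (ξ.a j) +
    ∑ j, (configNorm (ξ.x j) + (ξ.G j).size + configNorm (ξ.y j)))

/-- Characteristic sequences `(m_j, φ_j, n_j)_{0 ≤ j ≤ k}` of a KLM sequence. -/
structure CharSeq where
  /-- the vectors `m_j` -/
  m : Fin (ξ.k + 1) → Fin d → ℕ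
  /-- the functions `φ_j : T_j → ℕ` -/
  φ : ∀ j : Fin (ξ.k + 1), {t // t ∈ (ξ.G j).T} → ℕ
  /-- the vectors `n_j` -/
  n : Fin (ξ.k + 1) → Fin d → ℕ

/-- `h` is a model of the characteristic system of `ξ`. -/
structure IsModel (h : ξ.CharSeq) : Prop where
  m_le : ∀ j i, SqLe (h.m j i : ℕ∞) (ξ.x j i)
  kirchhoff : ∀ j, (ξ.G j).Kirchhoff (h.φ j)
  displacement : ∀ j i, (h.n j i : ℤ) = (h.m j i : ℤ) + (ξ.G j).displacement (h.φ j) i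
  n_le : ∀ j i, SqLe (h.n j i : ℕ∞) (ξ.y j i)
  link : ∀ j : Fin ξ.k,
    Step (finConfig (h.n j.castSucc)) (ξ.a j) (finConfig (h.m j.succ))

/-- The characteristic system has a model. -/
def Satisfiable : Prop := ∃ h, ξ.IsModel h

/-- All the VASSes of the sequence are strongly connected. -/
def StronglyConnected : Prop := ∀ j, (ξ.G j).StronglyConnected

/-- `ω` components are unbounded over the models of the characteristic system. -/
def Saturated : Prop :=
  ∀ j i,
    (ξ.x j i = ⊤ → ¬ BddAbove {v : ℕ | ∃ h, ξ.IsModel h ∧ h.m j i = v}) ∧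
    (ξ.y j i = ⊤ → ¬ BddAbove {v : ℕ | ∃ h, ξ.IsModel h ∧ h.n j i = v})

/-- Every transition count is unbounded over the models of the characteristic system. -/
def Unbounded : Prop :=
  ∀ j (t : {t // t ∈ (ξ.G j).T}), ¬ BddAbove {v : ℕ | ∃ h, ξ.IsModel h ∧ h.φ j t = v}

/-- Every triple of the sequence is rigid. -/
def Rigid : Prop := ∀ j, (ξ.G j).RigidTriple (ξ.x j) (ξ.y j)

/-- Every triple of the sequence is pumpable. -/
def Pumpable : Prop := ∀ j, (ξ.G j).PumpableTriple (ξ.x j) (ξ.y j)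

/-- Clean KLM sequences. -/
def Clean : Prop := ξ.Satisfiable ∧ ξ.StronglyConnected ∧ ξ.Saturated

/-- Normal KLM sequences. -/
def Normal : Prop := ξ.Clean ∧ ξ.Rigid ∧ ξ.Pumpable ∧ ξ.Unbounded

end KLM

/-- The function `ℓ(x) = x ^ (3 x)`. -/
def ell (x : ℕ) : ℕ := x ^ (3 * x)

/-! ### Presenting KLM sequences and words of actions to a machine -/

/-- The tape alphabet for inputs and outputs. -/
inductive Sym
  | one | minus | omega | sep | bar | trans | close | link
  deriving DecidableEq

instance : Fintype Sym where
  elems := {Sym.one, Sym.minus, Sym.omega, Sym.sep, Sym.bar, Sym.trans, Sym.close, Sym.link}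
  complete s := by cases s <;> decide

/-- A natural number in unary, closed by `sep`. -/
def encNat (n : ℕ) : List Sym := List.replicate n Sym.one ++ [Sym.sep]

/-- An integer: a sign if it is negative, then its absolute value. -/
def encInt (z : ℤ) : List Sym := (if z < 0 then [Sym.minus] else []) ++ encNat z.natAbs

/-- An element of `ℕ_ω`. -/
noncomputable def encENat (x : ℕ∞) : List Sym :=
  if x = ⊤ then [Sym.omega, Sym.sep] else encNat x.toNat

/-- An action: its components, closed by `bar`. -/
def encAction {d : ℕ} (a : Action d) : List Sym :=
  (List.ofFn fun i => encInt (a i)).flatten ++ [Sym.bar]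

/-- A configuration: its components, closed by `bar`. -/
noncomputable def encConfig {d : ℕ} (x : Config d) : List Sym :=
  (List.ofFn fun i => encENat (x i)).flatten ++ [Sym.bar]

/-- A word of actions. -/
def encWord {d : ℕ} (σ : List (Action d)) : List Sym := (σ.map encAction).flatten

/-- A transition, for a numbering `e` of the states. -/
def encTrans {d N : ℕ} {Q : Type u} (e : Q ≃ Fin N) (t : Q × Action d × Q) : List Sym :=
  Sym.trans :: (encNat (e t.1) ++ encAction t.2.1 ++ encNat (e t.2.2))

/-- `w` presents the VASS `G`, for some numbering `0, …, |Q| - 1` of its states and some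
listing, without repetition, of its transitions. -/
def VASS.Encodes {d : ℕ} (G : VASS.{u} d) (w : List Sym) : Prop :=
  ∃ (e : G.Q ≃ Fin (Nat.card G.Q)) (l : List (G.Q × Action d × G.Q)),
    l.Nodup ∧ (∀ t, t ∈ l ↔ t ∈ G.T) ∧
    w = encNat (Nat.card G.Q) ++ encNat (e G.qin) ++ encNat (e G.qout) ++
      (l.map (encTrans e)).flatten ++ [Sym.close]

/-- `w` presents the KLM sequence `ξ`: the dimension, then the triples, each but the first
preceded by `link` and the action that leads to it. -/
def KLM.Encodes {d : ℕ} (ξ : KLM.{u} d) (w : List Sym) : Prop :=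
  ∃ g : Fin (ξ.k + 1) → List Sym, (∀ j, (ξ.G j).Encodes (g j)) ∧
    w = encNat d ++ (encConfig (ξ.x 0) ++ g 0 ++ encConfig (ξ.y 0)) ++
      (List.ofFn fun j : Fin ξ.k => Sym.link :: (encAction (ξ.a j) ++
        encConfig (ξ.x j.succ) ++ g j.succ ++ encConfig (ξ.y j.succ))).flatten

/-! ### Space-bounded computations of multi-stack Turing machines -/

/-- The space that a configuration of a machine occupies: the number of symbols on all its
stacks, the input and the output stack included. -/
def cfgSpace (tm : Turing.FinTM2) (c : tm.Cfg) : ℕ :=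
  letI := tm.kFin
  ∑ k : tm.K, (Turing.TM2.Cfg.stk c k).length

/-- From the input `w`, the machine halts with output `v`, and no configuration on the way
occupies more than `s` cells. -/
def ComputesInSpace (M : Turing.TM2ComputableAux Sym Sym) (w v : List Sym) (s : ℕ) : Prop :=
  Nonempty (Turing.TM2Outputs M.tm (w.map M.inputAlphabet.symm)
    (some (v.map M.outputAlphabet.symm))) ∧
  ∀ c, StateTransition.Reaches M.tm.step
    (Turing.initList M.tm (w.map M.inputAlphabet.symm)) c → cfgSpace M.tm c ≤ s

end KLMReach

/-! The proof has a combinatorial half and a machine half.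

Existence. Models of the characteristic system are the nonnegative solutions of an integer linear
system whose homogenizing variable is 1. Siegel's lemma yields a small model `h`. By Dickson's
lemma, saturation and unboundedness become positivity of homogeneous solutions, so there is also a
small homogeneous solution `h₀` that is positive on all transitions and all `ω` components.
Pumpability and Rackoff's argument (`exists_short_cover`) give short cycles `u` at the input state
and `v` at the output state of each VASS: `u` raises every finite component that is not fixed, and
`v` does so when read backwards. For large `K`, the circulation `K φ₀` minus the Parikh images of
`u` and `v` is positive, hence by strong connectivity the Parikh image of a cycle `w`; likewise `φ +
φ₀` is that of a complete path `π`. The path `u ^ p w ^ p π v ^ p` has Parikh image `φ + (p K + 1)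
φ₀`. For large `p` it can be fired: the components that are not fixed are at least `p` after `u ^ p`
and before `v ^ p`, which is more than `w` and `π` can lose, and the fixed components are governed
by the state through rigidity (`exists_pumped_path`). Since the multiple `p K + 1` is the same in
all triples, `h + (p K + 1) h₀` is a model and the pieces fit together (`exists_realized`). The
bound is computed in `witness_bound`.

Machine. A deterministic search enumerates the words of choices over two symbols by increasing
length. For each of them it runs a trial, which guesses the first vector and the paths as the
choices dictate. In a trial every symbol written on a counter or on the result is paid for with one
choice. So a trial always halts, and it needs no more space than the input and the choices it was
given. The model above provides a successful word of choices of length at most `ell ξ.size`, so the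
search stops there at the latest; its result is no longer than the choices, which bounds both the
word and the space.

The machine is written in a small structured language with a big-step semantics `Exec` and is
compiled into a Turing machine (`sim`). Programs are verified by weakest preconditions with a
separate condition `F` for failure: `F = True` (failure is harmless) expresses soundness, and `F =
False` (failure is impossible) expresses completeness. -/

namespace KLMReach

/-! ### Small nonnegative solutions of homogeneous integer systems -/

section LinearAlgebra
open Matrix

/-- A nonzero rational-dependency of the columns gives a small integer one (Siegel's lemma). -/
theorem exists_small_kernel {ρ ι : Type*} [Fintype ρ] [Fintype ι] (A : Matrix ρ ι ℤ) (b : ℕ)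
    (hb : 1 ≤ b) (hA : ∀ r c, |A r c| ≤ b) (x : ι → ℤ) (hx : x ≠ 0) (hAx : A *ᵥ x = 0) :
    ∃ t : ι → ℤ, t ≠ 0 ∧ A *ᵥ t = 0 ∧ ∀ c, |t c| ≤ ((Fintype.card ι * b) ^ Fintype.card ι : ℕ) := by
  classical
  set rows : ρ → ι → ℚ := fun r c => (A r c : ℚ) with hrows
  -- Siegel's lemma needs fewer equations than unknowns. A maximal independent family of rows has
  -- the same kernel, and the nonzero vector `x` in this kernel forces the family to be smaller than
  -- the number of columns.
  obtain ⟨S, hSsub, hSspan, hSind⟩ := exists_linearIndependent ℚ (Set.range rows)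
  have hSfin : S.Finite := (Set.finite_range rows).subset hSsub
  have : Fintype S := hSfin.fintype
  have hrep : ∀ v : S, ∃ r, rows r = v := fun v => hSsub v.2
  choose f hf using hrep
  have hker : ∀ t : ι → ℤ, (∀ v : S, ∑ c, A (f v) c * t c = 0) → A *ᵥ t = 0 := by
    intro t ht
    have key : ∀ w ∈ Submodule.span ℚ S, ∑ c, w c * (t c : ℚ) = 0 := by
      intro w hw
      induction hw using Submodule.span_induction with
      | mem w hw =>
        have := ht ⟨w, hw⟩
        have h2 := hf ⟨w, hw⟩
        have h3 : (∑ c, (A (f ⟨w, hw⟩) c : ℚ) * (t c : ℚ)) = 0 := by exact_mod_cast this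
        simp only at h2
        rw [← h2]; exact h3
      | zero => simp
      | add a b _ _ ha hb => simp only [Pi.add_apply, add_mul, Finset.sum_add_distrib, ha, hb, add_zero]
      | smul q a _ ha => simp only [Pi.smul_apply, smul_eq_mul, mul_assoc, ← Finset.mul_sum, ha, mul_zero]
    ext r
    have := key (rows r) (by rw [hSspan]; exact Submodule.subset_span ⟨r, rfl⟩)
    simp only [mulVec, dotProduct, Pi.zero_apply]
    have h3 : ((∑ c, A r c * t c : ℤ) : ℚ) = 0 := by push_cast; exact this
    exact_mod_cast h3
  have hcard : Fintype.card S < Fintype.card ι := by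
    have hle : Fintype.card S ≤ Fintype.card ι := by
      have := hSind.fintype_card_le_finrank
      simpa using this
    refine lt_of_le_of_ne hle fun heq => hx ?_
    have htop : Submodule.span ℚ S = ⊤ := by
      have := hSind.span_eq_top_of_card_eq_finrank' (by simpa using heq)
      simpa using this
    have key : ∀ w ∈ Submodule.span ℚ S, ∑ c, w c * (x c : ℚ) = 0 := by
      intro w hw
      induction hw using Submodule.span_induction with
      | mem w hw =>
        have h2 := hf ⟨w, hw⟩
        have := congrFun hAx (f ⟨w, hw⟩)
        simp only [mulVec, dotProduct, Pi.zero_apply] at this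
        have h3 : (∑ c, (A (f ⟨w, hw⟩) c : ℚ) * (x c : ℚ)) = 0 := by exact_mod_cast this
        simp only at h2
        rw [← h2]; exact h3
      | zero => simp
      | add a b _ _ ha hb => simp only [Pi.add_apply, add_mul, Finset.sum_add_distrib, ha, hb, add_zero]
      | smul q a _ ha => simp only [Pi.smul_apply, smul_eq_mul, mul_assoc, ← Finset.mul_sum, ha, mul_zero]
    ext c
    have := key (Pi.single c 1) (by rw [htop]; trivial)
    simpa [Pi.single_apply] using this
  have hN : 1 ≤ Fintype.card ι := by omega
  -- Siegel's lemma also needs at least one equation; with none, a unit vector will do.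
  rcases Nat.eq_zero_or_pos (Fintype.card S) with h0 | hpos
  · have : IsEmpty S := Fintype.card_eq_zero_iff.mp h0
    obtain ⟨c⟩ : Nonempty ι := Fintype.card_pos_iff.mp hN
    refine ⟨Pi.single c 1, by simp, hker _ fun v => isEmptyElim v, fun c' => ?_⟩
    have h1 : (1 : ℤ) ≤ ((Fintype.card ι * b) ^ Fintype.card ι : ℕ) := by
      exact_mod_cast Nat.one_le_pow _ _ (Nat.mul_pos hN hb)
    by_cases hc : c' = c
    · subst hc; simpa using h1
    · simp only [Pi.single_apply, hc, if_false, abs_zero]; omega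
  · let : SeminormedAddCommGroup (Matrix S ι ℤ) := Matrix.seminormedAddCommGroup
    obtain ⟨t, ht0, hAt, htn⟩ := Int.Matrix.exists_ne_zero_int_vec_norm_le
      (Matrix.of fun (v : S) c => A (f v) c) hcard hpos
    refine ⟨t, ht0, hker t fun v => ?_, fun c => ?_⟩
    · have := congrFun hAt v
      simpa [mulVec, dotProduct] using this
    · have h1 : (|t c| : ℝ) ≤ ‖t‖ := by
        have := norm_le_pi_norm t c
        rwa [Int.norm_eq_abs] at this
      have hbase : (Fintype.card ι : ℝ) * max 1 ‖Matrix.of fun (v : S) c => A (f v) c‖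
          ≤ Fintype.card ι * b := by
        refine mul_le_mul_of_nonneg_left (max_le (by exact_mod_cast hb) ?_) (by positivity)
        refine (Matrix.norm_le_iff (by positivity)).mpr fun v c => ?_
        rw [Int.norm_eq_abs]
        exact_mod_cast hA (f v) c
      have hb1 : (1 : ℝ) ≤ Fintype.card ι * b := by exact_mod_cast Nat.mul_pos hN hb
      -- The exponent `m / (n - m)` of Siegel's lemma is at most `m`, since `n - m ≥ 1`.
      have hexp : (Fintype.card S : ℝ) / (Fintype.card ι - Fintype.card S) ≤ Fintype.card ι := by
        have h2 : (1 : ℝ) ≤ Fintype.card ι - Fintype.card S := by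
          have : (Fintype.card S + 1 : ℝ) ≤ Fintype.card ι := by exact_mod_cast hcard
          linarith
        calc (Fintype.card S : ℝ) / (Fintype.card ι - Fintype.card S) ≤ Fintype.card S :=
              div_le_self (by positivity) h2
          _ ≤ _ := by exact_mod_cast hcard.le
      have h3 : (|t c| : ℝ) ≤ (Fintype.card ι * b : ℝ) ^ (Fintype.card ι : ℝ) := by
        refine h1.trans (htn.trans ?_)
        calc _ ≤ ((Fintype.card ι : ℝ) * b) ^ ((Fintype.card S : ℝ) / (Fintype.card ι - Fintype.card S)) := by
              refine Real.rpow_le_rpow (by positivity) hbase ?_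
              have : (Fintype.card S : ℝ) ≤ Fintype.card ι := by exact_mod_cast hcard.le
              exact div_nonneg (by positivity) (by linarith)
          _ ≤ _ := Real.rpow_le_rpow_of_exponent_le hb1 hexp
      rw [Real.rpow_natCast] at h3
      exact_mod_cast h3

/-- Subtracting from `x` a multiple of `t` kills a component and keeps `x` nonnegative. -/
theorem exists_reduction {ι : Type*} [Fintype ι] (x t : ι → ℤ)
    (hx : ∀ c, 0 ≤ x c) (hsupp : ∀ c, x c = 0 → t c = 0) (hpos : ∃ c, 0 < t c) :
    ∃ c₀, 0 < t c₀ ∧ 0 < x c₀ ∧ ∀ c, 0 ≤ t c₀ * x c - x c₀ * t c := by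
  classical
  obtain ⟨c₁, hc₁⟩ := hpos
  have hxp : ∀ c, 0 < t c → 0 < x c := fun c hc =>
    lt_of_le_of_ne (hx c) fun h => by rw [hsupp c h.symm] at hc; exact lt_irrefl _ hc
  -- The pivot maximizes `t / x`: it is the first component to vanish when growing multiples of `t`
  -- are subtracted from `x`. The factor `t c₀` on `x` keeps the combination integral.
  obtain ⟨c₀, hc₀, hmax⟩ := (Finset.univ.filter fun c => 0 < t c).exists_max_image
    (fun c => (t c : ℚ) / x c) ⟨c₁, by simpa using hc₁⟩
  simp only [Finset.mem_filter, Finset.mem_univ, true_and] at hc₀ hmax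
  refine ⟨c₀, hc₀, hxp _ hc₀, fun c => ?_⟩
  rcases lt_or_ge 0 (t c) with h | h
  · have h1 := hmax c h
    rw [div_le_div_iff₀ (by exact_mod_cast hxp c h) (by exact_mod_cast hxp _ hc₀)] at h1
    have : t c * x c₀ ≤ t c₀ * x c := by exact_mod_cast h1
    linarith [mul_comm (t c) (x c₀)]
  · have := mul_nonneg hc₀.le (hx c)
    have := mul_nonpos_of_nonneg_of_nonpos (hxp _ hc₀).le h
    linarith

theorem mulVec_reduction {ρ ι : Type*} [Fintype ι] (A : Matrix ρ ι ℤ) (x t : ι → ℤ) (α β : ℤ)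
    (hx : A *ᵥ x = 0) (ht : A *ᵥ t = 0) : A *ᵥ (fun c => α * x c - β * t c) = 0 := by
  have : (fun c => α * x c - β * t c) = α • x - β • t := by ext c; simp
  rw [this, mulVec_sub, mulVec_smul, mulVec_smul, hx, ht]; simp

/-- Every component of a nonnegative solution is covered by a small nonnegative solution. -/
theorem exists_small_nonneg {ρ ι : Type*} [Fintype ρ] [Fintype ι] (A : Matrix ρ ι ℤ) (b : ℕ)
    (hb : 1 ≤ b) (hA : ∀ r c, |A r c| ≤ b) (x : ι → ℤ) (hx : ∀ c, 0 ≤ x c) (hAx : A *ᵥ x = 0)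
    (c : ι) (hc : 0 < x c) :
    ∃ t : ι → ℤ, A *ᵥ t = 0 ∧ 0 < t c ∧ (∀ c', x c' = 0 → t c' = 0) ∧
      ∀ c', 0 ≤ t c' ∧ t c' ≤ ((Fintype.card ι * b) ^ Fintype.card ι : ℕ) := by
  classical
  induction hn : (Finset.univ.filter fun c => x c ≠ 0).card using Nat.strong_induction_on
    generalizing x with
  | _ n ih =>
  -- If `t c ≤ 0`, subtracting a multiple of `t` keeps the component `c` positive while it kills
  -- another one, so induction on the support applies.
  have step : ∀ t : ι → ℤ, A *ᵥ t = 0 → (∀ c', x c' = 0 → t c' = 0) → t c ≤ 0 → (∃ c', 0 < t c') →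
      ∃ t : ι → ℤ, A *ᵥ t = 0 ∧ 0 < t c ∧ (∀ c', x c' = 0 → t c' = 0) ∧
      ∀ c', 0 ≤ t c' ∧ t c' ≤ ((Fintype.card ι * b) ^ Fintype.card ι : ℕ) := by
    intro t hAt hsupp htc hpos
    obtain ⟨c₀, h1, h2, h3⟩ := exists_reduction x t hx hsupp hpos
    have hz : ∀ c', x c' = 0 → t c₀ * x c' - x c₀ * t c' = 0 := fun c' h => by
      simp [h, hsupp c' h]
    have hlt : (Finset.univ.filter fun c => t c₀ * x c - x c₀ * t c ≠ 0).card < n := by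
      rw [← hn]
      refine Finset.card_lt_card ⟨fun c' h => ?_, fun h => ?_⟩
      · simp only [Finset.mem_filter, Finset.mem_univ, true_and] at h ⊢
        exact fun h' => h (hz c' h')
      · have := h (show c₀ ∈ _ by simpa using h2.ne')
        simp only [Finset.mem_filter, Finset.mem_univ, true_and] at this
        exact this (by ring)
    obtain ⟨t', ht1, ht2, ht3, ht4⟩ := ih _ hlt (fun c => t c₀ * x c - x c₀ * t c) h3
      (mulVec_reduction A x t _ _ hAx hAt)
      (by have := mul_pos h1 hc; have := mul_nonpos_of_nonneg_of_nonpos h2.le htc; linarith) rfl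
    exact ⟨t', ht1, ht2, fun c' h => ht3 c' (hz c' h), ht4⟩
  have hsum : ∀ g : ι → ℤ, (∀ c, x c = 0 → g c = 0) → ∑ c : {c // x c ≠ 0}, g c = ∑ c, g c := by
    intro g hg
    rw [← Finset.sum_filter_of_ne (p := fun c => x c ≠ 0) (f := g) (fun c _ h h' => h (hg c h'))]
    exact (Finset.sum_subtype _ (by simp) _).symm
  -- Only the columns in the support of `x` are kept, so that `t` vanishes where `x` does. If `t`
  -- has constant sign and `t c ≠ 0`, then `t` or `-t` is the solution sought; otherwise one of them
  -- satisfies the hypotheses of `step`.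
  obtain ⟨t₀, ht0, hAt0, htb⟩ := exists_small_kernel
    (Matrix.of fun r (c : {c // x c ≠ 0}) => A r c) b hb
    (fun r c => hA r c) (fun c => x c) (fun h => hc.ne' (congrFun h ⟨c, hc.ne'⟩)) (by
      rw [← hAx]; ext r
      exact hsum (fun c => A r c * x c) fun c h => by simp [h])
  set t : ι → ℤ := fun c => if h : x c ≠ 0 then t₀ ⟨c, h⟩ else 0 with ht
  have htv : ∀ c : {c // x c ≠ 0}, t c = t₀ c := fun c => by simp [ht, c.2]
  have hsupp : ∀ c', x c' = 0 → t c' = 0 := fun c' h => by simp [ht, h]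
  have hAt : A *ᵥ t = 0 := by
    rw [← hAt0]; ext r
    refine (hsum (fun c => A r c * t c) fun c h => by simp [hsupp c h]).symm.trans ?_
    simp only [mulVec, dotProduct, Matrix.of_apply, htv]
  have htne : ∃ c', t c' ≠ 0 := by
    by_contra! h
    exact ht0 (funext fun c => by rw [← htv, h]; rfl)
  have hbd : ∀ c', |t c'| ≤ ((Fintype.card ι * b) ^ Fintype.card ι : ℕ) := by
    intro c'
    by_cases h : x c' = 0
    · rw [hsupp c' h]; simp only [abs_zero]; positivity
    · refine (htv ⟨c', h⟩ ▸ htb ⟨c', h⟩).trans ?_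
      have h1 : Fintype.card {c // x c ≠ 0} ≤ Fintype.card ι := Fintype.card_subtype_le _
      have h2 : 1 ≤ Fintype.card ι := Fintype.card_pos_iff.mpr ⟨c⟩
      exact_mod_cast (Nat.pow_le_pow_left (Nat.mul_le_mul_right b h1) _).trans
        (Nat.pow_le_pow_right (Nat.mul_pos h2 hb) h1)
  have hneg : A *ᵥ (-t) = 0 := by rw [mulVec_neg, hAt, neg_zero]
  by_cases hp : ∃ c', 0 < t c'
  · by_cases hq : ∃ c', t c' < 0
    · rcases le_total (t c) 0 with h | h
      · exact step t hAt hsupp h hp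
      · exact step (-t) hneg (fun c' h' => by simp [hsupp c' h']) (by simpa using h)
          (by simpa using hq)
    · push Not at hq
      rcases (hq c).eq_or_lt with h | h
      · exact step t hAt hsupp h.ge hp
      · exact ⟨t, hAt, h, hsupp, fun c' => ⟨hq c', (le_abs_self _).trans (hbd c')⟩⟩
  · push Not at hp
    rcases (hp c).eq_or_lt with h | h
    · refine step (-t) hneg (fun c' h' => by simp [hsupp c' h']) (by simp [h]) ?_
      obtain ⟨c', hc'⟩ := htne
      exact ⟨c', by have := lt_of_le_of_ne (hp c') hc'; simpa using this⟩
    · exact ⟨-t, hneg, by simpa using h, fun c' h' => by simp [hsupp c' h'],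
        fun c' => ⟨by simpa using hp c', (neg_le_abs _).trans (hbd c')⟩⟩

/-- Every nonnegative solution is, after scaling, dominated by a combination of small solutions
below it, with coefficients that are at most the scaling factor if the solution is minimal. -/
theorem le_of_minimal {ρ ι : Type*} [Fintype ρ] [Fintype ι] (A : Matrix ρ ι ℤ) (b : ℕ)
    (hb : 1 ≤ b) (hA : ∀ r c, |A r c| ≤ b) (z : ι) (y : ι → ℤ) (hyz : y z = 1)
    (hmin : ∀ t : ι → ℤ, A *ᵥ t = 0 → (∀ c, 0 ≤ t c) → (∀ c, t c ≤ y c) → t z = 0 → t = 0)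
    (M : ℤ) (hM : 0 < M) (x : ι → ℤ) (hx : ∀ c, 0 ≤ x c)
    (hxy : ∀ c, x c ≤ M * y c) (hAx : A *ᵥ x = 0) :
    ∀ c, x c ≤ M * ((Finset.univ.filter fun c => x c ≠ 0).card *
      ((Fintype.card ι * b) ^ Fintype.card ι : ℕ)) := by
  classical
  set D : ℕ := (Fintype.card ι * b) ^ Fintype.card ι with hD
  induction hn : (Finset.univ.filter fun c => x c ≠ 0).card using Nat.strong_induction_on
    generalizing x M with
  | _ n ih =>
  by_cases hx0 : ∃ c, 0 < x c
  swap
  · push Not at hx0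
    intro c
    exact (hx0 c).trans (by positivity)
  obtain ⟨c₁, hc₁⟩ := hx0
  obtain ⟨t, hAt, htc, hsupp, htb⟩ := exists_small_nonneg A b hb hA x hx hAx c₁ hc₁
  obtain ⟨c₀, h1, h2, h3⟩ := exists_reduction x t hx hsupp ⟨c₁, htc⟩
  -- the coefficient of `t` in `x` is at most `M`
  have hcoef : x c₀ ≤ M * t c₀ := by
    by_contra! hlt
    -- A coefficient above `M` would give `M * t ≤ x ≤ M * y`, hence `t ≤ y`. If `t z = 0` this
    -- contradicts minimality; if `t z ≥ 1` then `x z` would exceed `M`.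
    by_cases hz : t z = 0
    · have : t = 0 := hmin t hAt (fun c => (htb c).1) (fun c => ?_) hz
      · rw [this] at htc; exact lt_irrefl _ htc
      · have e1 := h3 c
        have e2 := hxy c
        by_contra! h5
        have e3 : M * t c₀ * t c ≤ x c₀ * t c := mul_le_mul_of_nonneg_right hlt.le (htb c).1
        have e4 : t c₀ * x c ≤ t c₀ * (M * y c) := mul_le_mul_of_nonneg_left e2 h1.le
        have e5 : t c₀ * M * (y c - t c) < 0 := mul_neg_of_pos_of_neg (mul_pos h1 hM) (by linarith)
        nlinarith
    · have hz1 : 1 ≤ t z := Int.add_one_le_iff.mpr (lt_of_le_of_ne (htb z).1 (Ne.symm hz))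
      have e1 := h3 z
      have e2 := hxy z
      rw [hyz, mul_one] at e2
      have e3 : x c₀ * 1 ≤ x c₀ * t z := mul_le_mul_of_nonneg_left hz1 h2.le
      have e4 : t c₀ * x z ≤ t c₀ * M := mul_le_mul_of_nonneg_left e2 h1.le
      linarith [mul_comm M (t c₀)]
  have hlt : (Finset.univ.filter fun c => t c₀ * x c - x c₀ * t c ≠ 0).card < n := by
    rw [← hn]
    refine Finset.card_lt_card ⟨fun c' h => ?_, fun h => ?_⟩
    · simp only [Finset.mem_filter, Finset.mem_univ, true_and] at h ⊢
      exact fun h' => h (by simp [h', hsupp c' h'])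
    · have := h (show c₀ ∈ _ by simpa using h2.ne')
      simp only [Finset.mem_filter, Finset.mem_univ, true_and] at this
      exact this (by ring)
  -- The remainder carries the factor `t c₀` that keeps it integral, so the scale becomes `M * t
  -- c₀`. The component lost from the support pays for the removed multiple of `t`.
  have hrec := ih _ hlt (M * t c₀) (mul_pos hM h1) (fun c => t c₀ * x c - x c₀ * t c) h3
    (fun c => by
      have e1 : t c₀ * x c ≤ t c₀ * (M * y c) := mul_le_mul_of_nonneg_left (hxy c) h1.le
      have e2 := mul_nonneg h2.le (htb c).1
      linarith [mul_comm M (t c₀), mul_assoc M (t c₀) (y c), mul_left_comm (t c₀) M (y c)])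
    (mulVec_reduction A x t _ _ hAx hAt) rfl
  intro c
  have e1 := hrec c
  have e2 : x c₀ * t c ≤ M * t c₀ * D :=
    mul_le_mul hcoef (htb c).2 (htb c).1 (mul_pos hM h1).le
  set n' := (Finset.univ.filter fun c => t c₀ * x c - x c₀ * t c ≠ 0).card
  have e3 : (n' : ℤ) + 1 ≤ n := by exact_mod_cast hlt
  have e4 : t c₀ * x c ≤ t c₀ * (M * (n * D)) := by
    have e5 : M * t c₀ * ((n' + 1) * (D : ℤ)) ≤ M * t c₀ * (n * D) :=
      mul_le_mul_of_nonneg_left (mul_le_mul_of_nonneg_right e3 (by positivity)) (mul_pos hM h1).le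
    have e6 : M * t c₀ * ((n' + 1) * (D : ℤ)) = M * t c₀ * (n' * D) + M * t c₀ * D := by ring
    have e7 : M * t c₀ * (n * (D : ℤ)) = t c₀ * (M * (n * D)) := by ring
    linarith
  exact le_of_mul_le_mul_left e4 h1

end LinearAlgebra
end KLMReach

/-! ### The homogenized characteristic system and its small solutions -/

namespace KLMReach
namespace KLM

variable {d : ℕ} (ξ : KLM.{u} d)

/-- The size without the factor that depends on the dimension. -/
noncomputable def weight : ℕ :=
  ξ.k + ∑ j, actionNorm (ξ.a j) +
    ∑ j, (configNorm (ξ.x j) + (ξ.G j).size + configNorm (ξ.y j))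

/-- The solutions of the homogeneous characteristic system. -/
structure IsHomogeneous (h : ξ.CharSeq) : Prop where
  m_eq : ∀ j i, ξ.x j i ≠ ⊤ → h.m j i = 0
  circulation : ∀ j (r : (ξ.G j).Q), ∑ t : {t // t ∈ (ξ.G j).T},
    (h.φ j t : ℤ) * ((ξ.G j).ind t.1.2.2 r - (ξ.G j).ind t.1.1 r) = 0
  displacement : ∀ j i, (h.n j i : ℤ) = (h.m j i : ℤ) + (ξ.G j).displacement (h.φ j) i
  n_eq : ∀ j i, ξ.y j i ≠ ⊤ → h.n j i = 0
  link : ∀ (j : Fin ξ.k) i, h.n j.castSucc i = h.m j.succ i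

/-- The variables of the homogenized characteristic system. -/
abbrev Var : Type u :=
  Option ((Fin (ξ.k + 1) × Fin d) ⊕ (Fin (ξ.k + 1) × Fin d) ⊕ (Σ j, {t // t ∈ (ξ.G j).T}))

/-- The equations of the homogenized characteristic system. -/
abbrev Eqn : Type u :=
  (Fin (ξ.k + 1) × Fin d) ⊕ (Fin (ξ.k + 1) × Fin d) ⊕ (Fin (ξ.k + 1) × Fin d) ⊕
    (Σ j, (ξ.G j).Q) ⊕ (Fin ξ.k × Fin d)

noncomputable instance : Fintype (Σ j, (ξ.G j).Q) := Fintype.ofFinite _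

open Classical in
/-- The matrix of the homogenized characteristic system. -/
noncomputable def sysMatrix : Matrix ξ.Eqn ξ.Var ℤ
  | .inl (j, i), none => if ξ.x j i = ⊤ then 0 else -((ξ.x j i).toNat : ℤ)
  | .inl (j, i), some (.inl c) => if ξ.x j i = ⊤ then 0 else if c = (j, i) then 1 else 0
  | .inl _, some (.inr _) => 0
  | .inr (.inl (j, i)), none => if ξ.y j i = ⊤ then 0 else -((ξ.y j i).toNat : ℤ)
  | .inr (.inl _), some (.inl _) => 0
  | .inr (.inl (j, i)), some (.inr (.inl c)) =>
    if ξ.y j i = ⊤ then 0 else if c = (j, i) then 1 else 0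
  | .inr (.inl _), some (.inr (.inr _)) => 0
  | .inr (.inr (.inl _)), none => 0
  | .inr (.inr (.inl e)), some (.inl c) => if c = e then -1 else 0
  | .inr (.inr (.inl e)), some (.inr (.inl c)) => if c = e then 1 else 0
  | .inr (.inr (.inl (j, i))), some (.inr (.inr ⟨j', t⟩)) => if j' = j then -t.1.2.1 i else 0
  | .inr (.inr (.inr (.inl e))), none =>
    (if e = ⟨e.1, (ξ.G e.1).qin⟩ then 1 else 0) - (if e = ⟨e.1, (ξ.G e.1).qout⟩ then 1 else 0)
  | .inr (.inr (.inr (.inl _))), some (.inl _) => 0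
  | .inr (.inr (.inr (.inl _))), some (.inr (.inl _)) => 0
  | .inr (.inr (.inr (.inl e))), some (.inr (.inr ⟨j', t⟩)) =>
    (if e = ⟨j', t.1.2.2⟩ then 1 else 0) - (if e = ⟨j', t.1.1⟩ then 1 else 0)
  | .inr (.inr (.inr (.inr (j, i)))), none => ξ.a j i
  | .inr (.inr (.inr (.inr (j, i)))), some (.inl c) => if c = (j.succ, i) then -1 else 0
  | .inr (.inr (.inr (.inr (j, i)))), some (.inr (.inl c)) => if c = (j.castSucc, i) then 1 else 0
  | .inr (.inr (.inr (.inr _))), some (.inr (.inr _)) => 0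

open Matrix in
-- The variable `none` multiplies the constants of the system: the value 1 yields the characteristic
-- system and the value 0 its homogeneous part, so that one matrix serves for both.
theorem sysMatrix_mulVec_iff (v : ξ.Var → ℤ) : ξ.sysMatrix *ᵥ v = 0 ↔
    (∀ j i, ξ.x j i ≠ ⊤ → v (some (.inl (j, i))) = (ξ.x j i).toNat * v none) ∧
    (∀ j i, ξ.y j i ≠ ⊤ → v (some (.inr (.inl (j, i)))) = (ξ.y j i).toNat * v none) ∧
    (∀ j i, v (some (.inr (.inl (j, i)))) = v (some (.inl (j, i))) +
      ∑ t : {t // t ∈ (ξ.G j).T}, v (some (.inr (.inr ⟨j, t⟩))) * t.1.2.1 i) ∧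
    (∀ j (r : (ξ.G j).Q), ∑ t : {t // t ∈ (ξ.G j).T}, v (some (.inr (.inr ⟨j, t⟩))) *
      ((ξ.G j).ind t.1.2.2 r - (ξ.G j).ind t.1.1 r) =
        ((ξ.G j).ind (ξ.G j).qout r - (ξ.G j).ind (ξ.G j).qin r) * v none) ∧
    (∀ (j : Fin ξ.k) i, v (some (.inl (j.succ, i))) =
      v (some (.inr (.inl (j.castSucc, i)))) + ξ.a j i * v none) := by
  classical
  rw [funext_iff, Sum.forall, Sum.forall, Sum.forall, Sum.forall]
  simp only [Prod.forall, Sigma.forall]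
  refine and_congr ?_ (and_congr ?_ (and_congr ?_ (and_congr ?_ ?_)))
  · refine forall_congr' fun j => forall_congr' fun i => ?_
    simp only [mulVec, dotProduct, Fintype.sum_option, Fintype.sum_sum_type, sysMatrix, Pi.zero_apply]
    by_cases h : ξ.x j i = ⊤
    · simp [h]
    · simp only [h, if_false, ite_mul, one_mul, zero_mul, Finset.sum_ite_eq', Finset.mem_univ, if_true,
        Finset.sum_const_zero, add_zero, ne_eq, not_false_eq_true, forall_true_left]
      constructor <;> intro h' <;> linarith
  · refine forall_congr' fun j => forall_congr' fun i => ?_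
    simp only [mulVec, dotProduct, Fintype.sum_option, Fintype.sum_sum_type, sysMatrix, Pi.zero_apply]
    by_cases h : ξ.y j i = ⊤
    · simp [h]
    · simp only [h, if_false, ite_mul, one_mul, zero_mul, Finset.sum_ite_eq', Finset.mem_univ, if_true,
        Finset.sum_const_zero, add_zero, zero_add, ne_eq, not_false_eq_true, forall_true_left]
      constructor <;> intro h' <;> linarith
  · refine forall_congr' fun j => forall_congr' fun i => ?_
    simp only [mulVec, dotProduct, Fintype.sum_option, Fintype.sum_sum_type, sysMatrix, Pi.zero_apply,
      Fintype.sum_sigma, ite_mul, one_mul, zero_mul, Finset.sum_ite_eq', Finset.mem_univ, if_true]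
    rw [Finset.sum_eq_single j (fun j' _ h => by simp [h]) (by simp)]
    simp only [if_true, neg_mul, Finset.sum_neg_distrib, mul_comm]
    constructor <;> intro h' <;> linarith
  · refine forall_congr' fun j => forall_congr' fun r => ?_
    simp only [mulVec, dotProduct, Fintype.sum_option, Fintype.sum_sum_type, sysMatrix, Pi.zero_apply,
      Fintype.sum_sigma, zero_mul, Finset.sum_const_zero, zero_add]
    rw [Finset.sum_eq_single j (fun j' _ h => Finset.sum_eq_zero fun t _ => by simp [Ne.symm h])
      (by simp)]
    simp only [Sigma.mk.injEq, true_and, heq_eq_eq, VASS.ind, mul_comm]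
    constructor <;> intro h' <;> linarith
  · refine forall_congr' fun j => forall_congr' fun i => ?_
    simp only [mulVec, dotProduct, Fintype.sum_option, Fintype.sum_sum_type, sysMatrix, Pi.zero_apply,
      ite_mul, one_mul, zero_mul, Finset.sum_ite_eq', Finset.mem_univ, if_true, Finset.sum_const_zero]
    constructor <;> intro h' <;> linarith

theorem one_le_size_vass (G : VASS.{u} d) : 1 ≤ Nat.card G.Q := by
  have : Nonempty G.Q := ⟨G.qin⟩
  exact Nat.card_pos

theorem weight_ge (j : Fin (ξ.k + 1)) :
    configNorm (ξ.x j) + (ξ.G j).size + configNorm (ξ.y j) ≤ ξ.weight := by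
  have := Finset.single_le_sum (f := fun j => configNorm (ξ.x j) + (ξ.G j).size + configNorm (ξ.y j))
    (fun _ _ => Nat.zero_le _) (Finset.mem_univ j)
  unfold weight; omega

theorem actionNorm_le_weight (j : Fin ξ.k) : actionNorm (ξ.a j) ≤ ξ.weight := by
  have := Finset.single_le_sum (f := fun j => actionNorm (ξ.a j))
    (fun _ _ => Nat.zero_le _) (Finset.mem_univ j)
  unfold weight; omega

theorem natAbs_le_actionNorm (a : Action d) (i : Fin d) : (a i).natAbs ≤ actionNorm a :=
  Finset.single_le_sum (f := fun i => (a i).natAbs) (fun _ _ => Nat.zero_le _) (Finset.mem_univ i)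

theorem toNat_le_configNorm (x : Config d) (i : Fin d) : (x i).toNat ≤ configNorm x :=
  Finset.single_le_sum (f := fun i => (x i).toNat) (fun _ _ => Nat.zero_le _) (Finset.mem_univ i)

theorem actionNorm_le_size (G : VASS.{u} d) {t} (ht : t ∈ G.T) : actionNorm t.2.1 + 2 ≤ G.size := by
  have := Finset.single_le_sum (f := fun t : G.Q × Action d × G.Q => actionNorm t.2.1)
    (fun _ _ => Nat.zero_le _) ht
  have h1 := one_le_size_vass G
  have h2 : 1 ≤ G.T.card := Finset.card_pos.mpr ⟨t, ht⟩
  unfold VASS.size; omega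

theorem one_le_weight : 1 ≤ ξ.weight := by
  have := ξ.weight_ge 0
  have h1 := one_le_size_vass (ξ.G 0)
  unfold VASS.size at this; omega

theorem abs_sysMatrix_le (r : ξ.Eqn) (c : ξ.Var) : |ξ.sysMatrix r c| ≤ ξ.weight := by
  classical
  have h1 : (1 : ℤ) ≤ ξ.weight := by exact_mod_cast ξ.one_le_weight
  have h0 : (0 : ℤ) ≤ ξ.weight := by omega
  have hind : ∀ (p q : Prop) [Decidable p] [Decidable q],
      |(if p then (1 : ℤ) else 0) - (if q then 1 else 0)| ≤ ξ.weight := by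
    intro p q _ _
    split_ifs
    · rw [sub_self, abs_zero]; exact h0
    · rw [sub_zero, abs_one]; exact h1
    · rw [zero_sub, abs_neg, abs_one]; exact h1
    · rw [sub_self, abs_zero]; exact h0
  have hx : ∀ j i, ((ξ.x j i).toNat : ℤ) ≤ ξ.weight := fun j i => by
    have := ξ.weight_ge j; have := toNat_le_configNorm (ξ.x j) i
    omega
  have hy : ∀ j i, ((ξ.y j i).toNat : ℤ) ≤ ξ.weight := fun j i => by
    have := ξ.weight_ge j; have := toNat_le_configNorm (ξ.y j) i
    omega
  have hz : |(0 : ℤ)| ≤ ξ.weight := by rw [abs_zero]; exact h0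
  have ho : |(1 : ℤ)| ≤ ξ.weight := by rw [abs_one]; exact h1
  have hm : |(-1 : ℤ)| ≤ ξ.weight := by rw [abs_neg]; exact ho
  have hite : ∀ (p : Prop) [Decidable p] (a b : ℤ), |a| ≤ ξ.weight → |b| ≤ ξ.weight →
      |if p then a else b| ≤ ξ.weight := by
    intro p _ a b ha hb
    split_ifs
    · exact ha
    · exact hb
  have hx' : ∀ j i, |-((ξ.x j i).toNat : ℤ)| ≤ ξ.weight := fun j i => by
    rw [abs_neg, Nat.abs_cast]; exact hx j i
  have hy' : ∀ j i, |-((ξ.y j i).toNat : ℤ)| ≤ ξ.weight := fun j i => by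
    rw [abs_neg, Nat.abs_cast]; exact hy j i
  have ht : ∀ j (t : {t // t ∈ (ξ.G j).T}) i, |-t.1.2.1 i| ≤ ξ.weight := fun j t i => by
    have e1 := ξ.weight_ge j
    have e2 := actionNorm_le_size (ξ.G j) t.2
    have e3 := natAbs_le_actionNorm t.1.2.1 i
    rw [abs_neg, Int.abs_eq_natAbs]
    omega
  have ha : ∀ j i, |ξ.a j i| ≤ ξ.weight := fun j i => by
    have e1 := ξ.actionNorm_le_weight j
    have e3 := natAbs_le_actionNorm (ξ.a j) i
    rw [Int.abs_eq_natAbs]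
    omega
  exact match r, c with
  | .inl (j, i), none => hite _ _ _ hz (hx' j i)
  | .inl (j, i), some (.inl c) => hite _ _ _ hz (hite _ _ _ ho hz)
  | .inl _, some (.inr _) => hz
  | .inr (.inl (j, i)), none => hite _ _ _ hz (hy' j i)
  | .inr (.inl _), some (.inl _) => hz
  | .inr (.inl (j, i)), some (.inr (.inl c)) => hite _ _ _ hz (hite _ _ _ ho hz)
  | .inr (.inl _), some (.inr (.inr _)) => hz
  | .inr (.inr (.inl _)), none => hz
  | .inr (.inr (.inl e)), some (.inl c) => hite _ _ _ hm hz
  | .inr (.inr (.inl e)), some (.inr (.inl c)) => hite _ _ _ ho hz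
  | .inr (.inr (.inl (j, i))), some (.inr (.inr ⟨j', t⟩)) => hite _ _ _ (ht j' t i) hz
  | .inr (.inr (.inr (.inl e))), none => hind _ _
  | .inr (.inr (.inr (.inl _))), some (.inl _) => hz
  | .inr (.inr (.inr (.inl _))), some (.inr (.inl _)) => hz
  | .inr (.inr (.inr (.inl e))), some (.inr (.inr ⟨j', t⟩)) => hind _ _
  | .inr (.inr (.inr (.inr (j, i)))), none => ha j i
  | .inr (.inr (.inr (.inr (j, i)))), some (.inl c) => hite _ _ _ hm hz
  | .inr (.inr (.inr (.inr (j, i)))), some (.inr (.inl c)) => hite _ _ _ ho hz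
  | .inr (.inr (.inr (.inr _))), some (.inr (.inr _)) => hz

/-- Every triple has at least one state, so the weight exceeds the number of transitions by at least
`k + 1`. This also leaves room for the homogenizing variable. -/
theorem card_var_le : Fintype.card ξ.Var ≤ (2 * d + 1) * ξ.weight := by
  have h1 : ∑ j, (1 + (ξ.G j).T.card) ≤ ξ.weight - ξ.k := by
    have : ∑ j, (1 + (ξ.G j).T.card) ≤
        ∑ j, (configNorm (ξ.x j) + (ξ.G j).size + configNorm (ξ.y j)) := by
      refine Finset.sum_le_sum fun j _ => ?_
      have := one_le_size_vass (ξ.G j)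
      unfold VASS.size; omega
    unfold weight; omega
  rw [Finset.sum_add_distrib] at h1
  simp only [Finset.sum_const, Finset.card_univ, Fintype.card_fin, smul_eq_mul, mul_one] at h1
  simp only [Fintype.card_option, Fintype.card_sum, Fintype.card_prod, Fintype.card_fin,
    Fintype.card_sigma, Fintype.card_coe]
  have h2 : (ξ.k + 1) * d ≤ ξ.weight * d := Nat.mul_le_mul_right _ (by omega)
  have h3 : (2 * d + 1) * ξ.weight = ξ.weight * d + ξ.weight * d + ξ.weight := by ring
  omega

variable {ξ}

/-- The vector of a characteristic sequence, with value `z` for the homogenizing variable. -/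
def toVec (z : ℤ) (h : ξ.CharSeq) : ξ.Var → ℤ
  | none => z
  | some (.inl (j, i)) => h.m j i
  | some (.inr (.inl (j, i))) => h.n j i
  | some (.inr (.inr ⟨j, t⟩)) => h.φ j t

/-- The characteristic sequence of a vector. -/
def ofVec (v : ξ.Var → ℤ) : ξ.CharSeq where
  m j i := (v (some (.inl (j, i)))).toNat
  n j i := (v (some (.inr (.inl (j, i))))).toNat
  φ j t := (v (some (.inr (.inr ⟨j, t⟩)))).toNat

theorem toVec_ofVec (v : ξ.Var → ℤ) (hv : ∀ c, 0 ≤ v c) : toVec (v none) (ofVec v) = v := by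
  funext c
  match c with
  | none => rfl
  | some (.inl (j, i)) => exact Int.toNat_of_nonneg (hv _)
  | some (.inr (.inl (j, i))) => exact Int.toNat_of_nonneg (hv _)
  | some (.inr (.inr ⟨j, t⟩)) => exact Int.toNat_of_nonneg (hv _)

theorem toVec_nonneg {z : ℤ} (hz : 0 ≤ z) (h : ξ.CharSeq) (c : ξ.Var) : 0 ≤ toVec z h c := by
  match c with
  | none => exact hz
  | some (.inl (j, i)) => exact Int.natCast_nonneg _
  | some (.inr (.inl (j, i))) => exact Int.natCast_nonneg _
  | some (.inr (.inr ⟨j, t⟩)) => exact Int.natCast_nonneg _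

theorem sqLe_natCast_iff (m : ℕ) (x : ℕ∞) : SqLe m x ↔ (x ≠ ⊤ → m = x.toNat) := by
  induction x using ENat.recTopCoe with
  | top => simp [SqLe]
  | coe n => simp [SqLe, eq_comm]

theorem step_finConfig_iff (n m : Fin d → ℕ) (a : Action d) :
    Step (finConfig n) a (finConfig m) ↔ ∀ i, (m i : ℤ) = n i + a i := by
  refine forall_congr' fun i => ?_
  simp only [AddRel, finConfig, ENat.natCast_ne_top, false_and, false_or]
  constructor
  · rintro ⟨p, q, h1, h2, h3⟩
    rw [ENat.natCast_inj] at h1 h2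
    subst h1 h2; exact h3
  · exact fun h => ⟨_, _, rfl, rfl, h⟩

open Matrix in
theorem isModel_iff (h : ξ.CharSeq) : ξ.IsModel h ↔ ξ.sysMatrix *ᵥ toVec 1 h = 0 := by
  rw [sysMatrix_mulVec_iff]
  simp only [toVec, mul_one, Nat.cast_inj]
  constructor
  · rintro ⟨h1, h2, h3, h4, h5⟩
    exact ⟨fun j i => (sqLe_natCast_iff _ _).1 (h1 j i), fun j i => (sqLe_natCast_iff _ _).1 (h4 j i),
      h3, fun j r => (h2 j r).symm, fun j => (step_finConfig_iff _ _ _).1 (h5 j)⟩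
  · rintro ⟨h1, h2, h3, h4, h5⟩
    exact ⟨fun j i => (sqLe_natCast_iff _ _).2 (h1 j i), fun j r => (h4 j r).symm, h3,
      fun j i => (sqLe_natCast_iff _ _).2 (h2 j i), fun j => (step_finConfig_iff _ _ _).2 (h5 j)⟩

open Matrix in
theorem isHomogeneous_iff (h : ξ.CharSeq) : ξ.IsHomogeneous h ↔ ξ.sysMatrix *ᵥ toVec 0 h = 0 := by
  rw [sysMatrix_mulVec_iff]
  simp only [toVec, mul_zero, Nat.cast_eq_zero, add_zero, Nat.cast_inj]
  constructor
  · rintro ⟨h1, h2, h3, h4, h5⟩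
    exact ⟨h1, h4, h3, h2, fun j i => (h5 j i).symm⟩
  · rintro ⟨h1, h2, h3, h4, h5⟩
    exact ⟨h1, h4, h3, h2, fun j i => (h5 j i).symm⟩

/-- The bound on the components of small solutions of the characteristic system. -/
noncomputable def solBound (ξ : KLM.{u} d) : ℕ :=
  Fintype.card ξ.Var * (Fintype.card ξ.Var * ξ.weight) ^ Fintype.card ξ.Var

open Matrix in
/-- A satisfiable characteristic system has a small model. -/
theorem exists_small_model (hsat : ξ.Satisfiable) :
    ∃ h, ξ.IsModel h ∧ ∀ c, toVec 1 h c ≤ ξ.solBound := by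
  classical
  -- A model with the least sum of components: subtracting a nonzero homogeneous solution below it
  -- would give a smaller model. This is the minimality that `le_of_minimal` asks for, with `M = 1`.
  obtain ⟨h, hh, hmin⟩ := (measure fun h : ξ.CharSeq => (∑ c, toVec 1 h c).toNat).wf.has_min
    {h | ξ.IsModel h} hsat
  refine ⟨h, hh, fun c => ?_⟩
  have hh' := (isModel_iff h).1 hh
  have h0 := toVec_nonneg zero_le_one h
  refine (le_of_minimal ξ.sysMatrix ξ.weight ξ.one_le_weight ξ.abs_sysMatrix_le none (toVec 1 h) rfl
    (fun t hAt ht0 hth htz => ?_) 1 one_pos (toVec 1 h) h0 (by simp) hh' c).trans ?_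
  · by_contra hne
    have hv : toVec 1 (ofVec (toVec 1 h - t)) = toVec 1 h - t := by
      have := toVec_ofVec (toVec 1 h - t) (fun c => by simpa using hth c)
      rwa [Pi.sub_apply, htz, sub_zero] at this
    refine hmin (ofVec (toVec 1 h - t)) ?_ ?_
    · rw [Set.mem_ofPred_eq, isModel_iff, hv, mulVec_sub, hh', hAt, sub_zero]
    · have hpos : 0 < ∑ c, t c := by
        obtain ⟨c, hc⟩ := Function.ne_iff.1 hne
        exact Finset.sum_pos' (fun c _ => ht0 c) ⟨c, Finset.mem_univ _, lt_of_le_of_ne (ht0 c) (Ne.symm hc)⟩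
      have hle : ∑ c, t c ≤ ∑ c, toVec 1 h c := Finset.sum_le_sum fun c _ => hth c
      change (∑ c, toVec 1 (ofVec (toVec 1 h - t)) c).toNat < (∑ c, toVec 1 h c).toNat
      rw [hv]
      simp only [Pi.sub_apply, Finset.sum_sub_distrib]
      omega
  · rw [one_mul, solBound]
    push_cast
    refine mul_le_mul_of_nonneg_right ?_ (by positivity)
    exact_mod_cast Finset.card_le_univ _

open Matrix in
/-- A component that is unbounded over the models is positive in some homogeneous solution. -/
theorem exists_homogeneous_pos (c : ξ.Var)
    (hc : ∀ b : ℕ, ∃ h, ξ.IsModel h ∧ (b : ℤ) < toVec 1 h c) :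
    ∃ v : ξ.Var → ℤ, (∀ c, 0 ≤ v c) ∧ ξ.sysMatrix *ᵥ v = 0 ∧ v none = 0 ∧ 0 < v c := by
  choose f hf hfc using hc
  -- Dickson's lemma: the models have a monotone subsequence, and the difference of two of its
  -- members solves the homogeneous system.
  obtain ⟨g, hg⟩ := (wellQuasiOrdered_le (α := ξ.Var → ℕ)).exists_monotone_subseq
    (f := fun n c => (toVec 1 (f n) c).toNat)
  -- This index is at least the value of the first model at `c`, while the model with index `w` has
  -- a value above `w` there.
  set w := g (toVec 1 (f (g 0)) c).toNat
  refine ⟨toVec 1 (f w) - toVec 1 (f (g 0)), fun c' => ?_, ?_, by simp [toVec], ?_⟩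
  · have h1 : (toVec 1 (f (g 0)) c').toNat ≤ (toVec 1 (f w) c').toNat :=
      hg 0 _ (Nat.zero_le (toVec 1 (f (g 0)) c).toNat) c'
    have h2 := toVec_nonneg zero_le_one (f (g 0)) c'
    have h3 := toVec_nonneg zero_le_one (f w) c'
    simp only [Pi.sub_apply]
    omega
  · rw [mulVec_sub, (isModel_iff _).1 (hf _), (isModel_iff _).1 (hf _), sub_zero]
  · have h1 := hfc w
    have h2 : (toVec 1 (f (g 0)) c).toNat ≤ w := g.strictMono.le_apply
    simp only [Pi.sub_apply]
    omega

open Matrix in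
/-- There is a small homogeneous solution that is positive wherever models are unbounded. -/
theorem exists_small_homogeneous :
    ∃ h, ξ.IsHomogeneous h ∧ (∀ c, toVec 0 h c ≤ ξ.solBound) ∧
      ∀ c, (∀ b : ℕ, ∃ h, ξ.IsModel h ∧ (b : ℤ) < toVec 1 h c) → 0 < toVec 0 h c := by
  classical
  set D : ℕ := (Fintype.card ξ.Var * ξ.weight) ^ Fintype.card ξ.Var with hD
  have key : ∀ c : ξ.Var, ∃ t : ξ.Var → ℤ, ξ.sysMatrix *ᵥ t = 0 ∧ t none = 0 ∧
      (∀ c, 0 ≤ t c ∧ t c ≤ D) ∧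
      ((∀ b : ℕ, ∃ h, ξ.IsModel h ∧ (b : ℤ) < toVec 1 h c) → 0 < t c) := by
    intro c
    by_cases hc : ∀ b : ℕ, ∃ h, ξ.IsModel h ∧ (b : ℤ) < toVec 1 h c
    · obtain ⟨v, hv0, hAv, hvz, hvc⟩ := exists_homogeneous_pos c hc
      obtain ⟨t, h1, h2, h3, h4⟩ :=
        exists_small_nonneg ξ.sysMatrix ξ.weight ξ.one_le_weight ξ.abs_sysMatrix_le v hv0 hAv c hvc
      exact ⟨t, h1, h3 _ hvz, h4, fun _ => h2⟩
    · exact ⟨0, by simp, rfl, fun c => ⟨le_rfl, by simp⟩, fun h => absurd h hc⟩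
  choose t hAt htz htb htp using key
  -- One small solution for each variable is added up, which costs the extra factor `card Var` in
  -- `solBound`.
  have h0 : ∀ c, 0 ≤ (∑ c', t c') c := fun c => by
    rw [Finset.sum_apply]; exact Finset.sum_nonneg fun c' _ => (htb c' c).1
  have hv : toVec 0 (ofVec (∑ c', t c')) = ∑ c', t c' := by
    have := toVec_ofVec (∑ c', t c') h0
    rwa [Finset.sum_apply, Finset.sum_eq_zero fun c _ => htz c] at this
  refine ⟨ofVec (∑ c', t c'), ?_, fun c => ?_, fun c hc => ?_⟩
  · rw [isHomogeneous_iff, hv, mulVec_sum, Finset.sum_eq_zero fun c _ => hAt c]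
  · rw [hv, Finset.sum_apply]
    refine (Finset.sum_le_card_nsmul _ _ _ fun c' _ => (htb c' c).2).trans ?_
    simp [solBound, hD]
  · rw [hv, Finset.sum_apply]
    exact Finset.sum_pos' (fun c' _ => (htb c' c).1) ⟨c, Finset.mem_univ _, htp c hc⟩

/-- Adding multiples of a homogeneous solution to a model. -/
def CharSeq.addMul (h : ξ.CharSeq) (p : ℕ) (h₀ : ξ.CharSeq) : ξ.CharSeq where
  m j i := h.m j i + p * h₀.m j i
  φ j t := h.φ j t + p * h₀.φ j t
  n j i := h.n j i + p * h₀.n j i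

open Matrix in
theorem IsModel.addMul {h h₀ : ξ.CharSeq} (hh : ξ.IsModel h) (hh₀ : ξ.IsHomogeneous h₀) (p : ℕ) :
    ξ.IsModel (h.addMul p h₀) := by
  rw [isModel_iff] at hh ⊢
  rw [isHomogeneous_iff] at hh₀
  have : toVec 1 (h.addMul p h₀) = toVec 1 h + (p : ℤ) • toVec 0 h₀ := by
    funext c
    match c with
    | none => simp [toVec]
    | some (.inl (j, i)) => simp [toVec, CharSeq.addMul]
    | some (.inr (.inl (j, i))) => simp [toVec, CharSeq.addMul]
    | some (.inr (.inr ⟨j, t⟩)) => simp [toVec, CharSeq.addMul]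
  rw [this, mulVec_add, mulVec_smul, hh, hh₀]; simp

end KLM
end KLMReach

/-! ### Unit flows and Eulerian paths -/

namespace KLMReach
namespace VASS

variable {d : ℕ} {G : VASS.{u} d}

theorem path_append {p q : G.Q} {π₁ π₂ : List (G.Q × Action d × G.Q)} :
    G.Path p (π₁ ++ π₂) q ↔ ∃ r, G.Path p π₁ r ∧ G.Path r π₂ q := by
  induction π₁ generalizing p with
  | nil => simp [Path]
  | cons t π₁ ih =>
    simp only [List.cons_append, Path, ih]
    constructor
    · rintro ⟨h1, h2, r, h3, h4⟩
      exact ⟨r, ⟨h1, h2, h3⟩, h4⟩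
    · rintro ⟨r, ⟨h1, h2, h3⟩, h4⟩
      exact ⟨h1, h2, r, h3, h4⟩

theorem Path.append {p q r : G.Q} {π₁ π₂ : List (G.Q × Action d × G.Q)}
    (h₁ : G.Path p π₁ q) (h₂ : G.Path q π₂ r) : G.Path p (π₁ ++ π₂) r :=
  path_append.2 ⟨q, h₁, h₂⟩

theorem Path.mem {p q : G.Q} {π : List (G.Q × Action d × G.Q)} (h : G.Path p π q) :
    ∀ t ∈ π, t ∈ G.T := by
  induction π generalizing p with
  | nil => simp
  | cons t π ih =>
    intro t' ht'
    rcases List.mem_cons.1 ht' with rfl | h'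
    · exact h.1
    · exact ih h.2.2 _ h'

/-- A cycle repeated `n` times. -/
theorem Path.replicate {p : G.Q} {π : List (G.Q × Action d × G.Q)} (h : G.Path p π p) (n : ℕ) :
    G.Path p (List.replicate n π).flatten p := by
  induction n with
  | zero => rfl
  | succ n ih => rw [List.replicate_succ, List.flatten_cons]; exact h.append ih

open Classical in
/-- `φ` carries one unit from `p` to `q`. -/
def Flow (G : VASS.{u} d) (φ : G.Q × Action d × G.Q → ℕ) (p q : G.Q) : Prop :=
  ∀ r, G.ind q r - G.ind p r = ∑ t ∈ G.T, (φ t : ℤ) * (G.ind t.2.2 r - G.ind t.1 r)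

open Classical in
theorem sum_count_mul {M : Type*} [CommRing M] (T : Finset (G.Q × Action d × G.Q))
    (π : List (G.Q × Action d × G.Q)) (hπ : ∀ t ∈ π, t ∈ T) (w : G.Q × Action d × G.Q → M) :
    ∑ t ∈ T, (π.count t : M) * w t = (π.map w).sum := by
  induction π with
  | nil => simp
  | cons s π ih =>
    rw [List.map_cons, List.sum_cons, ← ih fun t ht => hπ t (List.mem_cons_of_mem _ ht)]
    simp only [List.count_cons, Nat.cast_add, add_mul, Finset.sum_add_distrib]
    rw [add_comm]
    congr 1
    rw [Finset.sum_eq_single s (fun t _ h => by simp [Ne.symm h])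
      (fun h => absurd (hπ s List.mem_cons_self) h)]
    simp

theorem Path.sum_ind {p q : G.Q} {π : List (G.Q × Action d × G.Q)} (h : G.Path p π q) (r : G.Q) :
    (π.map fun t => G.ind t.2.2 r - G.ind t.1 r).sum = G.ind q r - G.ind p r := by
  induction π generalizing p with
  | nil => cases h; simp
  | cons t π ih =>
    obtain ⟨_, rfl, h⟩ := h
    rw [List.map_cons, List.sum_cons, ih h]; ring

open Classical in
theorem Path.flow {p q : G.Q} {π : List (G.Q × Action d × G.Q)} (h : G.Path p π q) :
    G.Flow (fun t => π.count t) p q := fun r => by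
  rw [sum_count_mul G.T π h.mem, h.sum_ind]

open Classical in
theorem sum_update_pred {φ : G.Q × Action d × G.Q → ℕ} {t : G.Q × Action d × G.Q} (ht : t ∈ G.T)
    (hφ : 0 < φ t) (w : G.Q × Action d × G.Q → ℤ) :
    ∑ s ∈ G.T, (Function.update φ t (φ t - 1) s : ℤ) * w s = (∑ s ∈ G.T, (φ s : ℤ) * w s) - w t := by
  rw [← Finset.add_sum_erase _ _ ht, ← Finset.add_sum_erase _ (fun s => (φ s : ℤ) * w s) ht]
  have : ∑ s ∈ G.T.erase t, (Function.update φ t (φ t - 1) s : ℤ) * w s =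
      ∑ s ∈ G.T.erase t, (φ s : ℤ) * w s :=
    Finset.sum_congr rfl fun s hs => by rw [Function.update_of_ne (Finset.ne_of_mem_erase hs)]
  rw [this, Function.update_self, Nat.cast_sub hφ]
  push_cast; ring

open Classical in
theorem Flow.update {φ : G.Q × Action d × G.Q → ℕ} {t : G.Q × Action d × G.Q} {q : G.Q}
    (hf : G.Flow φ t.1 q) (ht : t ∈ G.T) (hφ : 0 < φ t) :
    G.Flow (Function.update φ t (φ t - 1)) t.2.2 q := fun r => by
  rw [sum_update_pred ht hφ, ← hf r]; ring

open Classical in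
/-- A unit flow contains a path. -/
theorem Flow.exists_path {φ : G.Q × Action d × G.Q → ℕ} {p q : G.Q} (hf : G.Flow φ p q) :
    ∃ π, G.Path p π q ∧ ∀ t ∈ G.T, π.count t ≤ φ t := by
  induction hn : ∑ t ∈ G.T, φ t using Nat.strong_induction_on generalizing φ p with
  | _ n ih =>
  by_cases hex : ∃ t ∈ G.T, t.1 = p ∧ 0 < φ t
  · obtain ⟨t, ht, rfl, hφ⟩ := hex
    have hlt : ∑ s ∈ G.T, Function.update φ t (φ t - 1) s < n := by
      have := sum_update_pred ht hφ (fun _ => 1)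
      simp only [mul_one] at this
      zify; rw [this, ← hn]; push_cast; omega
    obtain ⟨π, h1, h2⟩ := ih _ hlt (hf.update ht hφ) rfl
    refine ⟨t :: π, ⟨ht, rfl, h1⟩, fun s hs => ?_⟩
    have := h2 s hs
    by_cases hst : s = t
    · subst hst
      rw [Function.update_self] at this
      rw [List.count_cons_self]; omega
    · rw [Function.update_of_ne hst] at this
      rwa [List.count_cons_of_ne (Ne.symm hst)]
  · push Not at hex
    have h := hf p
    -- If no flow leaves `p`, the net inflow at `p` is nonnegative, whereas it would be -1 for `p ≠
    -- q`. So the path has arrived.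
    have h1 : 0 ≤ ∑ t ∈ G.T, (φ t : ℤ) * (G.ind t.2.2 p - G.ind t.1 p) := by
      refine Finset.sum_nonneg fun t ht => ?_
      by_cases htp : t.1 = p
      · have := hex t ht htp
        simp [Nat.le_zero.1 this]
      · refine mul_nonneg (by positivity) ?_
        simp only [ind, Ne.symm htp, if_false, sub_zero]
        split_ifs <;> simp
    have hpq : p = q := by
      by_contra hne
      simp only [ind] at h h1
      rw [if_neg hne, if_pos trivial] at h
      omega
    exact ⟨[], hpq, fun t _ => by simp⟩

/-- The form in which strong connectivity enters the Euler argument, with `S` the set of the states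
on a path. -/
theorem StronglyConnected.forall_of_closed (hG : G.StronglyConnected) (S : G.Q → Prop) {p : G.Q}
    (hp : S p) (hS : ∀ t ∈ G.T, S t.1 → S t.2.2) (q : G.Q) : S q := by
  obtain ⟨π, hπ⟩ := hG p q
  induction π generalizing p with
  | nil => cases hπ; exact hp
  | cons t π ih =>
    obtain ⟨h1, rfl, h3⟩ := hπ
    exact ih (hS t h1 hp) h3

open Classical in
/-- In a strongly connected graph, a unit flow that uses all the transitions is the Parikh image of
a path. -/
theorem exists_path_of_flow (hG : G.StronglyConnected) {φ : G.Q × Action d × G.Q → ℕ} {p q : G.Q}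
    (hf : G.Flow φ p q) (hφ : ∀ t ∈ G.T, 0 < φ t) :
    ∃ π, G.Path p π q ∧ ∀ t ∈ G.T, π.count t = φ t := by
  obtain ⟨π, hπ, hc⟩ := hf.exists_path
  induction hn : ∑ t ∈ G.T, (φ t - π.count t) using Nat.strong_induction_on generalizing π with
  | _ n ih =>
  by_cases hall : ∀ t ∈ G.T, π.count t = φ t
  · exact ⟨π, hπ, hall⟩
  -- Otherwise all transitions that leave visited states are used up, hence occur on the path since
  -- `φ` is positive. The visited states are then closed under transitions, so all states are
  -- visited and no flow is left over.
  have hex : ∃ t ∈ G.T, π.count t < φ t ∧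
      ∃ π₁ π₂, π = π₁ ++ π₂ ∧ G.Path p π₁ t.1 ∧ G.Path t.1 π₂ q := by
    by_contra hno
    push Not at hno
    refine hall fun t ht => ?_
    have hvis := hG.forall_of_closed
      (fun r => ∃ π₁ π₂, π = π₁ ++ π₂ ∧ G.Path p π₁ r ∧ G.Path r π₂ q)
      (p := p) ⟨[], π, rfl, rfl, hπ⟩ (fun s hs ⟨π₁, π₂, h1, h2, h3⟩ => ?_) t.1
    · obtain ⟨π₁, π₂, h1, h2, h3⟩ := hvis
      by_contra hne
      exact hno t ht (lt_of_le_of_ne (hc t ht) hne) π₁ π₂ h1 h2 h3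
    · have hmem : s ∈ π := by
        rw [← List.count_pos_iff]
        by_contra hz
        exact hno s hs (by have := hφ s hs; omega) π₁ π₂ h1 h2 h3
      obtain ⟨l₁, l₂, rfl⟩ := List.append_of_mem hmem
      obtain ⟨r, hr1, _, rfl, hr3⟩ := path_append.1 hπ
      exact ⟨l₁ ++ [s], l₂, by simp, hr1.append ⟨hs, rfl, rfl⟩, hr3⟩
  obtain ⟨t, ht, hlt, π₁, π₂, rfl, h1, h2⟩ := hex
  -- The unused part of `φ` is a circulation. Without one unit on `t` it carries a unit from the
  -- target of `t` to its source, so it contains a path that closes a cycle through `t`. This cycle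
  -- is spliced in.
  have hres : G.Flow (fun s => φ s - (π₁ ++ π₂).count s) t.1 t.1 := fun r => by
    have e1 := hf r
    rw [hπ.flow r] at e1
    rw [sub_self, ← sub_eq_zero.2 e1.symm, ← Finset.sum_sub_distrib]
    refine Finset.sum_congr rfl fun s hs => ?_
    rw [Nat.cast_sub (hc s hs)]; ring
  obtain ⟨c, hc1, hc2⟩ := (hres.update ht (by omega)).exists_path
  have hcount : ∀ s ∈ G.T, (π₁ ++ t :: c ++ π₂).count s ≤ φ s := by
    intro s hs
    have e1 := hc2 s hs
    have e2 := hc s hs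
    simp only [List.count_append, List.count_cons] at e1 e2 hlt ⊢
    by_cases hst : s = t
    · subst hst
      rw [Function.update_self] at e1
      simp only [beq_self_eq_true, if_true]
      omega
    · rw [Function.update_of_ne hst] at e1
      simp only [beq_iff_eq, Ne.symm hst, if_false]
      omega
  refine ih _ ?_ (π₁ ++ t :: c ++ π₂) ((h1.append (π₂ := t :: c) ⟨ht, rfl, hc1⟩).append h2) hcount rfl
  rw [← hn]
  refine Finset.sum_lt_sum (fun s _ => ?_) ⟨t, ht, ?_⟩
  · simp only [List.count_append, List.count_cons]; omega
  · simp only [List.count_append, List.count_cons, beq_self_eq_true, if_true] at hlt ⊢; omega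

end VASS
end KLMReach

/-! ### Nonnegative partial sums, and Rackoff's bound on covering paths -/

namespace KLMReach

/-- All the partial sums of `v` and the elements of a list are nonnegative. -/
def NonnegAlong : ℤ → List ℤ → Prop
  | v, [] => 0 ≤ v
  | v, a :: L => 0 ≤ v ∧ NonnegAlong (v + a) L

namespace NonnegAlong

@[simp] theorem nil_iff {v : ℤ} : NonnegAlong v [] ↔ 0 ≤ v := Iff.rfl

theorem start {v : ℤ} {L : List ℤ} (h : NonnegAlong v L) : 0 ≤ v := by
  cases L with
  | nil => exact h
  | cons a L => exact h.1

theorem append_iff {v : ℤ} {L₁ L₂ : List ℤ} :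
    NonnegAlong v (L₁ ++ L₂) ↔ NonnegAlong v L₁ ∧ NonnegAlong (v + L₁.sum) L₂ := by
  induction L₁ generalizing v with
  | nil => simpa using fun h => NonnegAlong.start h
  | cons a L₁ ih => simp [NonnegAlong, ih, and_assoc, add_assoc]

theorem mono {v w : ℤ} {L : List ℤ} (h : NonnegAlong v L) (hvw : v ≤ w) : NonnegAlong w L := by
  induction L generalizing v w with
  | nil => exact le_trans h hvw
  | cons a L ih => exact ⟨h.1.trans hvw, ih h.2 (by linarith)⟩

theorem end_nonneg {v : ℤ} {L : List ℤ} (h : NonnegAlong v L) : 0 ≤ v + L.sum := by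
  have : NonnegAlong v (L ++ []) := by rwa [List.append_nil]
  exact (append_iff.1 this).2

/-- The reversed list with negated entries runs through the same partial sums from the end to the
start. -/
theorem reverse {v : ℤ} {L : List ℤ} (h : NonnegAlong v L) :
    NonnegAlong (v + L.sum) (L.reverse.map Neg.neg) := by
  induction L generalizing v with
  | nil => simpa using h
  | cons a L ih =>
    simp only [List.reverse_cons, List.map_append, append_iff, List.sum_cons]
    refine ⟨by simpa [add_assoc] using ih h.2, ?_⟩
    have hs : ((L.reverse).map Neg.neg).sum = -L.sum := by
      rw [List.map_reverse, List.sum_reverse]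
      exact (List.sum_neg L).symm ▸ rfl
    rw [hs]
    simp only [List.map_cons, List.map_nil, NonnegAlong]
    have := h.2.start
    exact ⟨by linarith, by linarith [h.1]⟩

/-- Starting high enough, the partial sums stay nonnegative. -/
theorem of_start {A : ℕ} {v : ℤ} {L : List ℤ} (hL : ∀ a ∈ L, |a| ≤ A) (hv : A * L.length ≤ v) :
    NonnegAlong v L := by
  induction L generalizing v with
  | nil => simpa using hv
  | cons a L ih =>
    rw [List.length_cons] at hv
    push_cast at hv
    have h1 := neg_le_of_abs_le (hL a List.mem_cons_self)
    have h2 : (0 : ℤ) ≤ A * L.length := by positivity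
    exact ⟨by linarith [Int.natCast_nonneg A], ih (fun b hb => hL b (List.mem_cons_of_mem _ hb)) (by linarith)⟩

theorem abs_sum_le {A : ℕ} {L : List ℤ} (hL : ∀ a ∈ L, |a| ≤ A) : |L.sum| ≤ A * L.length := by
  induction L with
  | nil => simp
  | cons a L ih =>
    rw [List.sum_cons, List.length_cons]
    have h1 := hL a List.mem_cons_self
    have h2 := ih fun b hb => hL b (List.mem_cons_of_mem _ hb)
    have h3 := abs_add_le a L.sum
    push_cast
    linarith

/-- Ending high enough, the partial sums stay nonnegative. -/
theorem of_end {A : ℕ} {v : ℤ} {L : List ℤ} (hL : ∀ a ∈ L, |a| ≤ A) (hv : A * L.length ≤ v + L.sum) :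
    NonnegAlong v L := by
  induction L generalizing v with
  | nil => simpa using hv
  | cons a L ih =>
    have h1 := le_of_abs_le (abs_sum_le hL)
    rw [List.length_cons, List.sum_cons] at *
    push_cast at *
    exact ⟨by linarith, ih (fun b hb => hL b (List.mem_cons_of_mem _ hb))
      (by linarith [Int.natCast_nonneg A])⟩

/-- Repetition of a list with high enough start and end. -/
theorem replicate_of_bounds {A : ℕ} {v : ℤ} {L : List ℤ} (hL : ∀ a ∈ L, |a| ≤ A) (n : ℕ)
    (hv : A * L.length ≤ v) (hv' : A * L.length ≤ v + n * L.sum) :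
    NonnegAlong v (List.replicate n L).flatten := by
  induction n generalizing v with
  | zero =>
    have h2 : (0 : ℤ) ≤ A * L.length := by positivity
    exact h2.trans hv
  | succ n ih =>
    rw [List.replicate_succ, List.flatten_cons, append_iff]
    refine ⟨of_start hL hv, ih ?_ ?_⟩
    · push_cast at hv'
      -- The levels at which the copies start and end form an arithmetic progression, so each is at
      -- least the lower of its two extremes.
      rcases le_total 0 L.sum with h | h
      · linarith
      · have : (n : ℤ) * L.sum ≤ 0 := mul_nonpos_of_nonneg_of_nonpos (by positivity) h
        linarith
    · push_cast at hv'; linarith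

/-- Repetition of a list with nonnegative sum. -/
theorem replicate_of_sum_nonneg {v : ℤ} {L : List ℤ} (h : NonnegAlong v L) (hs : 0 ≤ L.sum) (n : ℕ) :
    NonnegAlong v (List.replicate n L).flatten := by
  induction n generalizing v with
  | zero => exact h.start
  | succ n ih =>
    rw [List.replicate_succ, List.flatten_cons, append_iff]
    exact ⟨h, ih (h.mono (by linarith))⟩

/-- Repetition of a list with nonpositive sum, up to its last occurrence. -/
theorem replicate_of_sum_nonpos {v : ℤ} {L : List ℤ} (h : NonnegAlong v L) (hs : L.sum ≤ 0) (n : ℕ) :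
    NonnegAlong (v + L.sum - n * L.sum) (List.replicate n L).flatten := by
  induction n with
  | zero => simpa using h.end_nonneg
  | succ n ih =>
    rw [List.replicate_succ, List.flatten_cons, append_iff]
    refine ⟨h.mono ?_, ?_⟩
    · have : (n : ℤ) * L.sum ≤ 0 := mul_nonpos_of_nonneg_of_nonpos (by positivity) hs
      push_cast; linarith
    · convert ih using 1; push_cast; ring

end NonnegAlong

theorem sum_flatten_replicate (n : ℕ) (L : List ℤ) :
    (List.replicate n L).flatten.sum = n * L.sum := by
  induction n with
  | zero => simp
  | succ n ih => rw [List.replicate_succ, List.flatten_cons, List.sum_append, ih]; push_cast; ring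

namespace VASS

variable {d : ℕ} {G : VASS.{u} d}

/-- The values added to the component `i` along a word of transitions. -/
def vals {Q : Type u} (i : Fin d) (π : List (Q × Action d × Q)) : List ℤ := π.map fun t => t.2.1 i

@[simp] theorem vals_nil {Q : Type u} (i : Fin d) : vals i ([] : List (Q × Action d × Q)) = [] := rfl

@[simp] theorem vals_cons {Q : Type u} (i : Fin d) (t : Q × Action d × Q) (π) :
    vals i (t :: π) = t.2.1 i :: vals i π := rfl

@[simp] theorem vals_append {Q : Type u} (i : Fin d) (π₁ π₂ : List (Q × Action d × Q)) :
    vals i (π₁ ++ π₂) = vals i π₁ ++ vals i π₂ := List.map_append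

@[simp] theorem length_vals {Q : Type u} (i : Fin d) (π : List (Q × Action d × Q)) :
    (vals i π).length = π.length := List.length_map _

theorem vals_replicate {Q : Type u} (i : Fin d) (n : ℕ) (π : List (Q × Action d × Q)) :
    vals i (List.replicate n π).flatten = (List.replicate n (vals i π)).flatten := by
  simp [vals]

theorem Path.abs_vals_le {A : ℕ} (hA : ∀ t ∈ G.T, ∀ i, |t.2.1 i| ≤ A) {p q : G.Q}
    {π : List (G.Q × Action d × G.Q)} (h : G.Path p π q) (i : Fin d) : ∀ a ∈ vals i π, |a| ≤ A := by
  intro a ha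
  obtain ⟨t, ht, rfl⟩ := List.mem_map.1 ha
  exact hA t (h.mem t ht) i

/-- `π` leads from `p` to `q`; from `v` it keeps the components in `I` nonnegative and makes them at
least `c`. -/
def Covers (G : VASS.{u} d) (I : Finset (Fin d)) (c : Fin d → ℤ) (q : G.Q) (p : G.Q) (v : Fin d → ℤ)
    (π : List (G.Q × Action d × G.Q)) : Prop :=
  G.Path p π q ∧ ∀ i ∈ I, NonnegAlong (v i) (vals i π) ∧ c i ≤ v i + (vals i π).sum

/-- The configurations from which the transitions of a path are fired. -/
def visits : G.Q → (Fin d → ℤ) → List (G.Q × Action d × G.Q) → List (G.Q × (Fin d → ℤ))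
  | _, _, [] => []
  | p, v, t :: π => (p, v) :: visits t.2.2 (v + t.2.1) π

@[simp] theorem length_visits (p : G.Q) (v : Fin d → ℤ) (π : List (G.Q × Action d × G.Q)) :
    (visits p v π).length = π.length := by
  induction π generalizing p v with
  | nil => rfl
  | cons t π ih => simp [visits, ih]

theorem mem_visits {p : G.Q} {v : Fin d → ℤ} {π : List (G.Q × Action d × G.Q)} {q : G.Q}
    (hπ : G.Path p π q) {r : G.Q} {w : Fin d → ℤ} (h : (r, w) ∈ visits p v π) :
    ∃ α β, π = α ++ β ∧ G.Path p α r ∧ ∀ i, w i = v i + (vals i α).sum := by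
  induction π generalizing p v with
  | nil => simp [visits] at h
  | cons t π ih =>
    rcases List.mem_cons.1 h with h' | h'
    · cases h'
      exact ⟨[], t :: π, rfl, rfl, by simp⟩
    · obtain ⟨ht, rfl, hπ⟩ := hπ
      obtain ⟨α, β, rfl, h2, h3⟩ := ih hπ h'
      exact ⟨t :: α, β, rfl, ⟨ht, rfl, h2⟩, fun i => by simp [h3 i, add_assoc]⟩

theorem Covers.cons {I : Finset (Fin d)} {c : Fin d → ℤ} {q : G.Q} {t : G.Q × Action d × G.Q}
    (ht : t ∈ G.T) {v : Fin d → ℤ} (hv : ∀ i ∈ I, 0 ≤ v i) {π : List (G.Q × Action d × G.Q)}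
    (h : G.Covers I c q t.2.2 (v + t.2.1) π) : G.Covers I c q t.1 v (t :: π) :=
  ⟨⟨ht, rfl, h.1⟩, fun i hi => ⟨⟨hv i hi, (h.2 i hi).1⟩, by
    have := (h.2 i hi).2
    simpa [add_assoc] using this⟩⟩

theorem Covers.append {I : Finset (Fin d)} {c : Fin d → ℤ} {q p r : G.Q} {v w : Fin d → ℤ}
    {α β : List (G.Q × Action d × G.Q)} (hα : G.Path p α r)
    (hv : ∀ i ∈ I, NonnegAlong (v i) (vals i α)) (hw : ∀ i ∈ I, w i = v i + (vals i α).sum)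
    (h : G.Covers I c q r w β) : G.Covers I c q p v (α ++ β) :=
  ⟨hα.append h.1, fun i hi => by
    rw [vals_append, NonnegAlong.append_iff, ← hw i hi, List.sum_append, ← add_assoc, ← hw i hi]
    exact ⟨⟨hv i hi, (h.2 i hi).1⟩, (h.2 i hi).2⟩⟩

theorem covers_append {I : Finset (Fin d)} {c : Fin d → ℤ} {q p : G.Q} {v : Fin d → ℤ}
    {α β : List (G.Q × Action d × G.Q)} (h : G.Covers I c q p v (α ++ β)) :
    ∃ r, G.Path p α r ∧ (∀ i ∈ I, NonnegAlong (v i) (vals i α)) ∧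
      G.Covers I c q r (fun i => v i + (vals i α).sum) β := by
  obtain ⟨h1, h2⟩ := h
  obtain ⟨r, hr1, hr2⟩ := path_append.1 h1
  simp only [vals_append, NonnegAlong.append_iff, List.sum_append, ← add_assoc] at h2
  exact ⟨r, hr1, fun i hi => (h2 i hi).1.1, hr2, fun i hi => ⟨(h2 i hi).1.2, (h2 i hi).2⟩⟩

/-- A covering path of minimal length does not repeat a configuration. -/
theorem nodup_visits {I : Finset (Fin d)} {c : Fin d → ℤ} {q : G.Q}
    {π₁ π₂ : List (G.Q × Action d × G.Q)} {p : G.Q} {v : Fin d → ℤ}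
    (h : G.Covers I c q p v (π₁ ++ π₂))
    (hmin : ∀ π, G.Covers I c q p v π → (π₁ ++ π₂).length ≤ π.length) :
    ((visits p v π₁).map fun x => (x.1, fun i : I => x.2 i)).Nodup := by
  induction π₁ generalizing p v with
  | nil => simp [visits]
  | cons t π₁ ih =>
    obtain ⟨⟨ht, rfl, hp⟩, hc⟩ := h
    have htail : G.Covers I c q t.2.2 (v + t.2.1) (π₁ ++ π₂) :=
      ⟨hp, fun i hi => ⟨(hc i hi).1.2, by
        have := (hc i hi).2
        simpa [add_assoc] using this⟩⟩
    have hv : ∀ i ∈ I, 0 ≤ v i := fun i hi => (hc i hi).1.start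
    simp only [visits, List.map_cons, List.nodup_cons]
    refine ⟨fun hmem => ?_, ih htail fun π hπ => ?_⟩
    -- A configuration repeated on `I` closes a loop, and cutting the loop out leaves a shorter
    -- covering path.
    · obtain ⟨⟨r, w⟩, hmem, heq⟩ := List.mem_map.1 hmem
      simp only [Prod.mk.injEq] at heq
      obtain ⟨rfl, hw⟩ := heq
      obtain ⟨r', hr1, hr2⟩ := path_append.1 hp
      obtain ⟨α, β, rfl, h2, h3⟩ := mem_visits hr1 hmem
      rw [List.append_assoc] at htail
      obtain ⟨r'', -, -, h5⟩ := covers_append htail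
      have hr'' : G.Path t.1 (β ++ π₂) q := by
        have hp' : G.Path t.2.2 ((α ++ β) ++ π₂) q := hp
        rw [List.append_assoc] at hp'
        obtain ⟨r1, e1, e2⟩ := path_append.1 hp'
        have : ∀ {a b b' : G.Q} {l}, G.Path a l b → G.Path a l b' → b = b' := by
          intro a b b' l
          induction l generalizing a with
          | nil => intro h h'; exact h.symm.trans h'
          | cons s l ih => intro h h'; exact ih h.2.2 h'.2.2
        rwa [this e1 h2] at e2
      have h6 := hmin (β ++ π₂) ⟨hr'', fun i hi => by
        have e1 : w i = v i := congrFun hw ⟨i, hi⟩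
        have e2 := h5.2 i hi
        simp only [← h3 i] at e2
        rwa [e1] at e2⟩
      simp only [List.length_append, List.length_cons] at h6
      omega
    · have := hmin (t :: π) (hπ.cons ht hv)
      simpa using this

/-- The first configuration on a path with a large component in `I`. -/
theorem exists_first_large (I : Finset (Fin d)) (R : ℤ) {p q : G.Q} {v : Fin d → ℤ}
    {π : List (G.Q × Action d × G.Q)} (h : G.Path p π q) :
    ∃ π₁ π₂, π = π₁ ++ π₂ ∧ (∀ x ∈ visits p v π₁, ∀ i ∈ I, x.2 i < R) ∧
      (π₂ = [] ∨ ∃ i ∈ I, R ≤ v i + (vals i π₁).sum) := by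
  induction π generalizing p v with
  | nil => exact ⟨[], [], rfl, by simp [visits], Or.inl rfl⟩
  | cons t π ih =>
    by_cases hl : ∃ i ∈ I, R ≤ v i
    · exact ⟨[], t :: π, rfl, by simp [visits], Or.inr (by simpa using hl)⟩
    · push Not at hl
      obtain ⟨π₁, π₂, rfl, h2, h3⟩ := ih (v := v + t.2.1) h.2.2
      refine ⟨t :: π₁, π₂, rfl, ?_, ?_⟩
      · intro x hx
        rcases List.mem_cons.1 hx with rfl | hx
        · exact hl
        · exact h2 x hx
      · rcases h3 with h3 | ⟨i, hi, h3⟩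
        · exact Or.inl h3
        · exact Or.inr ⟨i, hi, by simpa [add_assoc] using h3⟩

/-- Rackoff's bound on the length of covering paths. -/
def coverBound (N A S : ℕ) : ℕ → ℕ
  | 0 => N
  | n + 1 => N * (A * coverBound N A S n + S) ^ (n + 1) + coverBound N A S n

/-- Rackoff's induction on the number of components in `I`. On a shortest path the configurations
are distinct on `I`, which bounds the part before some component reaches `A * B + S`, where `B` is
the bound for one component fewer. From then on that component can be ignored: a path of length at
most `B` lowers it by at most `A * B`, so it stays at `S` or above. -/
theorem exists_short_cover {A S : ℕ} (hA : ∀ t ∈ G.T, ∀ i, |t.2.1 i| ≤ A) {c : Fin d → ℤ}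
    (hc : ∀ i, c i ≤ S) (q : G.Q) (n : ℕ) (I : Finset (Fin d)) (hI : I.card = n)
    (p : G.Q) (v : Fin d → ℤ) (hex : ∃ π, G.Covers I c q p v π) :
    ∃ π, G.Covers I c q p v π ∧ π.length ≤ coverBound (Nat.card G.Q) A S n := by
  classical
  have : Fintype G.Q := Fintype.ofFinite _
  induction n generalizing I p v with
  | zero | succ n ih =>
    obtain ⟨π, hπ, hmin⟩ := (measure (List.length (α := G.Q × Action d × G.Q))).wf.has_min
      {π | G.Covers I c q p v π} hex
    replace hmin : ∀ π', G.Covers I c q p v π' → π.length ≤ π'.length := fun π' h =>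
      not_lt.1 (hmin π' h)
    replace hπ : G.Covers I c q p v π := hπ
    have hcount : ∀ (R : ℕ) (π₁ π₂), π = π₁ ++ π₂ → (∀ x ∈ visits p v π₁, ∀ i ∈ I, x.2 i < R) →
        π₁.length ≤ Nat.card G.Q * R ^ I.card := by
      rintro R π₁ π₂ rfl hR
      have hnd := nodup_visits hπ hmin
      rw [← length_visits p v π₁, ← List.length_map (as := visits p v π₁)
        (f := fun x : G.Q × (Fin d → ℤ) => (x.1, fun i : I => x.2 i)),
        ← List.toFinset_card_of_nodup hnd]
      have hsub : ((visits p v π₁).map fun x => (x.1, fun i : I => x.2 i)).toFinset ⊆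
          Finset.univ ×ˢ Fintype.piFinset (fun _ : I => Finset.Ico (0 : ℤ) R) := by
        intro y hy
        obtain ⟨⟨r, w⟩, hx, rfl⟩ := List.mem_map.1 (List.mem_toFinset.1 hy)
        simp only [Finset.mem_product, Finset.mem_univ, true_and, Fintype.mem_piFinset, Finset.mem_Ico]
        rintro ⟨i, hi⟩
        refine ⟨?_, hR _ hx i hi⟩
        obtain ⟨r', h1, h2, -⟩ := covers_append hπ
        obtain ⟨α, β, rfl, -, h4⟩ := mem_visits h1 hx
        have h5 := h2 i hi
        rw [vals_append, NonnegAlong.append_iff] at h5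
        rw [h4]; exact h5.2.start
      refine (Finset.card_le_card hsub).trans ?_
      simp [Finset.card_product, Fintype.card_piFinset]
    first
    | -- no component
      rw [Finset.card_eq_zero] at hI
      subst hI
      refine ⟨π, hπ, ?_⟩
      -- With `I` empty the condition on the components is void and `0 ^ 0 = 1`, so `R = 0` gives
      -- the number of states.
      have := hcount 0 π [] (by simp) (by simp)
      simpa [coverBound] using this
    | -- one component more
      set B := coverBound (Nat.card G.Q) A S n with hB
      obtain ⟨π₁, π₂, rfl, h1, h2⟩ := exists_first_large I (A * B + S : ℕ) (v := v) hπ.1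
      have hlen := hcount _ π₁ π₂ rfl h1
      rw [hI] at hlen
      rcases h2 with rfl | ⟨i₀, hi₀, h2⟩
      · refine ⟨_, hπ, ?_⟩
        rw [List.append_nil, coverBound]
        exact hlen.trans (Nat.le_add_right _ _)
      · obtain ⟨r, hr1, hr2, hr3⟩ := covers_append hπ
        obtain ⟨π', hπ', hlen'⟩ := ih (I.erase i₀) (by rw [Finset.card_erase_of_mem hi₀, hI]; rfl) r
          (fun i => v i + (vals i π₁).sum) ⟨π₂, hr3.1, fun i hi => hr3.2 i (Finset.mem_of_mem_erase hi)⟩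
        refine ⟨π₁ ++ π', Covers.append hr1 hr2 (fun _ _ => rfl) ⟨hπ'.1, fun i hi => ?_⟩, ?_⟩
        · by_cases hii : i = i₀
          · subst hii
            have hA' := hπ'.1.abs_vals_le hA i
            have e1 : (A : ℤ) * (vals i π').length ≤ A * B := by
              rw [length_vals]
              exact mul_le_mul_of_nonneg_left (by exact_mod_cast hlen') (by positivity)
            push_cast at h2
            refine ⟨NonnegAlong.of_start hA' (by change (A : ℤ) * _ ≤ v i + _; linarith [hc i]), ?_⟩
            have e2 := neg_le_of_abs_le (NonnegAlong.abs_sum_le hA')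
            have := hc i
            linarith
          · exact hπ'.2 i (Finset.mem_erase.2 ⟨hii, hi⟩)
        · rw [List.length_append, coverBound]
          exact Nat.add_le_add hlen hlen'

/-- The double exponent satisfies the recursion `2 + (e + 1) * (n + 1) ≤ (n + 2) ^ (n + 2)` with `e
= (n + 1) ^ (n + 1)`. The 2 provides one factor `s` for `N` and another one that absorbs the sum of
two terms, as `s ≥ 2`. -/
theorem coverBound_le {N A S s : ℕ} (hs : 2 ≤ s) (hN : N + 1 ≤ s) (hA : A ≤ s) (hS : S ≤ s) (n : ℕ) :
    coverBound N A S n + 1 ≤ s ^ (n + 1) ^ (n + 1) := by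
  induction n with
  | zero => simpa [coverBound] using hN
  | succ n ih =>
    set e := (n + 1) ^ (n + 1) with he
    set g := coverBound N A S n with hg
    have h1 : A * g + S ≤ s ^ (e + 1) := by
      calc A * g + S ≤ s * g + s := Nat.add_le_add (Nat.mul_le_mul_right _ hA) hS
        _ = s * (g + 1) := by ring
        _ ≤ s * s ^ e := Nat.mul_le_mul_left _ ih
        _ = s ^ (e + 1) := by ring
    have h2 : N * (A * g + S) ^ (n + 1) ≤ s ^ (1 + (e + 1) * (n + 1)) := by
      calc N * (A * g + S) ^ (n + 1) ≤ s * (s ^ (e + 1)) ^ (n + 1) :=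
          Nat.mul_le_mul (by omega) (Nat.pow_le_pow_left h1 _)
        _ = s ^ (1 + (e + 1) * (n + 1)) := by rw [← pow_mul, ← pow_succ', add_comm 1]
    have h3 : s ^ e ≤ s ^ (1 + (e + 1) * (n + 1)) := Nat.pow_le_pow_right (by omega) (by nlinarith)
    have h4 : 2 + (e + 1) * (n + 1) ≤ (n + 2) ^ (n + 2) := by
      have e1 : e + 1 ≤ (n + 2) ^ (n + 1) := by
        have := Nat.pow_lt_pow_left (show n + 1 < n + 2 by omega) (show n + 1 ≠ 0 by omega)
        omega
      have e2 : (n + 2) ^ (n + 2) = (n + 2) * (n + 2) ^ (n + 1) := by ring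
      have e3 : 1 ≤ e := Nat.one_le_pow _ _ (by omega)
      rw [e2]
      nlinarith
    calc coverBound N A S (n + 1) + 1 = N * (A * g + S) ^ (n + 1) + (g + 1) := by rw [coverBound]; ring
      _ ≤ s ^ (1 + (e + 1) * (n + 1)) + s ^ (1 + (e + 1) * (n + 1)) := Nat.add_le_add h2 (ih.trans h3)
      _ = 2 * s ^ (1 + (e + 1) * (n + 1)) := by ring
      _ ≤ s * s ^ (1 + (e + 1) * (n + 1)) := Nat.mul_le_mul_right _ hs
      _ = s ^ (2 + (e + 1) * (n + 1)) := by rw [← pow_succ']; congr 1; ring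
      _ ≤ _ := Nat.pow_le_pow_right (by omega) h4

end VASS
end KLMReach

/-! ### Pumping cycles and the pumped path of a triple -/

namespace KLMReach

theorem AddRel.eq_top_iff {x y : ℕ∞} {a : ℤ} (h : AddRel x a y) : x = ⊤ ↔ y = ⊤ := by
  rcases h with ⟨rfl, rfl⟩ | ⟨m, n, rfl, rfl, -⟩ <;> simp

theorem AddRel.toNat {x y : ℕ∞} {a : ℤ} (h : AddRel x a y) (hx : x ≠ ⊤) :
    (y.toNat : ℤ) = x.toNat + a := by
  rcases h with ⟨rfl, rfl⟩ | ⟨m, n, rfl, rfl, h⟩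
  · exact absurd rfl hx
  · simpa using h

namespace VASS

variable {d : ℕ} {G : VASS.{u} d}

/-- On `ω` components a step imposes nothing, so only the finite components become integer partial
sums. -/
theorem SRun.exists_path {p q : G.Q} {x y : Config d} {σ : List (Action d)} (h : G.SRun p x σ q y) :
    ∃ π, G.Path p π q ∧ ∀ i, (x i = ⊤ ↔ y i = ⊤) ∧ (x i ≠ ⊤ →
      NonnegAlong (x i).toNat (vals i π) ∧ ((y i).toNat : ℤ) = (x i).toNat + (vals i π).sum) := by
  induction σ generalizing p x with
  | nil =>
    obtain ⟨rfl, rfl⟩ := h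
    exact ⟨[], rfl, fun i => ⟨Iff.rfl, fun _ => by simp⟩⟩
  | cons a σ ih =>
    obtain ⟨r, c, ht, hs, h⟩ := h
    obtain ⟨π, h1, h2⟩ := ih h
    refine ⟨(p, a, r) :: π, ⟨ht, rfl, h1⟩, fun i => ⟨(hs i).eq_top_iff.trans (h2 i).1, fun hx => ?_⟩⟩
    obtain ⟨h3, h4⟩ := (h2 i).2 (mt (hs i).eq_top_iff.2 hx)
    have h5 := (hs i).toNat hx
    rw [h5] at h3 h4
    exact ⟨⟨Int.natCast_nonneg _, h3⟩, by rw [h4, vals_cons, List.sum_cons, add_assoc]⟩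

/-- A cycle that increases each component of `J` and decreases no component of `I`. -/
theorem exists_common_pump {q : G.Q} {v : Fin d → ℕ} (I J : Finset (Fin d))
    (h : ∀ j ∈ J, ∃ π, G.Path q π q ∧
      (∀ i ∈ I, NonnegAlong (v i) (vals i π) ∧ 0 ≤ (vals i π).sum) ∧ 1 ≤ (vals j π).sum)
    (hJ : J ⊆ I) :
    ∃ π, G.Path q π q ∧ (∀ i ∈ I, NonnegAlong (v i) (vals i π) ∧ 0 ≤ (vals i π).sum) ∧
      ∀ j ∈ J, 1 ≤ (vals j π).sum := by
  induction J using Finset.induction_on with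
  | empty => exact ⟨[], rfl, by simp, by simp⟩
  | insert j J _ ih =>
    obtain ⟨π₁, h1, h2, h3⟩ := ih (fun j hj => h j (Finset.mem_insert_of_mem hj))
      ((Finset.subset_insert _ _).trans hJ)
    obtain ⟨π₂, h4, h5, h6⟩ := h j (Finset.mem_insert_self _ _)
    refine ⟨π₁ ++ π₂, h1.append h4, fun i hi => ?_, fun i hi => ?_⟩
    · rw [vals_append, NonnegAlong.append_iff, List.sum_append]
      have := (h2 i hi).2
      have := (h5 i hi).2
      exact ⟨⟨(h2 i hi).1, (h5 i hi).1.mono (by linarith)⟩, by linarith⟩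
    · rw [vals_append, List.sum_append]
      have e1 := (h2 i (hJ hi)).2
      have e2 := (h5 i (hJ hi)).2
      rcases Finset.mem_insert.1 hi with rfl | hi
      · linarith
      · linarith [h3 i hi]

theorem coverBound_mono (N A S : ℕ) : Monotone (coverBound N A S) :=
  monotone_nat_of_le_succ fun n => by rw [coverBound]; exact Nat.le_add_left _ _

/-- A pumping cycle is a covering path from `q` to itself whose target is `v` plus 1 on `J`, so
Rackoff's bound applies. This is why `S` must exceed the components of `v`. -/
theorem exists_short_pump {A S : ℕ} (hA : ∀ t ∈ G.T, ∀ i, |t.2.1 i| ≤ A) {q : G.Q} {v : Fin d → ℕ}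
    (hS : ∀ i, v i + 1 ≤ S) (I J : Finset (Fin d))
    (h : ∀ j ∈ J, ∃ π, G.Path q π q ∧
      (∀ i ∈ I, NonnegAlong (v i) (vals i π) ∧ 0 ≤ (vals i π).sum) ∧ 1 ≤ (vals j π).sum)
    (hJ : J ⊆ I) :
    ∃ π, G.Path q π q ∧ π.length ≤ coverBound (Nat.card G.Q) A S d ∧
      (∀ i ∈ I, NonnegAlong (v i) (vals i π) ∧ 0 ≤ (vals i π).sum) ∧
      ∀ j ∈ J, 1 ≤ (vals j π).sum := by
  classical
  obtain ⟨π, h1, h2, h3⟩ := exists_common_pump I J h hJ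
  obtain ⟨π', h4, h5⟩ := exists_short_cover hA (c := fun i => v i + if i ∈ J then 1 else 0) (S := S)
    (fun i => by have := hS i; split_ifs <;> omega) q I.card I rfl q (fun i => v i)
    ⟨π, h1, fun i hi => ⟨(h2 i hi).1, by
      have := (h2 i hi).2
      beta_reduce
      split_ifs with hij
      · linarith [h3 i hij]
      · linarith⟩⟩
  refine ⟨π', h4.1, h5.trans (coverBound_mono _ _ _ (by simpa using Finset.card_le_univ I)),
    fun i hi => ⟨(h4.2 i hi).1, ?_⟩, fun j hj => ?_⟩
  · have := (h4.2 i hi).2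
    simp only at this
    split_ifs at this <;> linarith
  · have := (h4.2 j (hJ hj)).2
    simp only [hj, if_true] at this
    linarith

/-- The `ω` components are not tracked. Each finite component that is not fixed is raised by some
cycle, since its acceleration is `⊤`. A concatenation of these cycles raises all of them at once and
is then shortened. -/
theorem exists_forward_pump {A S : ℕ} (hA : ∀ t ∈ G.T, ∀ i, |t.2.1 i| ≤ A) {x : Config d}
    (hS : configNorm x + 1 ≤ S) (hp : ∀ i, ¬ G.Fixed i → G.facc x i = ⊤) :
    ∃ π, G.Path G.qin π G.qin ∧ π.length ≤ coverBound (Nat.card G.Q) A S d ∧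
      ∀ i, x i ≠ ⊤ → NonnegAlong (x i).toNat (vals i π) ∧ 0 ≤ (vals i π).sum ∧
        (¬ G.Fixed i → 1 ≤ (vals i π).sum) := by
  classical
  have key : ∀ j ∈ Finset.univ.filter fun i => x i ≠ ⊤ ∧ ¬ G.Fixed i, ∃ π, G.Path G.qin π G.qin ∧
      (∀ i ∈ Finset.univ.filter fun i => x i ≠ ⊤,
        NonnegAlong ((x i).toNat : ℕ) (vals i π) ∧ 0 ≤ (vals i π).sum) ∧ 1 ≤ (vals j π).sum := by
    intro j hj
    simp only [Finset.mem_filter, Finset.mem_univ, true_and] at hj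
    have hj2 := hp j hj.2
    unfold facc at hj2
    split_ifs at hj2 with hex
    · obtain ⟨x', hle, hlt, σ, hσ⟩ := hex
      obtain ⟨π, h1, h2⟩ := hσ.exists_path
      refine ⟨π, h1, fun i hi => ?_, ?_⟩
      · simp only [Finset.mem_filter, Finset.mem_univ, true_and] at hi
        obtain ⟨h3, h4⟩ := (h2 i).2 hi
        have := ENat.toNat_le_toNat (hle i) (mt (h2 i).1.2 hi)
        exact ⟨h3, by omega⟩
      · obtain ⟨h3, h4⟩ := (h2 j).2 hj.1
        have hx' := mt (h2 j).1.2 hj.1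
        have : (x j).toNat < (x' j).toNat := by
          rw [← ENat.natCast_toNat hj.1, ← ENat.natCast_toNat hx'] at hlt
          exact_mod_cast hlt
        omega
    · exact absurd hj2 hj.1
  obtain ⟨π, h1, h2, h3, h4⟩ := exists_short_pump hA (q := G.qin) (v := fun i => (x i).toNat) (S := S)
    (fun i => by have := KLM.toNat_le_configNorm x i; omega)
    (Finset.univ.filter fun i => x i ≠ ⊤) (Finset.univ.filter fun i => x i ≠ ⊤ ∧ ¬ G.Fixed i)
    key (fun i hi => by simp at hi ⊢; exact hi.1)
  refine ⟨π, h1, h2, fun i hi => ⟨(h3 i (by simpa using hi)).1, (h3 i (by simpa using hi)).2,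
      fun hf => h4 i (by simpa using ⟨hi, hf⟩)⟩⟩

/-- A transition read backwards. -/
def revTrans {Q : Type u} (t : Q × Action d × Q) : Q × Action d × Q := (t.2.2, -t.2.1, t.1)

open Classical in
/-- The VASS with its transitions read backwards. -/
noncomputable abbrev rev (G : VASS.{u} d) : VASS.{u} d where
  Q := G.Q
  qin := G.qout
  qout := G.qin
  T := G.T.image revTrans

theorem mem_rev_T {t : G.Q × Action d × G.Q} : t ∈ G.rev.T ↔ revTrans t ∈ G.T := by
  classical
  have hinv : ∀ t : G.Q × Action d × G.Q, revTrans (revTrans t) = t := fun t => by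
    simp [revTrans]
  constructor
  · intro h
    obtain ⟨s, hs, rfl⟩ := Finset.mem_image.1 h
    rwa [hinv]
  · intro h
    exact Finset.mem_image.2 ⟨_, h, hinv t⟩

theorem Path.rev {p q : G.Q} {π : List (G.Q × Action d × G.Q)} (h : G.Path p π q) :
    G.rev.Path q (π.reverse.map revTrans) p := by
  induction π generalizing p with
  | nil => exact h.symm
  | cons t π ih =>
    obtain ⟨ht, rfl, h⟩ := h
    rw [List.reverse_cons, List.map_append]
    exact Path.append (G := G.rev) (ih h) (π₂ := [revTrans t])
      ⟨mem_rev_T.2 (by simpa [revTrans] using ht), rfl, rfl⟩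

theorem Path.of_rev {p q : G.Q} {π : List (G.Q × Action d × G.Q)} (h : G.rev.Path p π q) :
    G.Path q (π.reverse.map revTrans) p := by
  induction π generalizing p with
  | nil => exact Eq.symm h
  | cons t π ih =>
    obtain ⟨ht, rfl, h⟩ := h
    rw [List.reverse_cons, List.map_append]
    exact (ih h).append (π₂ := [revTrans t]) ⟨mem_rev_T.1 ht, rfl, rfl⟩

theorem vals_rev {Q : Type u} (i : Fin d) (π : List (Q × Action d × Q)) :
    vals i (π.reverse.map revTrans) = (vals i π).reverse.map Neg.neg := by
  simp [vals, revTrans, Function.comp_def]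

theorem sum_vals_rev {Q : Type u} (i : Fin d) (π : List (Q × Action d × Q)) :
    (vals i (π.reverse.map revTrans)).sum = - (vals i π).sum := by
  rw [vals_rev, List.map_reverse, List.sum_reverse]
  exact (List.sum_neg _).symm

/-- The forward construction in the reversed VASS. Turned around, the cycle starts above `y` and
descends to it on the finite components. -/
theorem exists_backward_pump {A S : ℕ} (hA : ∀ t ∈ G.T, ∀ i, |t.2.1 i| ≤ A) {y : Config d}
    (hS : configNorm y + 1 ≤ S) (hp : ∀ i, ¬ G.Fixed i → G.bacc y i = ⊤) :
    ∃ π, G.Path G.qout π G.qout ∧ π.length ≤ coverBound (Nat.card G.Q) A S d ∧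
      ∀ i, y i ≠ ⊤ → NonnegAlong ((y i).toNat - (vals i π).sum) (vals i π) ∧ (vals i π).sum ≤ 0 ∧
        (¬ G.Fixed i → (vals i π).sum ≤ -1) := by
  classical
  have key : ∀ j ∈ Finset.univ.filter fun i => y i ≠ ⊤ ∧ ¬ G.Fixed i, ∃ π, G.rev.Path G.qout π G.qout ∧
      (∀ i ∈ Finset.univ.filter fun i => y i ≠ ⊤,
        NonnegAlong ((y i).toNat : ℕ) (vals i π) ∧ 0 ≤ (vals i π).sum) ∧ 1 ≤ (vals j π).sum := by
    intro j hj
    simp only [Finset.mem_filter, Finset.mem_univ, true_and] at hj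
    have hj2 := hp j hj.2
    unfold bacc at hj2
    split_ifs at hj2 with hex
    · obtain ⟨y', hle, hlt, σ, hσ⟩ := hex
      obtain ⟨π, h1, h2⟩ := hσ.exists_path
      refine ⟨π.reverse.map revTrans, h1.rev, fun i hi => ?_, ?_⟩
      · simp only [Finset.mem_filter, Finset.mem_univ, true_and] at hi
        have hy' := mt (h2 i).1.1 hi
        obtain ⟨h3, h4⟩ := (h2 i).2 hy'
        have := ENat.toNat_le_toNat (hle i) hy'
        rw [sum_vals_rev, vals_rev, h4]
        exact ⟨h3.reverse, by omega⟩
      · have hy' := mt (h2 j).1.1 hj.1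
        obtain ⟨h3, h4⟩ := (h2 j).2 hy'
        have : (y j).toNat < (y' j).toNat := by
          rw [← ENat.natCast_toNat hj.1, ← ENat.natCast_toNat hy'] at hlt
          exact_mod_cast hlt
        rw [sum_vals_rev]
        omega
    · exact absurd hj2 hj.1
  obtain ⟨π, h1, h2, h3, h4⟩ := exists_short_pump (G := G.rev) (A := A) (fun t ht i => by
      have := hA _ (mem_rev_T.1 ht) i
      simpa [revTrans] using this) (q := G.qout) (v := fun i => (y i).toNat) (S := S)
    (fun i => by have := KLM.toNat_le_configNorm y i; omega)
    (Finset.univ.filter fun i => y i ≠ ⊤) (Finset.univ.filter fun i => y i ≠ ⊤ ∧ ¬ G.Fixed i)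
    key (fun i hi => by simp at hi ⊢; exact hi.1)
  refine ⟨π.reverse.map revTrans, Path.of_rev h1, by rw [List.length_map, List.length_reverse]; exact h2,
    fun i hi => ?_⟩
  obtain ⟨h5, h6⟩ := h3 i (by simpa using hi)
  rw [sum_vals_rev, vals_rev]
  exact ⟨by simpa using h5.reverse, by linarith, fun hf => by
      linarith [h4 i (by simpa using ⟨hi, hf⟩)]⟩

/-- On a fixed component the value is a function of the state. A path that starts at the right value
therefore never becomes negative, and a cycle has no effect. -/
theorem Path.tracks {i : Fin d} {f : G.Q → ℕ} (hf : G.Tracks i f) {p q : G.Q}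
    {π : List (G.Q × Action d × G.Q)} (h : G.Path p π q) :
    NonnegAlong (f p) (vals i π) ∧ (vals i π).sum = f q - f p := by
  induction π generalizing p with
  | nil => cases h; simp
  | cons t π ih =>
    obtain ⟨ht, rfl, h⟩ := h
    have h1 := hf t ht
    obtain ⟨h2, h3⟩ := ih h
    rw [h1] at h2 h3
    exact ⟨⟨Int.natCast_nonneg _, h2⟩, by rw [vals_cons, List.sum_cons, h3]; ring⟩

open Classical in
theorem sum_vals_eq {p q : G.Q} {π : List (G.Q × Action d × G.Q)} (h : G.Path p π q) (i : Fin d) :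
    (vals i π).sum = ∑ t ∈ G.T, (π.count t : ℤ) * t.2.1 i :=
  (sum_count_mul G.T π h.mem _).symm

open Classical in
theorem length_eq_sum_count {p q : G.Q} {π : List (G.Q × Action d × G.Q)} (h : G.Path p π q) :
    (π.length : ℤ) = ∑ t ∈ G.T, (π.count t : ℤ) := by
  have := sum_count_mul (M := ℤ) G.T π h.mem (fun _ => 1)
  simp only [mul_one, List.map_const', List.sum_replicate, nsmul_eq_mul] at this
  exact this.symm

set_option maxHeartbeats 1000000 in
/-- The data from which a path between large enough configurations is built: a unit flow `φ` from
`qin` to `qout`, a full circulation `φ₀`, and pumping cycles. -/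
theorem exists_pumped_path (hG : G.StronglyConnected) {A : ℕ}
    (hA : ∀ t ∈ G.T, ∀ i, |t.2.1 i| ≤ A) {x y : Config d} (hrigid : G.RigidTriple x y)
    {φ φ₀ : G.Q × Action d × G.Q → ℕ} (hφ : G.Flow φ G.qin G.qout) (hφ₀ : G.Flow φ₀ G.qin G.qin)
    (hpos : ∀ t ∈ G.T, 0 < φ₀ t) {m m₀ n n₀ : Fin d → ℕ}
    (hm : ∀ i, x i ≠ ⊤ → m i = (x i).toNat ∧ m₀ i = 0) (hm₀ : ∀ i, x i = ⊤ → 0 < m₀ i)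
    (hn : ∀ i, y i ≠ ⊤ → n i = (y i).toNat ∧ n₀ i = 0) (hn₀ : ∀ i, y i = ⊤ → 0 < n₀ i)
    (hd : ∀ i, (n i : ℤ) = m i + ∑ t ∈ G.T, (φ t : ℤ) * t.2.1 i)
    (hd₀ : ∀ i, (n₀ i : ℤ) = m₀ i + ∑ t ∈ G.T, (φ₀ t : ℤ) * t.2.1 i)
    {u v : List (G.Q × Action d × G.Q)} (hu : G.Path G.qin u G.qin) (hv : G.Path G.qout v G.qout)
    (hu' : ∀ i, x i ≠ ⊤ → NonnegAlong (x i).toNat (vals i u) ∧ 0 ≤ (vals i u).sum ∧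
        (¬ G.Fixed i → 1 ≤ (vals i u).sum))
    (hv' : ∀ i, y i ≠ ⊤ → NonnegAlong ((y i).toNat - (vals i v).sum) (vals i v) ∧
        (vals i v).sum ≤ 0 ∧ (¬ G.Fixed i → (vals i v).sum ≤ -1))
    {K p : ℕ} (hK : u.length + v.length + 1 ≤ K) (hKu : A * u.length + 1 ≤ K)
    (hKv : A * v.length + 1 ≤ K)
    (hp : A * (∑ t ∈ G.T, φ t + (K + 1) * ∑ t ∈ G.T, φ₀ t) ≤ p) :
    ∃ π, G.Path G.qin π G.qout ∧
      (π.length = ∑ t ∈ G.T, φ t + (p * K + 1) * ∑ t ∈ G.T, φ₀ t) ∧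
      ∀ i, NonnegAlong (m i + (p * K + 1 : ℕ) * m₀ i) (vals i π) ∧
        ((n i + (p * K + 1 : ℕ) * n₀ i : ℤ) = m i + (p * K + 1 : ℕ) * m₀ i + (vals i π).sum) := by
  classical
  have hcu : ∀ t, u.count t ≤ u.length := fun t => List.count_le_length
  have hcv : ∀ t, v.count t ≤ v.length := fun t => List.count_le_length
  have hKφ : ∀ t ∈ G.T, u.count t + v.count t + 1 ≤ K * φ₀ t := fun t ht => by
    have h1 := Nat.mul_le_mul_left K (hpos t ht)
    have h2 := hcu t
    have h3 := hcv t
    omega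
  -- `w` realizes `K * φ₀` minus the Parikh images of `u` and `v`. This circulation is positive on
  -- all transitions because `K > u.length + v.length` and `φ₀ ≥ 1`.
  obtain ⟨w, hw, hwc⟩ := exists_path_of_flow hG (p := G.qin) (q := G.qin)
    (φ := fun t => K * φ₀ t - (u.count t + v.count t)) (fun r => by
      have e0 := hφ₀ r
      have e1 := hu.flow r
      have e2 := hv.flow r
      rw [sub_self] at e0 e1 e2 ⊢
      have : ∀ t ∈ G.T, ((K * φ₀ t - (u.count t + v.count t) : ℕ) : ℤ) * (G.ind t.2.2 r - G.ind t.1 r)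
          = K * ((φ₀ t : ℤ) * (G.ind t.2.2 r - G.ind t.1 r)) -
            (u.count t : ℤ) * (G.ind t.2.2 r - G.ind t.1 r) -
            (v.count t : ℤ) * (G.ind t.2.2 r - G.ind t.1 r) := fun t ht => by
        rw [Nat.cast_sub (by have := hKφ t ht; omega)]; push_cast; ring
      rw [Finset.sum_congr rfl this, Finset.sum_sub_distrib, Finset.sum_sub_distrib, ← Finset.mul_sum,
        ← e0, ← e1, ← e2]; ring) (fun t ht => by have := hKφ t ht; omega)
  -- `φ` may vanish on some transitions, while the Euler argument needs a positive flow; hence `φ₀`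
  -- is added once. This is the `+ 1` in `p * K + 1`.
  obtain ⟨π, hπ, hπc⟩ := exists_path_of_flow hG (p := G.qin) (q := G.qout)
    (φ := fun t => φ t + φ₀ t) (fun r => by
      have e0 := hφ₀ r
      rw [sub_self] at e0
      simp only [Nat.cast_add, add_mul, Finset.sum_add_distrib, ← e0, ← hφ r, add_zero])
    (fun t ht => by have := hpos t ht; omega)
  -- lengths and effects
  have hwl : (u.length : ℤ) + v.length + w.length = K * ∑ t ∈ G.T, (φ₀ t : ℤ) := by
    rw [length_eq_sum_count hu, length_eq_sum_count hv, length_eq_sum_count hw,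
      ← Finset.sum_add_distrib, ← Finset.sum_add_distrib, Finset.mul_sum]
    refine Finset.sum_congr rfl fun t ht => ?_
    rw [hwc t ht, Nat.cast_sub (by have := hKφ t ht; omega)]; push_cast; ring
  have hπl : (π.length : ℤ) = ∑ t ∈ G.T, (φ t : ℤ) + ∑ t ∈ G.T, (φ₀ t : ℤ) := by
    rw [length_eq_sum_count hπ, ← Finset.sum_add_distrib]
    exact Finset.sum_congr rfl fun t ht => by rw [hπc t ht]; push_cast; ring
  have hws : ∀ i, (vals i u).sum + (vals i v).sum + (vals i w).sum = K * ((n₀ i : ℤ) - m₀ i) := by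
    intro i
    have : (n₀ i : ℤ) - m₀ i = ∑ t ∈ G.T, (φ₀ t : ℤ) * t.2.1 i := by rw [hd₀ i]; ring
    rw [sum_vals_eq hu, sum_vals_eq hv, sum_vals_eq hw, this,
      ← Finset.sum_add_distrib, ← Finset.sum_add_distrib, Finset.mul_sum]
    refine Finset.sum_congr rfl fun t ht => ?_
    rw [hwc t ht, Nat.cast_sub (by have := hKφ t ht; omega)]; push_cast; ring
  have hπs : ∀ i, (vals i π).sum = (n i : ℤ) - m i + (n₀ i - m₀ i) := by
    intro i
    rw [sum_vals_eq hπ, hd i, hd₀ i, add_sub_cancel_left, add_sub_cancel_left,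
      ← Finset.sum_add_distrib]
    exact Finset.sum_congr rfl fun t ht => by rw [hπc t ht]; push_cast; ring
  -- `p` is at least what `π` and one copy of each of `u`, `v` and `w` can lose together.
  have hp' : (A * (π.length + (u.length + v.length + w.length)) : ℤ) ≤ p := by
    rw [hwl, hπl]
    zify at hp
    refine le_trans (le_of_eq ?_) hp
    ring
  have hAu : (0 : ℤ) ≤ A * u.length := by positivity
  have hAv : (0 : ℤ) ≤ A * v.length := by positivity
  have hAw : (0 : ℤ) ≤ A * w.length := by positivity
  have hAπ : (0 : ℤ) ≤ A * π.length := by positivity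
  simp only [mul_add] at hp'
  -- The path `u ^ p w ^ p π v ^ p`. Since `u`, `v` and `w` together amount to `K * φ₀`, its Parikh
  -- image is `φ + (p * K + 1) * φ₀`.
  refine ⟨(List.replicate p u).flatten ++ ((List.replicate p w).flatten ++
    (π ++ (List.replicate p v).flatten)), (hu.replicate p).append ((hw.replicate p).append
      (hπ.append (hv.replicate p))), ?_, fun i => ?_⟩
  · zify
    simp only [List.length_append, List.length_flatten, List.map_replicate, List.sum_replicate,
      smul_eq_mul]
    push_cast
    rw [hπl]
    linear_combination (p : ℤ) * hwl
  have hsum : (n i + (p * K + 1 : ℕ) * n₀ i : ℤ) = m i + (p * K + 1 : ℕ) * m₀ i +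
      (p * (vals i u).sum + (p * (vals i w).sum + ((vals i π).sum + p * (vals i v).sum))) := by
    rw [hπs i]; push_cast
    linear_combination (-(p : ℤ)) * hws i
  simp only [vals_append, vals_replicate, NonnegAlong.append_iff, List.sum_append,
    sum_flatten_replicate]
  refine ⟨?_, hsum⟩
  have lu := hu.abs_vals_le hA i
  have lv := hv.abs_vals_le hA i
  have lw := hw.abs_vals_le hA i
  have lπ := hπ.abs_vals_le hA i
  have bu := abs_le.1 (NonnegAlong.abs_sum_le lu)
  have bv := abs_le.1 (NonnegAlong.abs_sum_le lv)
  have bπ := abs_le.1 (NonnegAlong.abs_sum_le lπ)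
  rw [length_vals] at bu bv bπ
  have hK1 : (A * u.length + 1 : ℤ) ≤ K := by exact_mod_cast hKu
  have hK2 : (A * v.length + 1 : ℤ) ≤ K := by exact_mod_cast hKv
  have hp0 : (0 : ℤ) ≤ p := Int.natCast_nonneg _
  have hpK : (p : ℤ) ≤ p * K := by
    have : (1 : ℤ) ≤ K := by linarith
    nlinarith
  -- One copy of `u` loses at most `A * u.length < K`, so a component that starts at `p * K` or
  -- above is still at least `p` after `u ^ p`. `hpKv` is the mirror image.
  have hpKu : (p : ℤ) ≤ p * K + p * (vals i u).sum := by
    have := mul_le_mul_of_nonneg_left (show (1 : ℤ) ≤ K + (vals i u).sum by linarith) hp0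
    linarith
  have hpKv : (p : ℤ) ≤ p * K - p * (vals i v).sum := by
    have := mul_le_mul_of_nonneg_left (show (1 : ℤ) ≤ K - (vals i v).sum by linarith) hp0
    linarith
  have hstart : x i = ⊤ → (p * K + 1 : ℤ) ≤ m i + (p * K + 1 : ℕ) * m₀ i := fun hx => by
    have h1 : (1 : ℤ) ≤ m₀ i := by exact_mod_cast hm₀ i hx
    have h2 : (0 : ℤ) ≤ p * K + 1 := by positivity
    push_cast
    nlinarith [Int.natCast_nonneg (m i)]
  have hend : y i = ⊤ → (p * K + 1 : ℤ) ≤ n i + (p * K + 1 : ℕ) * n₀ i := fun hy => by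
    have h1 : (1 : ℤ) ≤ n₀ i := by exact_mod_cast hn₀ i hy
    have h2 : (0 : ℤ) ≤ p * K + 1 := by positivity
    push_cast
    nlinarith [Int.natCast_nonneg (n i)]
  have hstart' : x i ≠ ⊤ → (m i + (p * K + 1 : ℕ) * m₀ i : ℤ) = (x i).toNat := fun hx => by
    rw [(hm i hx).1, (hm i hx).2]; simp
  have hend' : y i ≠ ⊤ → (n i + (p * K + 1 : ℕ) * n₀ i : ℤ) = (y i).toNat := fun hy => by
    rw [(hn i hy).1, (hn i hy).2]; simp
  generalize (m i + (p * K + 1 : ℕ) * m₀ i : ℤ) = a₀ at *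
  generalize (n i + (p * K + 1 : ℕ) * n₀ i : ℤ) = a₄ at *
  -- On a fixed component the three cycles have no effect. If `x i = ⊤`, it starts above `p`, which
  -- covers `π` and one copy of each cycle; otherwise rigidity says that it starts at the value tied
  -- to the input state.
  by_cases hfix : G.Fixed i
  · obtain ⟨f, hf, hfx, -⟩ := hrigid i hfix
    have e1 : (vals i u).sum = 0 := by rw [(hu.tracks hf).2, sub_self]
    have e2 : (vals i v).sum = 0 := by rw [(hv.tracks hf).2, sub_self]
    have e3 : (vals i w).sum = 0 := by rw [(hw.tracks hf).2, sub_self]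
    by_cases hx : x i = ⊤
    · have h0 := hstart hx
      rw [e1, e3, mul_zero, add_zero, add_zero]
      refine ⟨NonnegAlong.replicate_of_bounds lu p ?_ ?_, NonnegAlong.replicate_of_bounds lw p ?_ ?_,
        NonnegAlong.of_start lπ ?_, NonnegAlong.replicate_of_bounds lv p ?_ ?_⟩ <;>
        rw [length_vals] <;> (try simp only [e1, e2, e3, mul_zero, add_zero]) <;> linarith
    · have hall := (((hu.replicate p).append ((hw.replicate p).append
        (hπ.append (hv.replicate p)))).tracks hf).1
      have : (f G.qin : ℤ) = a₀ := by
        rw [hstart' hx]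
        rcases hfx with h | h
        · rw [h, ENat.toNat_natCast]
        · exact absurd h hx
      rw [this] at hall
      simpa only [vals_append, vals_replicate, NonnegAlong.append_iff, List.sum_append,
        sum_flatten_replicate] using hall
  -- A component that is not fixed is at least `p` after `u ^ p`, by pumping or because it starts at
  -- `p * K` or above, and symmetrically before `v ^ p`. So `w ^ p` has high ends and `π` has a high
  -- end.
  · have h1 : NonnegAlong a₀ (List.replicate p (vals i u)).flatten ∧
        (p : ℤ) ≤ a₀ + p * (vals i u).sum := by
      by_cases hx : x i = ⊤
      · have h0 := hstart hx
        refine ⟨NonnegAlong.replicate_of_bounds lu p ?_ ?_, ?_⟩ <;> try rw [length_vals]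
        all_goals linarith
      · obtain ⟨h2, h3, h4⟩ := hu' i hx
        rw [hstart' hx]
        refine ⟨h2.replicate_of_sum_nonneg h3 p, ?_⟩
        have := mul_le_mul_of_nonneg_left (h4 hfix) hp0
        linarith [Int.natCast_nonneg (x i).toNat]
    have ha₃ : a₀ + p * (vals i u).sum + p * (vals i w).sum + (vals i π).sum =
        a₄ - p * (vals i v).sum := by rw [hsum]; ring
    have h2 : NonnegAlong (a₄ - p * (vals i v).sum) (List.replicate p (vals i v)).flatten ∧
        (p : ℤ) ≤ a₄ - p * (vals i v).sum := by
      by_cases hy : y i = ⊤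
      · have h0 := hend hy
        refine ⟨NonnegAlong.replicate_of_bounds lv p ?_ ?_, ?_⟩ <;> try rw [length_vals]
        all_goals linarith
      · obtain ⟨h2, h3, h4⟩ := hv' i hy
        rw [hend' hy]
        refine ⟨by simpa using h2.replicate_of_sum_nonpos h3 p, ?_⟩
        have := mul_le_mul_of_nonneg_left (h4 hfix) hp0
        linarith [Int.natCast_nonneg (y i).toNat]
    refine ⟨h1.1, NonnegAlong.replicate_of_bounds lw p ?_ ?_, NonnegAlong.of_end lπ ?_, ?_⟩
    · rw [length_vals]; linarith [h1.2]
    · rw [length_vals]; linarith [h2.2]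
    · rw [length_vals, ha₃]; linarith [h2.2]
    · rw [ha₃]; exact h2.1

end VASS
end KLMReach

/-! ### Realized models and the numerical bound -/

namespace KLMReach
namespace KLM

variable {d : ℕ} {ξ : KLM.{u} d}

/-- A bound on the absolute values of the components of the actions. -/
noncomputable def actBound (ξ : KLM.{u} d) : ℕ := if d = 0 then 0 else ξ.weight

/-- A bound on the lengths of the pumping cycles. -/
noncomputable def pumpBound (ξ : KLM.{u} d) : ℕ := ξ.weight ^ (d + 1) ^ (d + 1)

/-- The factor that makes the homogeneous solution larger than the pumping cycles. -/
noncomputable def scale (ξ : KLM.{u} d) : ℕ := 2 * ξ.pumpBound + ξ.actBound * ξ.pumpBound + 1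

/-- A bound on the sums of the components of small solutions. -/
noncomputable def totalBound (ξ : KLM.{u} d) : ℕ := Fintype.card ξ.Var * ξ.solBound

/-- The number of repetitions of the pumping cycles. -/
noncomputable def reps (ξ : KLM.{u} d) : ℕ :=
  ξ.actBound * (ξ.totalBound + (ξ.scale + 1) * ξ.totalBound)

theorem one_le_pumpBound : 1 ≤ ξ.pumpBound := Nat.one_le_pow _ _ ξ.one_le_weight

theorem abs_le_actBound (j : Fin (ξ.k + 1)) {t} (ht : t ∈ (ξ.G j).T) (i : Fin d) :
    |t.2.1 i| ≤ ξ.actBound := by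
  have h0 : d ≠ 0 := fun h => by subst h; exact i.elim0
  have e1 := ξ.weight_ge j
  have e2 := actionNorm_le_size (ξ.G j) ht
  have e3 := natAbs_le_actionNorm t.2.1 i
  rw [actBound, if_neg h0, Int.abs_eq_natAbs]
  omega

theorem actBound_le : ξ.actBound ≤ ξ.weight := by
  unfold actBound; split_ifs <;> omega

/-- `coverBound_le` needs a base of at least 2 that exceeds the number of states. A nonempty path
provides a transition and hence both; the empty path needs no bound. -/
theorem length_le_pumpBound (j : Fin (ξ.k + 1)) {p q : (ξ.G j).Q} {π}
    (hπ : (ξ.G j).Path p π q)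
    (hlen : π.length ≤ VASS.coverBound (Nat.card (ξ.G j).Q) ξ.actBound ξ.weight d) :
    π.length ≤ ξ.pumpBound := by
  cases π with
  | nil => exact Nat.zero_le _
  | cons t π =>
    have h1 : 1 ≤ (ξ.G j).T.card := Finset.card_pos.2 ⟨t, hπ.1⟩
    have h2 := ξ.weight_ge j
    have h3 := one_le_size_vass (ξ.G j)
    have h4 : (ξ.G j).size = Nat.card (ξ.G j).Q + (ξ.G j).T.card + _ := rfl
    have := VASS.coverBound_le (N := Nat.card (ξ.G j).Q) (A := ξ.actBound) (S := ξ.weight)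
      (s := ξ.weight) (by omega) (by omega) actBound_le le_rfl d
    unfold pumpBound
    omega

theorem sum_toVec (z : ℤ) (h : ξ.CharSeq) : ∑ c, toVec z h c =
    z + (∑ j, ∑ i, (h.m j i : ℤ) + (∑ j, ∑ i, (h.n j i : ℤ) + ∑ j, ∑ t, (h.φ j t : ℤ))) := by
  simp only [Fintype.sum_option, Fintype.sum_sum_type, Fintype.sum_prod_type, Fintype.sum_sigma, toVec]

/-- Besides the transition counts only the first vector is estimated: a run that the machine guesses
is determined by its start and its letters. -/
theorem sum_le_totalBound {z : ℤ} {h : ξ.CharSeq} (hz : 0 ≤ z) (hb : ∀ c, toVec z h c ≤ ξ.solBound) :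
    ∑ j, ∑ t, h.φ j t + ∑ i, h.m 0 i ≤ ξ.totalBound := by
  have h1 : ∑ c, toVec z h c ≤ ξ.totalBound := by
    refine (Finset.sum_le_card_nsmul _ _ _ fun c _ => hb c).trans ?_
    simp [totalBound]
  rw [sum_toVec] at h1
  have h2 : (∑ i, (h.m 0 i : ℤ)) ≤ ∑ j, ∑ i, (h.m j i : ℤ) :=
    Finset.single_le_sum (f := fun j => ∑ i, (h.m j i : ℤ)) (fun j _ => by positivity)
      (Finset.mem_univ 0)
  have h3 : 0 ≤ ∑ j, ∑ i, (h.n j i : ℤ) := by positivity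
  zify
  linarith

/-- A model of the characteristic system together with paths that realize it. -/
structure IsRealized (H : ξ.CharSeq) (π : ∀ j, List ((ξ.G j).Q × Action d × (ξ.G j).Q)) : Prop where
  model : ξ.IsModel H
  path : ∀ j, (ξ.G j).Path (ξ.G j).qin (π j) (ξ.G j).qout
  nonneg : ∀ j i, NonnegAlong (H.m j i) (VASS.vals i (π j))
  effect : ∀ j i, (H.n j i : ℤ) = H.m j i + (VASS.vals i (π j)).sum

open Classical in
/-- Extension by zero of a function on the transitions. -/
noncomputable def extendZero {G : VASS.{u} d} (φ : {t // t ∈ G.T} → ℕ) (t : G.Q × Action d × G.Q) : ℕ :=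
  if h : t ∈ G.T then φ ⟨t, h⟩ else 0

theorem sum_extendZero {G : VASS.{u} d} {M : Type*} [AddCommMonoid M] (φ : {t // t ∈ G.T} → ℕ)
    (w : ℕ → G.Q × Action d × G.Q → M) :
    ∑ t ∈ G.T, w (extendZero φ t) t = ∑ t : {t // t ∈ G.T}, w (φ t) t.1 := by
  rw [← Finset.sum_coe_sort]
  refine Finset.sum_congr rfl fun t _ => ?_
  simp [extendZero]

/-- All triples use the same multiple `reps * scale + 1` of the homogeneous solution, so the ends of
the pumped paths come from one model of the whole system and satisfy the links. -/
theorem exists_realized (hξ : ξ.Normal) : ∃ H π, ξ.IsRealized H π ∧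
    ∑ j, (π j).length + ∑ i, H.m 0 i ≤ ξ.totalBound * (ξ.reps * ξ.scale + 2) := by
  obtain ⟨⟨hsat, hconn, hsatur⟩, hrigid, hpump, hunb⟩ := hξ
  obtain ⟨h, hh, hb⟩ := exists_small_model hsat
  obtain ⟨h₀, hh₀, hb₀, hp₀⟩ := exists_small_homogeneous (ξ := ξ)
  -- The only use of saturation and unboundedness: a value that is unbounded over the models is
  -- positive in the small homogeneous solution.
  have hunb' : ∀ {c : ξ.Var} {f : ξ.CharSeq → ℕ}, (∀ h, toVec 1 h c = f h) →
      ¬ BddAbove {v : ℕ | ∃ h, ξ.IsModel h ∧ f h = v} → 0 < toVec 0 h₀ c := by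
    intro c f hf hbdd
    refine hp₀ c fun b => ?_
    rw [not_bddAbove_iff] at hbdd
    obtain ⟨_, ⟨g, hg, rfl⟩, hlt⟩ := hbdd b
    exact ⟨g, hg, by rw [hf]; exact_mod_cast hlt⟩
  have hB := one_le_pumpBound (ξ := ξ)
  have hφ₀ : ∀ j t, 0 < h₀.φ j t := fun j t => by
    have := hunb' (c := some (.inr (.inr ⟨j, t⟩))) (f := fun h => h.φ j t) (fun _ => rfl) (hunb j t)
    exact Int.natCast_pos.1 this
  have hm₀ : ∀ j i, ξ.x j i = ⊤ → 0 < h₀.m j i := fun j i hx => by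
    have := hunb' (c := some (.inl (j, i))) (f := fun h => h.m j i) (fun _ => rfl)
      ((hsatur j i).1 hx)
    exact Int.natCast_pos.1 this
  have hn₀ : ∀ j i, ξ.y j i = ⊤ → 0 < h₀.n j i := fun j i hx => by
    have := hunb' (c := some (.inr (.inl (j, i)))) (f := fun h => h.n j i) (fun _ => rfl)
      ((hsatur j i).2 hx)
    exact Int.natCast_pos.1 this
  have hT := sum_le_totalBound zero_le_one hb
  have hT₀ := sum_le_totalBound le_rfl hb₀
  have key : ∀ j, ∃ π, (ξ.G j).Path (ξ.G j).qin π (ξ.G j).qout ∧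
      (π.length = ∑ t, h.φ j t + (ξ.reps * ξ.scale + 1) * ∑ t, h₀.φ j t) ∧
      ∀ i, NonnegAlong (h.m j i + (ξ.reps * ξ.scale + 1 : ℕ) * h₀.m j i) (VASS.vals i π) ∧
        ((h.n j i + (ξ.reps * ξ.scale + 1 : ℕ) * h₀.n j i : ℤ) =
          h.m j i + (ξ.reps * ξ.scale + 1 : ℕ) * h₀.m j i + (VASS.vals i π).sum) := by
    intro j
    have hA : ∀ t ∈ (ξ.G j).T, ∀ i, |t.2.1 i| ≤ ξ.actBound := fun t ht i => abs_le_actBound j ht i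
    have hw := ξ.weight_ge j
    have hs : 1 ≤ (ξ.G j).size := by have := one_le_size_vass (ξ.G j); unfold VASS.size; omega
    obtain ⟨u, hu1, hu2, hu3⟩ := VASS.exists_forward_pump hA (x := ξ.x j) (S := ξ.weight) (by omega)
      (fun i hi => (hpump j i hi).1)
    obtain ⟨v, hv1, hv2, hv3⟩ := VASS.exists_backward_pump hA (y := ξ.y j) (S := ξ.weight) (by omega)
      (fun i hi => (hpump j i hi).2)
    replace hu2 := length_le_pumpBound j hu1 hu2
    replace hv2 := length_le_pumpBound j hv1 hv2
    have hKu := Nat.mul_le_mul_left ξ.actBound hu2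
    have hKv := Nat.mul_le_mul_left ξ.actBound hv2
    have e1 : ∑ t ∈ (ξ.G j).T, extendZero (h.φ j) t = ∑ t, h.φ j t :=
      sum_extendZero (h.φ j) fun n _ => n
    have e2 : ∑ t ∈ (ξ.G j).T, extendZero (h₀.φ j) t = ∑ t, h₀.φ j t :=
      sum_extendZero (h₀.φ j) fun n _ => n
    have e3 : ∑ t, h.φ j t ≤ ∑ j, ∑ t, h.φ j t :=
      Finset.single_le_sum (f := fun j => ∑ t, h.φ j t) (fun j _ => Nat.zero_le _) (Finset.mem_univ j)
    have e4 : ∑ t, h₀.φ j t ≤ ∑ j, ∑ t, h₀.φ j t :=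
      Finset.single_le_sum (f := fun j => ∑ t, h₀.φ j t) (fun j _ => Nat.zero_le _) (Finset.mem_univ j)
    have := VASS.exists_pumped_path (hconn j) hA (hrigid j) (φ := extendZero (h.φ j))
      (φ₀ := extendZero (h₀.φ j))
      (fun r => (hh.kirchhoff j r).trans (sum_extendZero (h.φ j)
        fun n t => (n : ℤ) * ((ξ.G j).ind t.2.2 r - (ξ.G j).ind t.1 r)).symm)
      (fun r => (sub_self _).trans ((hh₀.circulation j r).symm.trans (sum_extendZero (h₀.φ j)
        fun n t => (n : ℤ) * ((ξ.G j).ind t.2.2 r - (ξ.G j).ind t.1 r)).symm))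
      (fun t ht => by rw [extendZero, dif_pos ht]; exact hφ₀ j ⟨t, ht⟩)
      (m := h.m j) (m₀ := h₀.m j) (n := h.n j) (n₀ := h₀.n j)
      (fun i hx => ⟨(sqLe_natCast_iff _ _).1 (hh.m_le j i) hx, hh₀.m_eq j i hx⟩) (hm₀ j)
      (fun i hx => ⟨(sqLe_natCast_iff _ _).1 (hh.n_le j i) hx, hh₀.n_eq j i hx⟩) (hn₀ j)
      (fun i => (hh.displacement j i).trans (congrArg _ (sum_extendZero (h.φ j)
        fun n t => (n : ℤ) * t.2.1 i).symm))
      (fun i => (hh₀.displacement j i).trans (congrArg _ (sum_extendZero (h₀.φ j)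
        fun n t => (n : ℤ) * t.2.1 i).symm))
      hu1 hv1 hu3 hv3 (K := ξ.scale) (p := ξ.reps) (by unfold scale; omega)
      (by unfold scale; omega) (by unfold scale; omega)
      (by
        rw [e1, e2]
        exact Nat.mul_le_mul_left _ (Nat.add_le_add (by omega) (Nat.mul_le_mul_left _ (by omega))))
    rwa [e1, e2] at this
  choose π h1 h2 h3 using key
  refine ⟨h.addMul (ξ.reps * ξ.scale + 1) h₀, π, ⟨hh.addMul hh₀ _, h1, fun j i => ?_, fun j i => ?_⟩, ?_⟩
  · have := (h3 j i).1
    simpa only [CharSeq.addMul, Nat.cast_add, Nat.cast_mul] using this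
  · have := (h3 j i).2
    simpa only [CharSeq.addMul, Nat.cast_add, Nat.cast_mul] using this
  · simp only [h2, CharSeq.addMul, Finset.sum_add_distrib, ← Finset.mul_sum]
    have e1 := Nat.mul_le_mul_left (ξ.reps * ξ.scale + 1) hT₀
    rw [mul_add] at e1
    have e2 : ξ.totalBound * (ξ.reps * ξ.scale + 2) =
      ξ.totalBound + (ξ.reps * ξ.scale + 1) * ξ.totalBound := by ring
    omega

set_option maxHeartbeats 1000000 in
/-- The bound on realized models leaves room for a polynomial factor. -/
theorem witness_bound (ξ : KLM.{u} d) :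
    (ξ.totalBound * (ξ.reps * ξ.scale + 2) + ξ.weight) * (2 * ξ.weight + 4 * d + 8) ≤ ell ξ.size := by
  have hs := ξ.one_le_weight
  have hn := ξ.card_var_le
  have hZ : ξ.totalBound = Fintype.card ξ.Var * (Fintype.card ξ.Var *
    (Fintype.card ξ.Var * ξ.weight) ^ Fintype.card ξ.Var) := rfl
  have hn1 : 1 ≤ Fintype.card ξ.Var := Fintype.card_pos_iff.2 ⟨none⟩
  have hX : ξ.size = 2 * (d + 1) ^ (d + 1) * ξ.weight := rfl
  have hK : ξ.scale = 2 * ξ.pumpBound + ξ.actBound * ξ.pumpBound + 1 := rfl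
  have hp : ξ.reps = ξ.actBound * (ξ.totalBound + (ξ.scale + 1) * ξ.totalBound) := rfl
  have hB : ξ.pumpBound = ξ.weight ^ (d + 1) ^ (d + 1) := rfl
  have hB1 := one_le_pumpBound (ξ := ξ)
  have hA := actBound_le (ξ := ξ)
  have hA0 : d = 0 → ξ.actBound = 0 := fun h => by simp [actBound, h]
  rw [ell]
  generalize ξ.size = X at *
  generalize ξ.weight = s at *
  generalize ξ.totalBound = Z at *
  generalize ξ.reps = p at *
  generalize ξ.scale = K at *
  generalize ξ.pumpBound = B at *
  generalize ξ.actBound = A at *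
  generalize Fintype.card ξ.Var = n at *
  -- The general estimate needs `(d + 1) ^ (d + 1) ≥ 4`, which fails in dimension 0. There `actBound
  -- = 0`, so `reps` vanishes and no pumping is needed.
  rcases Nat.eq_zero_or_pos d with rfl | hd
  · have hA' := hA0 rfl
    subst hA'
    rw [zero_mul] at hp
    subst hp
    simp only [mul_zero, zero_add, one_mul, pow_one, mul_one, zero_mul, add_zero] at *
    have hZ' : Z ≤ s ^ (2 * s + 2) := by
      rw [hZ]
      calc n * (n * (n * s) ^ n) ≤ s * (s * (s * s) ^ s) := by
            refine Nat.mul_le_mul hn (Nat.mul_le_mul hn ?_)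
            exact (Nat.pow_le_pow_left (Nat.mul_le_mul_right _ hn) _).trans
              (Nat.pow_le_pow_right (Nat.mul_pos hs hs) hn)
        _ = s ^ (2 * s + 2) := by rw [← sq, ← pow_mul, ← mul_assoc, pow_add]; ring
    have hs2 : s ≤ s ^ (2 * s + 2) := Nat.le_self_pow (by omega) s
    calc (Z * 2 + s) * (2 * s + 8) ≤ (3 * s ^ (2 * s + 2)) * (10 * s) :=
          Nat.mul_le_mul (by omega) (by omega)
      _ = 30 * s ^ (2 * s + 3) := by ring
      _ ≤ 2 ^ (6 * s) * s ^ (6 * s) := by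
          refine Nat.mul_le_mul ?_ (Nat.pow_le_pow_right hs (by omega))
          calc 30 ≤ 2 ^ 6 := by norm_num
            _ ≤ 2 ^ (6 * s) := Nat.pow_le_pow_right (by norm_num) (by omega)
      _ = X ^ (3 * X) := by rw [hX, ← mul_pow]; congr 1; ring
  · set e := (d + 1) ^ (d + 1) with he
    -- With at most `(2 * d + 1) * s` variables, this makes `4 * n` at most one half of the
    -- available exponent `3 * X = 6 * (e * s)`.
    have he4 : 4 * (2 * d + 1) ≤ 3 * e := by
      rcases Nat.lt_or_ge d 2 with h | h
      · have : d = 1 := by omega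
        subst this; norm_num [he]
      · have : (d + 1) ^ 3 ≤ e := Nat.pow_le_pow_right (by omega) (by omega)
        have h9 : 3 * 3 ≤ (d + 1) * (d + 1) := Nat.mul_le_mul (by omega) (by omega)
        have h27 := Nat.mul_le_mul_left (d + 1) h9
        rw [show (d + 1) ^ 3 = (d + 1) * ((d + 1) * (d + 1)) by ring] at this
        omega
    have he5 : 4 ≤ e := by omega
    have hse : s ≤ e * s := Nat.le_mul_of_pos_left _ (by omega)
    have hes : e ≤ e * s := Nat.le_mul_of_pos_right _ hs
    have h4s : 4 * s ≤ e * s := Nat.mul_le_mul_right _ he5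
    have hX' : X = 2 * (e * s) := by rw [hX, mul_assoc]
    have hn4 : 4 * n ≤ 3 * (e * s) := by
      calc 4 * n ≤ 4 * ((2 * d + 1) * s) := Nat.mul_le_mul_left _ hn
        _ = (4 * (2 * d + 1)) * s := by ring
        _ ≤ 3 * e * s := Nat.mul_le_mul_right _ he4
        _ = 3 * (e * s) := by ring
    have hnX : n ≤ X := by omega
    have hsX : s ≤ X := by omega
    have hX8 : 8 ≤ X := by omega
    have hZ2 : Z ≤ X ^ (2 + 2 * n) := by
      calc Z = n * (n * (n * s) ^ n) := hZ
        _ ≤ X * (X * (X * X) ^ n) := Nat.mul_le_mul hnX (Nat.mul_le_mul hnX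
            (Nat.pow_le_pow_left (Nat.mul_le_mul hnX hsX) n))
        _ = X ^ (2 + 2 * n) := by rw [← sq X, ← pow_mul, ← mul_assoc, pow_add]; ring
    have hZ1 : 1 ≤ Z := by
      rw [hZ]; exact Nat.mul_pos hn1 (Nat.mul_pos hn1 (Nat.pow_pos (Nat.mul_pos hn1 hs)))
    have hK1 : K ≤ X * B := by
      rw [hK]
      have : A * B ≤ s * B := Nat.mul_le_mul_right _ hA
      have : (s + 3) * B ≤ X * B := Nat.mul_le_mul_right _ (by omega)
      nlinarith
    have hK2 : K + 2 ≤ X * B := by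
      rw [hK]
      have : A * B ≤ s * B := Nat.mul_le_mul_right _ hA
      have : (s + 5) * B ≤ X * B := Nat.mul_le_mul_right _ (by omega)
      nlinarith
    have hpK : p * K ≤ X ^ 3 * Z * B ^ 2 := by
      calc p * K = A * (Z * ((K + 2) * K)) := by rw [hp]; ring
        _ ≤ X * (Z * ((X * B) * (X * B))) := Nat.mul_le_mul (hA.trans hsX)
            (Nat.mul_le_mul_left _ (Nat.mul_le_mul hK2 hK1))
        _ = X ^ 3 * Z * B ^ 2 := by ring
    have hbig : 1 ≤ X ^ 3 * Z * B ^ 2 := Nat.mul_pos (Nat.mul_pos (Nat.pow_pos (by omega)) hZ1)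
      (Nat.pow_pos hB1)
    have hW : Z * (p * K + 2) + s ≤ X ^ 5 * Z ^ 2 * B ^ 2 := by
      have h1 : Z * (p * K + 2) ≤ Z * (3 * (X ^ 3 * Z * B ^ 2)) := Nat.mul_le_mul_left _ (by omega)
      have h2 : s ≤ s * (Z * (X ^ 3 * Z * B ^ 2)) := Nat.le_mul_of_pos_right _ (Nat.mul_pos hZ1 hbig)
      have h3 : (3 + s) * (Z * (X ^ 3 * Z * B ^ 2)) ≤ X ^ 2 * (Z * (X ^ 3 * Z * B ^ 2)) := by
        refine Nat.mul_le_mul_right _ ?_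
        nlinarith
      have h4 : X ^ 2 * (Z * (X ^ 3 * Z * B ^ 2)) = X ^ 5 * Z ^ 2 * B ^ 2 := by ring
      nlinarith
    have hF : 2 * s + 4 * d + 8 ≤ X ^ 2 := by
      rw [sq]
      exact (show 2 * s + 4 * d + 8 ≤ 3 * X by omega).trans (Nat.mul_le_mul_right _ (by omega))
    -- The other factors contribute the exponents 5, `4 + 4 * n` and 2. As `4 * n` takes at most one
    -- half of `6 * (e * s)`, there remains `3 * (e * s) - 11` for `B ^ 2`. This suffices: `B = 1`
    -- if `s = 1`, and `2 * e ≤ e * s` otherwise.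
    have hBB : B ^ 2 ≤ X ^ (3 * (e * s) - 11) := by
      rcases Nat.eq_or_lt_of_le hs with h1 | h1
      · rw [hB, ← h1]
        simp only [one_pow]
        exact Nat.one_le_pow _ _ (by omega)
      · calc B ^ 2 = s ^ (e * 2) := by rw [hB, pow_mul]
          _ ≤ X ^ (e * 2) := Nat.pow_le_pow_left hsX _
          _ ≤ X ^ (3 * (e * s) - 11) := by
              refine Nat.pow_le_pow_right (by omega) ?_
              have : e * 2 ≤ e * s := Nat.mul_le_mul_left _ h1
              omega
    calc (Z * (p * K + 2) + s) * (2 * s + 4 * d + 8) ≤ (X ^ 5 * Z ^ 2 * B ^ 2) * X ^ 2 :=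
          Nat.mul_le_mul hW hF
      _ ≤ (X ^ 5 * (X ^ (2 + 2 * n)) ^ 2 * X ^ (3 * (e * s) - 11)) * X ^ 2 := by gcongr
      _ = X ^ (5 + (2 + 2 * n) * 2 + (3 * (e * s) - 11) + 2) := by
          rw [← pow_mul, ← pow_add, ← pow_add, ← pow_add]
      _ ≤ X ^ (3 * X) := Nat.pow_le_pow_right (by omega) (by omega)

end KLM
end KLMReach

/-! ### From realized models to words of the action language -/

namespace KLMReach

theorem run_label_of_nonneg {d : ℕ} {Q : Type u} (π : List (Q × Action d × Q)) (m n : Fin d → ℕ)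
    (h : ∀ i, NonnegAlong (m i) (VASS.vals i π))
    (hn : ∀ i, (n i : ℤ) = m i + (VASS.vals i π).sum) :
    Run (finConfig m) (π.map fun t => t.2.1) (finConfig n) := by
  induction π generalizing m with
  | nil =>
    have : n = m := funext fun i => by simpa using hn i
    subst this; rfl
  | cons t π ih =>
    have h1 : ∀ i, ((m i + t.2.1 i).toNat : ℤ) = m i + t.2.1 i := fun i =>
      Int.toNat_of_nonneg (h i).2.start
    refine ⟨finConfig fun i => (m i + t.2.1 i).toNat, (KLM.step_finConfig_iff _ _ _).2 h1,
      ih _ (fun i => ?_) (fun i => ?_)⟩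
    · rw [h1]; exact (h i).2
    · rw [h1, hn i, VASS.vals_cons, List.sum_cons, add_assoc]

namespace KLM

variable {d : ℕ} {ξ : KLM.{u} d}

theorem IsRealized.mem_language {H : ξ.CharSeq} {π} (h : ξ.IsRealized H π) :
    (ξ.G 0).label (π 0) ++
      (List.ofFn fun j : Fin ξ.k => ξ.a j :: (ξ.G j.succ).label (π j.succ)).flatten ∈ ξ.language :=
  ⟨fun j => (ξ.G j).label (π j), H.m, H.n, rfl, fun j => ⟨π j, h.path j, rfl⟩,
    fun j => run_label_of_nonneg (π j) _ _ (h.nonneg j) (h.effect j), h.model.link,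
    h.model.m_le, h.model.n_le⟩

theorem length_word (ξ : KLM.{u} d) (σ : Fin (ξ.k + 1) → List (Action d)) :
    (σ 0 ++ (List.ofFn fun j : Fin ξ.k => ξ.a j :: σ j.succ).flatten).length =
      ξ.k + ∑ j, (σ j).length := by
  rw [List.length_append, List.length_flatten, List.map_ofFn, List.sum_ofFn, Fin.sum_univ_succ]
  simp only [Function.comp_def, List.length_cons, Finset.sum_add_distrib, Finset.sum_const,
    Finset.card_univ, Fintype.card_fin, smul_eq_mul, mul_one]
  ring

theorem exists_short_word (hξ : ξ.Normal) : ∃ σ ∈ ξ.language, σ.length ≤ ell ξ.size := by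
  obtain ⟨H, π, h, hb⟩ := exists_realized hξ
  refine ⟨_, h.mem_language, ?_⟩
  rw [ξ.length_word fun j => (ξ.G j).label (π j)]
  have e1 := ξ.witness_bound
  have e2 : ξ.k ≤ ξ.weight := by unfold weight; omega
  have e3 : ∀ a : ℕ, a ≤ a * (2 * ξ.weight + 4 * d + 8) := fun a =>
    Nat.le_mul_of_pos_right _ (by omega)
  have e4 := e3 (ξ.totalBound * (ξ.reps * ξ.scale + 2) + ξ.weight)
  simp only [VASS.label, List.length_map]
  omega

end KLM
end KLMReach

/-! ### Structured programs and their compilation into multi-stack machines -/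

namespace KLMReach

/-- The stacks of the machine. -/
inductive Stk
  | inp | read | cho | cnt | cnt' | cur | tgt | res | inp0 | cho0 | aux | out
  deriving DecidableEq

instance : Fintype Stk where
  elems := {.inp, .read, .cho, .cnt, .cnt', .cur, .tgt, .res, .inp0, .cho0, .aux, .out}
  complete k := by cases k <;> decide

/-- The contents of the stacks that a trial leaves alone. -/
structure Store where
  /-- the input -/
  inp0 : List Sym
  /-- the choices under trial -/
  cho0 : List Sym
  /-- an auxiliary stack -/
  aux : List Sym
  /-- the output -/
  out : List Sym

/-- The states of the structured programs. -/
structure St where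
  /-- the symbol in the finite control -/
  r : Option Sym
  /-- the input that remains to be read -/
  inp : List Sym
  /-- the input read -/
  read : List Sym
  /-- the remaining choices -/
  cho : List Sym
  /-- the counters -/
  cnt : List Sym
  /-- the counters, in reverse order, while they are processed -/
  cnt' : List Sym
  /-- the number of the current state -/
  cur : List Sym
  /-- the number of the output state -/
  tgt : List Sym
  /-- the word of actions, in reverse order -/
  res : List Sym
  /-- the other stacks -/
  e : Store

namespace St

/-- The contents of a stack. -/
def get (s : St) : Stk → List Sym
  | .inp => s.inp
  | .read => s.read
  | .cho => s.cho
  | .cnt => s.cnt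
  | .cnt' => s.cnt'
  | .cur => s.cur
  | .tgt => s.tgt
  | .res => s.res
  | .inp0 => s.e.inp0
  | .cho0 => s.e.cho0
  | .aux => s.e.aux
  | .out => s.e.out

/-- Replacing the contents of a stack. -/
def set (s : St) (k : Stk) (l : List Sym) : St :=
  match k with
  | .inp => { s with inp := l }
  | .read => { s with read := l }
  | .cho => { s with cho := l }
  | .cnt => { s with cnt := l }
  | .cnt' => { s with cnt' := l }
  | .cur => { s with cur := l }
  | .tgt => { s with tgt := l }
  | .res => { s with res := l }
  | .inp0 => { s with e := { s.e with inp0 := l } }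
  | .cho0 => { s with e := { s.e with cho0 := l } }
  | .aux => { s with e := { s.e with aux := l } }
  | .out => { s with e := { s.e with out := l } }

theorem get_set (s : St) (k : Stk) (l : List Sym) : (s.set k l).get = Function.update s.get k l := by
  funext k'
  cases k <;> cases k' <;> rfl

theorem set_r (s : St) (k : Stk) (l : List Sym) : (s.set k l).r = s.r := by cases k <;> rfl

/-- The number of symbols on all the stacks. -/
def size (s : St) : ℕ := ∑ k, (s.get k).length

end St

/-- The basic instructions. -/
inductive Prim
  | pop (k : Stk)
  | mv (k k' : Stk)
  | gen (k : Stk) (f : Option Sym → Sym)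
  | push (k : Stk) (f : Option Sym → Sym)
  | set (f : Option Sym → Option Sym)
  | fail

/-- The meaning of the basic instructions; the Boolean tells whether the instruction succeeds.
The instruction `gen` pushes a symbol at the price of a choice. -/
def Prim.sem : Prim → St → Bool × St
  | .pop k, s => (true, { s.set k (s.get k).tail with r := (s.get k).head? })
  | .mv k k', s => match s.get k with
    | [] => (true, { s with r := none })
    | x :: l => (true, { (s.set k l).set k' (x :: (s.set k l).get k') with r := some x })
  | .gen k f, s => match s.cho with
    | [] => (false, s)
    | _ :: l => (true, (s.set .cho l).set k (f s.r :: (s.set .cho l).get k))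
  | .push k f, s => (true, s.set k (f s.r :: s.get k))
  | .set f, s => (true, { s with r := f s.r })
  | .fail, s => (false, s)

/-- Structured programs. -/
inductive Cmd
  | prim (p : Prim)
  | seq (a b : Cmd)
  | ite (t : Option Sym → Bool) (a b : Cmd)
  | whl (t : Option Sym → Bool) (a : Cmd)
  | rescue (a b : Cmd)

/-- `Exec P c s o s'`: from `s`, the program `c` ends in `s'`, with success if `o`, and all the states
reached by basic instructions satisfy `P`. -/
inductive Exec (P : St → Prop) : Cmd → St → Bool → St → Prop
  | prim {p s} : P (p.sem s).2 → Exec P (.prim p) s (p.sem s).1 (p.sem s).2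
  | seq_ok {a b s s₁ o s₂} : Exec P a s true s₁ → Exec P b s₁ o s₂ → Exec P (.seq a b) s o s₂
  | seq_fail {a b s s₁} : Exec P a s false s₁ → Exec P (.seq a b) s false s₁
  | ite_true {t a b s o s₁} : t s.r = true → Exec P a s o s₁ → Exec P (.ite t a b) s o s₁
  | ite_false {t a b s o s₁} : t s.r = false → Exec P b s o s₁ → Exec P (.ite t a b) s o s₁
  | whl_done {t a s} : t s.r = false → Exec P (.whl t a) s true s
  | whl_step {t a s s₁ o s₂} : t s.r = true → Exec P a s true s₁ → Exec P (.whl t a) s₁ o s₂ →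
      Exec P (.whl t a) s o s₂
  | whl_fail {t a s s₁} : t s.r = true → Exec P a s false s₁ → Exec P (.whl t a) s false s₁
  | rescue_ok {a b s s₁} : Exec P a s true s₁ → Exec P (.rescue a b) s true s₁
  | rescue_fail {a b s s₁ o s₂} : Exec P a s false s₁ → Exec P b s₁ o s₂ →
      Exec P (.rescue a b) s o s₂

namespace Cmd

/-- The labels of the compiled program. -/
def Lbl : Cmd → Type
  | prim _ => Unit
  | seq a b => Lbl a ⊕ Lbl b
  | ite _ a b => Option (Lbl a ⊕ Lbl b)
  | whl _ a => Option (Lbl a)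
  | rescue a b => Lbl a ⊕ Lbl b

instance instFintypeLbl : (c : Cmd) → Fintype c.Lbl
  | prim _ => inferInstanceAs (Fintype Unit)
  | seq a b =>
    letI := instFintypeLbl a; letI := instFintypeLbl b; inferInstanceAs (Fintype (a.Lbl ⊕ b.Lbl))
  | ite _ a b =>
    letI := instFintypeLbl a; letI := instFintypeLbl b
    inferInstanceAs (Fintype (Option (a.Lbl ⊕ b.Lbl)))
  | whl _ a => letI := instFintypeLbl a; inferInstanceAs (Fintype (Option a.Lbl))
  | rescue a b =>
    letI := instFintypeLbl a; letI := instFintypeLbl b; inferInstanceAs (Fintype (a.Lbl ⊕ b.Lbl))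

/-- The first label of the compiled program. -/
def entry : (c : Cmd) → c.Lbl
  | prim _ => ()
  | seq a _ => Sum.inl a.entry
  | ite _ _ _ => none
  | whl _ _ => none
  | rescue a _ => Sum.inl a.entry

/-- The statements of the machine. -/
abbrev MStmt (Λ : Type) := Turing.TM2.Stmt (fun _ : Stk => Sym) Λ (Option Sym × Bool)

/-- The statement for a basic instruction. -/
def primCode {Λ : Type} (ok fail : Λ) : Prim → MStmt Λ
  | .pop k => .pop k (fun _ o => (o, false)) (.goto fun _ => ok)
  | .mv k k' => .pop k (fun _ o => (o, false)) (.branch (fun v => v.1.isSome)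
      (.push k' (fun v => v.1.getD .one) (.goto fun _ => ok)) (.goto fun _ => ok))
  -- The Boolean in the control records whether a choice was available, within this statement only;
  -- it is `false` again at every label.
  | .gen k f => .pop .cho (fun v o => (v.1, o.isSome)) (.branch (fun v => v.2)
      (.push k (fun v => f v.1) (.load (fun v => (v.1, false)) (.goto fun _ => ok)))
      (.load (fun v => (v.1, false)) (.goto fun _ => fail)))
  | .push k f => .push k (fun v => f v.1) (.goto fun _ => ok)
  | .set f => .load (fun v => (f v.1, false)) (.goto fun _ => ok)
  | .fail => .goto fun _ => fail

/-- The compiled program, with labels embedded by `emb`; it continues at `ok` or at `fail`. -/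
def code : (c : Cmd) → {Λ : Type} → (c.Lbl → Λ) → Λ → Λ → c.Lbl → MStmt Λ
  | prim p, _, _, ok, fail, _ => primCode ok fail p
  | seq a b, _, emb, ok, fail, l => match l with
    | .inl l => a.code (fun l => emb (.inl l)) (emb (.inr b.entry)) fail l
    | .inr l => b.code (fun l => emb (.inr l)) ok fail l
  | ite t a b, _, emb, ok, fail, l => match l with
    | none => .goto fun v => if t v.1 then emb (some (.inl a.entry)) else emb (some (.inr b.entry))
    | some (.inl l) => a.code (fun l => emb (some (.inl l))) ok fail l
    | some (.inr l) => b.code (fun l => emb (some (.inr l))) ok fail l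
  | whl t a, _, emb, ok, fail, l => match l with
    | none => .goto fun v => if t v.1 then emb (some a.entry) else ok
    | some l => a.code (fun l => emb (some l)) (emb none) fail l
  | rescue a b, _, emb, ok, fail, l => match l with
    | .inl l => a.code (fun l => emb (.inl l)) ok (emb (.inr b.entry)) l
    | .inr l => b.code (fun l => emb (.inr l)) ok fail l

/-- The configurations of the machine. -/
abbrev MCfg (Λ : Type) := Turing.TM2.Cfg (fun _ : Stk => Sym) Λ (Option Sym × Bool)

/-- The configuration at a label. -/
def cfg {Λ : Type} (l : Λ) (s : St) : MCfg Λ := ⟨some l, (s.r, false), s.get⟩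

theorem step_prim {Λ : Type} (m : Λ → MStmt Λ) (l ok fail : Λ) (p : Prim) (s : St)
    (hm : m l = primCode ok fail p) :
    Turing.TM2.step m (cfg l s) = some (cfg (bif (p.sem s).1 then ok else fail) (p.sem s).2) := by
  simp only [cfg, Turing.TM2.step, hm]
  cases p with
  | pop k => simp [primCode, Turing.TM2.stepAux, Prim.sem, ← St.get_set]; rfl
  | mv k k' =>
    cases h : s.get k with
    | nil =>
      have : Function.update s.get k [] = s.get := by rw [← h]; exact Function.update_eq_self _ _
      simp [primCode, Turing.TM2.stepAux, Prim.sem, h, this]; rfl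
    | cons x l =>
      simp [primCode, Turing.TM2.stepAux, Prim.sem, h, ← St.get_set]; rfl
  | gen k f =>
    cases h : s.cho with
    | nil =>
      have h' : s.get .cho = [] := h
      have : Function.update s.get .cho [] = s.get := by rw [← h']; exact Function.update_eq_self _ _
      simp [primCode, Turing.TM2.stepAux, Prim.sem, h, h', this]
    | cons x l =>
      have h' : s.get .cho = x :: l := h
      simp [primCode, Turing.TM2.stepAux, Prim.sem, h, h', ← St.get_set, St.set_r]
  | push k f => simp [primCode, Turing.TM2.stepAux, Prim.sem, ← St.get_set, St.set_r]
  | set f => simp [primCode, Turing.TM2.stepAux, Prim.sem]; rfl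
  | fail => simp [primCode, Turing.TM2.stepAux, Prim.sem]

/-- A step of the machine to a configuration whose stacks are those of a state with `P`. -/
def StepTo {Λ : Type} (m : Λ → MStmt Λ) (P : St → Prop) (a b : MCfg Λ) : Prop :=
  Turing.TM2.step m a = some b ∧ ∃ t, P t ∧ b.stk = t.get

/-- Induction on the execution. The surrounding machine is arbitrary except that it holds the code
at the embedded labels, so subprograms are treated by composing embeddings and by changing the
continuations. Tests leave the stacks alone, so a bound that holds at the start and after each basic
instruction holds at every machine configuration. -/
theorem sim {P : St → Prop} {c : Cmd} {s : St} {o : Bool} {s' : St} (h : Exec P c s o s') (hs : P s)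
    {Λ : Type} (m : Λ → MStmt Λ) (emb : c.Lbl → Λ) (ok fail : Λ)
    (hm : ∀ l, m (emb l) = c.code emb ok fail l) :
    P s' ∧ Relation.ReflTransGen (StepTo m P) (cfg (emb c.entry) s)
      (cfg (bif o then ok else fail) s') := by
  induction h generalizing ok fail with
  | prim h =>
    exact ⟨h, .single ⟨step_prim m _ ok fail _ _ (hm ()), _, h, rfl⟩⟩
  | seq_ok _ _ ih₁ ih₂ =>
    obtain ⟨h1, h2⟩ := ih₁ hs (fun l => emb (.inl l)) _ fail fun l => hm (.inl l)
    obtain ⟨h3, h4⟩ := ih₂ h1 (fun l => emb (.inr l)) ok fail fun l => hm (.inr l)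
    exact ⟨h3, h2.trans h4⟩
  | @seq_fail a b s s₁ _ ih =>
    exact ih hs (fun l => emb (.inl l)) (emb (.inr b.entry)) fail fun l => hm (.inl l)
  | @ite_true t a b s o s₁ ht _ ih =>
    obtain ⟨h1, h2⟩ := ih hs (fun l => emb (some (.inl l))) ok fail fun l => hm (some (.inl l))
    refine ⟨h1, .head ⟨?_, s, hs, rfl⟩ h2⟩
    simp only [cfg, Turing.TM2.step, entry, hm none, code, Turing.TM2.stepAux, ht, if_true]
  | @ite_false t a b s o s₁ ht _ ih =>
    obtain ⟨h1, h2⟩ := ih hs (fun l => emb (some (.inr l))) ok fail fun l => hm (some (.inr l))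
    refine ⟨h1, .head ⟨?_, s, hs, rfl⟩ h2⟩
    simp only [cfg, Turing.TM2.step, entry, hm none, code, Turing.TM2.stepAux, ht, Bool.false_eq_true,
      if_false]
  | whl_done ht =>
    refine ⟨hs, .single ⟨?_, _, hs, rfl⟩⟩
    simp only [cfg, Turing.TM2.step, entry, hm none, code, Turing.TM2.stepAux, ht, Bool.false_eq_true,
      if_false, cond_true]
  | whl_step ht _ _ ih₁ ih₂ =>
    obtain ⟨h1, h2⟩ := ih₁ hs (fun l => emb (some l)) (emb none) fail fun l => hm (some l)
    obtain ⟨h3, h4⟩ := ih₂ h1 emb ok fail hm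
    refine ⟨h3, .head ⟨?_, _, hs, rfl⟩ (h2.trans h4)⟩
    simp only [cfg, Turing.TM2.step, entry, hm none, code, Turing.TM2.stepAux, ht, if_true]
  | whl_fail ht _ ih =>
    obtain ⟨h1, h2⟩ := ih hs (fun l => emb (some l)) (emb none) fail fun l => hm (some l)
    refine ⟨h1, .head ⟨?_, _, hs, rfl⟩ h2⟩
    simp only [cfg, Turing.TM2.step, entry, hm none, code, Turing.TM2.stepAux, ht, if_true]
  | @rescue_ok a b s s₁ _ ih =>
    exact ih hs (fun l => emb (.inl l)) ok (emb (.inr b.entry)) fun l => hm (.inl l)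
  | rescue_fail _ _ ih₁ ih₂ =>
    obtain ⟨h1, h2⟩ := ih₁ hs (fun l => emb (.inl l)) ok _ fun l => hm (.inl l)
    obtain ⟨h3, h4⟩ := ih₂ h1 (fun l => emb (.inr l)) ok fail fun l => hm (.inr l)
    exact ⟨h3, h2.trans h4⟩

/-- The machine that runs a program. -/
def machine (c : Cmd) : Turing.TM2ComputableAux Sym Sym where
  tm :=
    { K := Stk
      k₀ := .inp0
      k₁ := .out
      Γ := fun _ => Sym
      Λ := Option c.Lbl
      main := some c.entry
      σ := Option Sym × Bool
      initialState := (none, false)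
      m := fun l => match l with
        | none => .halt
        | some l => c.code some none none l }
  inputAlphabet := Equiv.refl _
  outputAlphabet := Equiv.refl _

/-- The initial state on an input. -/
def initSt (w : List Sym) : St := ⟨none, [], [], [], [], [], [], [], [], ⟨w, [], [], []⟩⟩

/-- The final state with an output. -/
def finalSt (v : List Sym) : St := ⟨none, [], [], [], [], [], [], [], [], ⟨[], [], [], v⟩⟩

/-- The machine is deterministic, so every reachable configuration lies on the halting run obtained
from the execution, where the space is bounded. -/
theorem computesInSpace {c : Cmd} {w v : List Sym} {B : ℕ}
    (h : Exec (fun t => t.size ≤ B) c (initSt w) true (finalSt v)) (hw : (initSt w).size ≤ B) :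
    ComputesInSpace c.machine w v B := by
  obtain ⟨hB, hsim⟩ := sim h hw (c.machine).tm.m some none none fun l => rfl
  have hinit : Turing.initList c.machine.tm (w.map c.machine.inputAlphabet.symm) =
      cfg (some c.entry) (initSt w) := by
    have hw' : w.map (c.machine.inputAlphabet.symm) = w := List.map_id w
    rw [hw']
    change Turing.TM2.Cfg.mk _ _ _ = Turing.TM2.Cfg.mk _ _ _
    congr 1
    funext k
    cases k <;> rfl
  have hfinal : Turing.haltList c.machine.tm (v.map c.machine.outputAlphabet.symm) =
      ⟨none, (none, false), (finalSt v).get⟩ := by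
    have hv' : v.map (c.machine.outputAlphabet.symm) = v := List.map_id v
    rw [hv']
    change Turing.TM2.Cfg.mk _ _ _ = Turing.TM2.Cfg.mk _ _ _
    congr 1
    funext k
    cases k <;> rfl
  have hlast : StepTo (c.machine).tm.m (fun t => t.size ≤ B) (cfg none (finalSt v))
      ⟨none, (none, false), (finalSt v).get⟩ := ⟨rfl, _, hB, rfl⟩
  have hall := hsim.tail hlast
  constructor
  · have : ∀ a b, Relation.ReflTransGen (StepTo (c.machine).tm.m (fun t => t.size ≤ B)) a b →
        ∃ n, (flip bind c.machine.tm.step)^[n] (some a) = some b := by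
      intro a b hab
      induction hab using Relation.ReflTransGen.head_induction_on with
      | refl => exact ⟨0, rfl⟩
      | head h1 _ ih =>
        obtain ⟨n, hn⟩ := ih
        refine ⟨n + 1, ?_⟩
        rw [Function.iterate_succ_apply]
        have : flip bind c.machine.tm.step (some _) = some _ := h1.1
        rw [this, hn]
    obtain ⟨n, hn⟩ := this _ _ hall
    refine ⟨⟨n, ?_⟩⟩
    rw [hinit]
    refine hn.trans ?_
    rw [Option.map_some, hfinal]
    rfl
  · intro b hb
    rw [hinit] at hb
    have hspace : ∀ a : c.machine.tm.Cfg, ∀ t : St, t.size ≤ B → a.stk = t.get →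
        cfgSpace c.machine.tm a ≤ B := by
      intro a t ht hat
      refine le_trans (le_of_eq ?_) ht
      unfold cfgSpace St.size
      rw [hat]
      rfl
    suffices hgen : ∀ a f, Relation.ReflTransGen (StepTo (c.machine).tm.m (fun t => t.size ≤ B)) a f →
        c.machine.tm.step f = none → cfgSpace c.machine.tm a ≤ B →
        ∀ b, StateTransition.Reaches c.machine.tm.step a b → cfgSpace c.machine.tm b ≤ B from
      hgen _ _ hall rfl (hspace _ _ hw rfl) b hb
    intro a f haf hf
    induction haf using Relation.ReflTransGen.head_induction_on with
    | refl =>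
      intro ha b hb
      rcases Relation.ReflTransGen.cases_head hb with h | ⟨x, h1, -⟩
      · exact h ▸ ha
      · rw [hf] at h1; simp at h1
    | head h1 _ ih =>
      intro ha b hb
      rcases Relation.ReflTransGen.cases_head hb with h | ⟨x, h2, h3⟩
      · exact h ▸ ha
      · obtain ⟨h4, t, ht, hat⟩ := h1
        have h5 : some x = some _ := (Eq.symm h2).trans h4
        cases h5
        exact ih (hspace _ t ht hat) b h3

end Cmd
end KLMReach

/-! ### Weakest preconditions and elementary programs -/

namespace KLMReach
namespace Cmd

/-- The program `c` halts, and all the states on the way satisfy `P`; if it succeeds then `Q` holds,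
and if it fails then `F` holds. -/
def wpIn (P : St → Prop) (c : Cmd) (s : St) (Q : St → Prop) (F : Prop) : Prop :=
  ∃ o s', Exec P c s o s' ∧ (o = true → Q s') ∧ (o = false → F)

/-- The program `c` halts; if it succeeds then `Q` holds, and if it fails then `F` holds. -/
abbrev wp (c : Cmd) (s : St) (Q : St → Prop) (F : Prop) : Prop := wpIn (fun _ => True) c s Q F

variable {P : St → Prop} {a b : Cmd} {t : Option Sym → Bool} {s : St} {Q Q' : St → Prop} {F : Prop}

theorem wpIn.mono (h : wpIn P a s Q F) (hQ : ∀ s, Q s → Q' s) : wpIn P a s Q' F := by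
  obtain ⟨o, s', h1, h2, h3⟩ := h
  exact ⟨o, s', h1, fun ho => hQ _ (h2 ho), h3⟩

theorem wpIn_prim {p : Prim} : wpIn P (prim p) s Q F ↔
    P (p.sem s).2 ∧ if (p.sem s).1 then Q (p.sem s).2 else F := by
  constructor
  · rintro ⟨o, s', h, h1, h2⟩
    cases h with
    | prim h =>
      refine ⟨h, ?_⟩
      split_ifs with ho
      · exact h1 ho
      · exact h2 (by simpa using ho)
  · rintro ⟨hP, h⟩
    refine ⟨_, _, .prim hP, fun ho => ?_, fun ho => ?_⟩
    · rwa [if_pos ho] at h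
    · rw [if_neg (by simp [ho])] at h; exact h

theorem wpIn_seq : wpIn P (seq a b) s Q F ↔ wpIn P a s (fun s₁ => wpIn P b s₁ Q F) F := by
  constructor
  · rintro ⟨o, s', h, h1, h2⟩
    cases h with
    | seq_ok h3 h4 => exact ⟨_, _, h3, fun _ => ⟨_, _, h4, h1, h2⟩, fun h => by simp at h⟩
    | seq_fail h3 => exact ⟨_, _, h3, fun h => by simp at h, h2⟩
  · rintro ⟨o, s', h, h1, h2⟩
    cases o with
    | true =>
      obtain ⟨o, s'', h3, h4, h5⟩ := h1 rfl
      exact ⟨_, _, .seq_ok h h3, h4, h5⟩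
    | false => exact ⟨_, _, .seq_fail h, fun h => by simp at h, h2⟩

theorem wpIn_ite : wpIn P (ite t a b) s Q F ↔ if t s.r then wpIn P a s Q F else wpIn P b s Q F := by
  constructor
  · rintro ⟨o, s', h, h1, h2⟩
    cases h with
    | ite_true ht h => rw [if_pos ht]; exact ⟨_, _, h, h1, h2⟩
    | ite_false ht h => rw [if_neg (by simp [ht])]; exact ⟨_, _, h, h1, h2⟩
  · intro h
    by_cases ht : t s.r
    · rw [if_pos ht] at h
      obtain ⟨o, s', h, h1, h2⟩ := h
      exact ⟨_, _, .ite_true ht h, h1, h2⟩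
    · rw [if_neg ht] at h
      obtain ⟨o, s', h, h1, h2⟩ := h
      exact ⟨_, _, .ite_false (by simpa using ht) h, h1, h2⟩

theorem wpIn_whl : wpIn P (whl t a) s Q F ↔
    if t s.r then wpIn P a s (fun s₁ => wpIn P (whl t a) s₁ Q F) F else Q s := by
  constructor
  · rintro ⟨o, s', h, h1, h2⟩
    cases h with
    | whl_done ht => rw [if_neg (by simp [ht])]; exact h1 rfl
    | whl_step ht h3 h4 =>
      rw [if_pos ht]
      exact ⟨_, _, h3, fun _ => ⟨_, _, h4, h1, h2⟩, fun h => by simp at h⟩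
    | whl_fail ht h3 => rw [if_pos ht]; exact ⟨_, _, h3, fun h => by simp at h, h2⟩
  · intro h
    by_cases ht : t s.r
    · rw [if_pos ht] at h
      obtain ⟨o, s', h, h1, h2⟩ := h
      cases o with
      | true =>
        obtain ⟨o, s'', h3, h4, h5⟩ := h1 rfl
        exact ⟨_, _, .whl_step ht h h3, h4, h5⟩
      | false => exact ⟨_, _, .whl_fail ht h, fun h => by simp at h, h2⟩
    · rw [if_neg ht] at h
      exact ⟨_, _, .whl_done (by simpa using ht), fun _ => h, fun h => by simp at h⟩

theorem wp_prim {p : Prim} : wp (prim p) s Q F ↔ if (p.sem s).1 then Q (p.sem s).2 else F := by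
  rw [wp, wpIn_prim, and_iff_right trivial]

theorem wp_seq : wp (seq a b) s Q F ↔ wp a s (fun s₁ => wp b s₁ Q F) F := wpIn_seq

theorem wp_ite : wp (ite t a b) s Q F ↔ if t s.r then wp a s Q F else wp b s Q F := wpIn_ite

theorem wp_whl : wp (whl t a) s Q F ↔
    if t s.r then wp a s (fun s₁ => wp (whl t a) s₁ Q F) F else Q s := wpIn_whl

/-- The program that does nothing. -/
def skip : Cmd := prim (.set id)

/-- The sequence of a list of programs. -/
def seqs : List Cmd → Cmd
  | [] => skip
  | c :: l => seq c (seqs l)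

/-- The test for a given symbol. -/
def is (x : Sym) (r : Option Sym) : Bool := decide (r = some x)

/-- The test for anything but a given symbol. -/
def isnt (x : Sym) (r : Option Sym) : Bool := decide (r ≠ some x)

/-- Pop from a stack into the control. -/
def pop (k : Stk) : Cmd := prim (.pop k)

/-- Move a symbol from one stack to another. -/
def mv (k k' : Stk) : Cmd := prim (.mv k k')

/-- Push a symbol at the price of a choice. -/
def gen (k : Stk) (x : Sym) : Cmd := prim (.gen k fun _ => x)

/-- Set the symbol in the control. -/
def set (x : Option Sym) : Cmd := prim (.set fun _ => x)

/-- Fail unless the test succeeds. -/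
def check (t : Option Sym → Bool) : Cmd := ite t skip (prim .fail)

/-- Read a symbol of the input. -/
def rd : Cmd := mv .inp .read

/-- Read a symbol of the input and copy it to the result. -/
def rdo : Cmd := seq rd (prim (.gen .res fun r => r.getD .one))

/-- Read a choice. -/
def ch : Cmd := seq (pop .cho) (check Option.isSome)

/-- Empty a stack. -/
def clear (k : Stk) : Cmd := seq (pop k) (whl Option.isSome (pop k))

/-- Move all of a stack to another one. -/
def mvAll (k k' : Stk) : Cmd := seq (mv k k') (whl Option.isSome (mv k k'))

/-- Move a stack to another one up to and including a symbol. -/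
def mvUntil (x : Sym) (k k' : Stk) : Cmd := seq (mv k k') (whl (isnt x) (mv k k'))

/-- Read symbols, and run `c` for each `one`, until another symbol occurs. -/
def forOnes (src c : Cmd) : Cmd :=
  seq (set (some .one)) (whl (is .one) (seq src (ite (is .one) c skip)))

@[simp] theorem wp_seqs_nil : wp (seqs []) s Q F ↔ Q s := by
  simp [seqs, skip, wp_prim, Prim.sem]

@[simp] theorem wp_seqs_cons {l : List Cmd} :
    wp (seqs (a :: l)) s Q F ↔ wp a s (fun s₁ => wp (seqs l) s₁ Q F) F := wp_seq

@[simp] theorem wp_skip : wp skip s Q F ↔ Q s := by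
  simp [skip, wp_prim, Prim.sem]

@[simp] theorem wp_fail : wp (prim .fail) s Q F ↔ F := by
  simp [wp_prim, Prim.sem]

@[simp] theorem wp_set {x : Option Sym} : wp (set x) s Q F ↔ Q { s with r := x } := by
  simp [set, wp_prim, Prim.sem]

@[simp] theorem wp_check : wp (check t) s Q F ↔ if t s.r then Q s else F := by
  simp [check, wp_ite]

@[simp] theorem wp_pop {k : Stk} : wp (pop k) s Q F ↔
    Q { s.set k (s.get k).tail with r := (s.get k).head? } := by
  simp [pop, wp_prim, Prim.sem]

theorem wp_mv {k k' : Stk} : wp (mv k k') s Q F ↔ Q ((Prim.mv k k').sem s).2 := by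
  rw [mv, wp_prim, if_pos]
  simp only [Prim.sem]
  cases s.get k <;> rfl

variable {r : Option Sym} {i j c v u p q o : List Sym} {e : Store} {x : Sym}

@[simp] theorem wp_gen {k : Stk} : wp (gen k x) ⟨r, i, j, c, v, u, p, q, o, e⟩ Q F ↔
    match c with
    | [] => F
    | _ :: c => Q ((St.mk r i j c v u p q o e).set k (x :: (St.mk r i j c v u p q o e).get k)) := by
  rw [gen, wp_prim]
  cases c <;> rfl

@[simp] theorem wp_rd : wp rd ⟨r, x :: i, j, c, v, u, p, q, o, e⟩ Q F ↔
    Q ⟨some x, i, x :: j, c, v, u, p, q, o, e⟩ := wp_mv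

@[simp] theorem wp_rd_nil : wp rd ⟨r, [], j, c, v, u, p, q, o, e⟩ Q F ↔
    Q ⟨none, [], j, c, v, u, p, q, o, e⟩ := wp_mv

@[simp] theorem wp_rdo : wp rdo ⟨r, x :: i, j, c, v, u, p, q, o, e⟩ Q F ↔
    match c with
    | [] => F
    | _ :: c => Q ⟨some x, i, x :: j, c, v, u, p, q, x :: o, e⟩ := by
  rw [rdo, wp_seq, wp_rd, wp_prim]
  cases c <;> rfl

@[simp] theorem wp_mv_cnt : wp (mv .cnt .cnt') ⟨r, i, j, c, x :: v, u, p, q, o, e⟩ Q F ↔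
    Q ⟨some x, i, j, c, v, x :: u, p, q, o, e⟩ := wp_mv

@[simp] theorem wp_mv_cnt' : wp (mv .cnt' .cnt) ⟨r, i, j, c, v, x :: u, p, q, o, e⟩ Q F ↔
    Q ⟨some x, i, j, c, x :: v, u, p, q, o, e⟩ := wp_mv

@[simp] theorem wp_mv_cnt'_nil : wp (mv .cnt' .cnt) ⟨r, i, j, c, v, [], p, q, o, e⟩ Q F ↔
    Q ⟨none, i, j, c, v, [], p, q, o, e⟩ := wp_mv

@[simp] theorem wp_mv_read : wp (mv .read .inp) ⟨r, i, x :: j, c, v, u, p, q, o, e⟩ Q F ↔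
    Q ⟨some x, x :: i, j, c, v, u, p, q, o, e⟩ := wp_mv

@[simp] theorem wp_mv_read_nil : wp (mv .read .inp) ⟨r, i, [], c, v, u, p, q, o, e⟩ Q F ↔
    Q ⟨none, i, [], c, v, u, p, q, o, e⟩ := wp_mv

@[simp] theorem wp_ch : wp ch ⟨r, i, j, c, v, u, p, q, o, e⟩ Q F ↔
    match c with
    | [] => F
    | x :: c => Q ⟨some x, i, j, c, v, u, p, q, o, e⟩ := by
  rw [ch, wp_seq, wp_pop, wp_check]
  cases c <;> simp [St.get, St.set]

theorem wp_clear {k : Stk} : wp (clear k) s Q F ↔ Q { s.set k [] with r := none } := by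
  have hset : ∀ (s : St) l l', (s.set k l).set k l' = s.set k l' := fun s l l' => by
    cases k <;> rfl
  have hget : ∀ (s : St) l, (s.set k l).get k = l := fun s l => by rw [St.get_set]; simp
  have hr : ∀ (s : St) r l, ({ s with r := r } : St).set k l = { s.set k l with r := r } :=
    fun s r l => by cases k <;> rfl
  have hgr : ∀ (s : St) r, ({ s with r := r } : St).get k = s.get k := fun s r => by cases k <;> rfl
  rw [clear, wp_seq, wp_pop]
  generalize hl : s.get k = l
  induction l generalizing s with
  | nil => rw [wp_whl, if_neg (by simp), List.tail_nil, List.head?_nil]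
  | cons x l ih =>
    have := ih (s := s.set k l) (hget s l)
    rw [hset s l l.tail, hset s l []] at this
    rw [wp_whl, if_pos (by rfl), wp_pop, hgr, hr, List.tail_cons, hget, hset]
    exact this

theorem wp_mvUntil_rd (l : List Sym) (hl : x ∉ l) :
    wp (mvUntil x .inp .read) ⟨r, l ++ x :: i, j, c, v, u, p, q, o, e⟩ Q F ↔
      Q ⟨some x, i, x :: (l.reverse ++ j), c, v, u, p, q, o, e⟩ := by
  rw [mvUntil, wp_seq]
  change wp rd _ (fun s₁ => wp (whl (isnt x) rd) s₁ Q F) F ↔ _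
  induction l generalizing r j with
  | nil => rw [List.nil_append, wp_rd, wp_whl]; simp [isnt]
  | cons y l ih =>
    rw [List.mem_cons, not_or] at hl
    rw [List.cons_append, wp_rd, wp_whl]
    simp only [isnt, ne_eq, Option.some.injEq, Ne.symm hl.1, not_false_eq_true, decide_true, if_true]
    exact (ih hl.2).trans (by simp)

theorem wp_mvUntil_cnt (l : List Sym) (hl : x ∉ l) :
    wp (mvUntil x .cnt .cnt') ⟨r, i, j, c, l ++ x :: v, u, p, q, o, e⟩ Q F ↔
      Q ⟨some x, i, j, c, v, x :: (l.reverse ++ u), p, q, o, e⟩ := by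
  rw [mvUntil, wp_seq]
  induction l generalizing r u with
  | nil => rw [List.nil_append, wp_mv_cnt, wp_whl]; simp [isnt]
  | cons y l ih =>
    rw [List.mem_cons, not_or] at hl
    rw [List.cons_append, wp_mv_cnt, wp_whl]
    simp only [isnt, ne_eq, Option.some.injEq, Ne.symm hl.1, not_false_eq_true, decide_true, if_true]
    exact (ih hl.2).trans (by simp)

theorem wp_mvAll_cnt : wp (mvAll .cnt' .cnt) ⟨r, i, j, c, v, u, p, q, o, e⟩ Q F ↔
    Q ⟨none, i, j, c, u.reverse ++ v, [], p, q, o, e⟩ := by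
  rw [mvAll, wp_seq]
  induction u generalizing r v with
  | nil => rw [wp_mv_cnt'_nil, wp_whl]; simp
  | cons y l ih =>
    rw [wp_mv_cnt', wp_whl]
    simp only [Option.isSome_some, if_true]
    exact ih.trans (by simp)

theorem wp_mvAll_read : wp (mvAll .read .inp) ⟨r, i, j, c, v, u, p, q, o, e⟩ Q F ↔
    Q ⟨none, j.reverse ++ i, [], c, v, u, p, q, o, e⟩ := by
  rw [mvAll, wp_seq]
  induction j generalizing r i with
  | nil => rw [wp_mv_read_nil, wp_whl]; simp
  | cons y l ih =>
    rw [wp_mv_read, wp_whl]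
    simp only [Option.isSome_some, if_true]
    exact ih.trans (by simp)

theorem encNat_zero : encNat 0 = [.sep] := rfl

theorem encNat_succ (n : ℕ) : encNat (n + 1) = .one :: encNat n := by
  simp [encNat, List.replicate_succ]

/-- One round of a `forOnes` loop. -/
theorem wp_forOnes_round {src body : Cmd} : wp (forOnes src body) s Q F ↔
    wp src { s with r := some .one } (fun s₁ =>
      if s₁.r = some .one then wp body s₁ (fun s₂ => wp (whl (is .one)
        (seq src (ite (is .one) body skip))) s₂ Q F) F else Q s₁) F := by
  rw [forOnes, wp_seq, wp_set, wp_whl]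
  simp only [is, decide_true, if_true, wp_seq, wp_ite, wp_skip]
  have : (fun s₁ : St => if decide (s₁.r = some Sym.one) = true then
        wp body s₁ (fun s₁ => wp (whl (is .one) (seq src (ite (is .one) body skip))) s₁ Q F) F
      else wp (whl (is .one) (seq src (ite (is .one) body skip))) s₁ Q F) =
      (fun s₁ => if s₁.r = some .one then
        wp body s₁ (fun s₁ => wp (whl (is .one) (seq src (ite (is .one) body skip))) s₁ Q F) F
      else Q s₁) := by
    funext s₁
    by_cases h : s₁.r = some .one
    · simp [h]
    · simp only [h, decide_false, Bool.false_eq_true, if_false]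
      rw [wp_whl]
      simp [is, h]
  exact iff_of_eq (congrArg (fun Q' => wp src _ Q' F) this)

/-- `forOnes` starts by putting `one` into the control, so re-entering its loop after a `one`
amounts to starting afresh. This permits induction on the number read. -/
theorem wp_whl_ones {src body : Cmd} (hr : s.r = some .one) :
    wp (whl (is .one) (seq src (ite (is .one) body skip))) s Q F ↔ wp (forOnes src body) s Q F := by
  rw [forOnes, wp_seq, wp_set]
  have : ({ s with r := some .one } : St) = s := by cases s; simp only at hr; rw [hr]
  rw [this]

end Cmd
end KLMReach

/-! ### Programs that compare and update unary numbers and vectors -/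

namespace KLMReach
namespace Cmd

variable {s : St} {Q Q' : St → Prop} {F : Prop}
variable {r : Option Sym} {i j c v u p q o : List Sym} {e : Store} {x : Sym}

theorem replicate_append_cons {α : Type*} (n : ℕ) (a : α) (l : List α) :
    List.replicate n a ++ a :: l = List.replicate (n + 1) a ++ l := by
  rw [List.replicate_succ', List.append_assoc]; rfl

theorem wp_readNat_cur (n : ℕ)
    (hQ : n ≤ c.length → Q ⟨some .sep, i, (encNat n).reverse ++ j, c.drop n, v, u,
      List.replicate n .one ++ p, q, o, e⟩)
    (hF : c.length < n → F) :
    wp (forOnes rd (gen .cur .one)) ⟨r, encNat n ++ i, j, c, v, u, p, q, o, e⟩ Q F := by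
  induction n generalizing r j c p with
  | zero =>
    rw [wp_forOnes_round]
    simpa [encNat_zero] using hQ
  | succ n ih =>
    rw [wp_forOnes_round, encNat_succ, List.cons_append, wp_rd, if_pos rfl, wp_gen]
    cases c with
    | nil => exact hF (by simp)
    | cons y c =>
      simp only
      refine (wp_whl_ones rfl).2 (ih (fun h => ?_) fun h => hF (by simpa using h))
      have := hQ (by simpa using h)
      simpa [encNat_succ, St.get, St.set, replicate_append_cons] using this

theorem wp_readNat_tgt (n : ℕ)
    (hQ : n ≤ c.length → Q ⟨some .sep, i, (encNat n).reverse ++ j, c.drop n, v, u, p,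
      List.replicate n .one ++ q, o, e⟩)
    (hF : c.length < n → F) :
    wp (forOnes rd (gen .tgt .one)) ⟨r, encNat n ++ i, j, c, v, u, p, q, o, e⟩ Q F := by
  induction n generalizing r j c q with
  | zero =>
    rw [wp_forOnes_round]
    simpa [encNat_zero] using hQ
  | succ n ih =>
    rw [wp_forOnes_round, encNat_succ, List.cons_append, wp_rd, if_pos rfl, wp_gen]
    cases c with
    | nil => exact hF (by simp)
    | cons y c =>
      simp only
      refine (wp_whl_ones rfl).2 (ih (fun h => ?_) fun h => hF (by simpa using h))
      have := hQ (by simpa using h)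
      simpa [encNat_succ, St.get, St.set, replicate_append_cons] using this

/-- Read a number and compare it with the number on the stack `cur`, which is emptied. -/
def matchNat : Cmd :=
  seqs [forOnes rd (seq (pop .cur) (check (is .one))), pop .cur, check Option.isNone]

/-- Each `one` read pops a symbol of `cur`. An empty `cur` is detected on the way, and a leftover
symbol by the last pop. -/
theorem wp_matchNat (m n : ℕ)
    (hQ : m = n → Q ⟨none, i, (encNat m).reverse ++ j, c, v, u, [], q, o, e⟩) (hF : m ≠ n → F) :
    wp matchNat ⟨r, encNat m ++ i, j, c, v, u, List.replicate n .one, q, o, e⟩ Q F := by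
  rw [matchNat, wp_seqs_cons]
  induction m generalizing r j n with
  | zero =>
    rw [wp_forOnes_round]
    cases n with
    | zero => simpa [encNat_zero, St.get, St.set] using hQ
    | succ n => simpa [encNat_zero, St.get, St.set, List.replicate_succ] using hF
  | succ m ih =>
    rw [wp_forOnes_round, encNat_succ, List.cons_append, wp_rd, if_pos rfl, wp_seq, wp_pop, wp_check]
    cases n with
    | zero => simpa [St.get, St.set, is] using hF
    | succ n =>
      simp only [St.get, St.set, List.replicate_succ, List.tail_cons, List.head?_cons, is, decide_true,
        if_true]
      refine (wp_whl_ones rfl).2 (ih n (fun h => ?_) fun h => hF (by omega))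
      have := hQ (by omega)
      simpa [encNat_succ] using this

/-- Compare the numbers on the stacks `cur` and `tgt`, which are emptied. -/
def matchState : Cmd :=
  seqs [forOnes (pop .tgt) (seq (pop .cur) (check (is .one))), pop .cur, check Option.isNone]

theorem wp_matchState (m n : ℕ)
    (hQ : m = n → Q ⟨none, i, j, c, v, u, [], [], o, e⟩) (hF : m ≠ n → F) :
    wp matchState ⟨r, i, j, c, v, u, List.replicate n .one, List.replicate m .one, o, e⟩ Q F := by
  rw [matchState, wp_seqs_cons]
  induction m generalizing r n with
  | zero =>
    rw [wp_forOnes_round]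
    cases n with
    | zero => simpa [St.get, St.set] using hQ
    | succ n => simpa [St.get, St.set, List.replicate_succ] using hF
  | succ m ih =>
    rw [wp_forOnes_round, wp_pop]
    simp only [St.get, St.set, List.replicate_succ, List.tail_cons, List.head?_cons, if_true, wp_seq,
      wp_pop, wp_check]
    cases n with
    | zero => simpa [St.get, St.set, is] using hF
    | succ n =>
      simp only [List.replicate_succ, List.tail_cons, List.head?_cons, is, decide_true, if_true]
      exact (wp_whl_ones rfl).2 (ih n (fun h => hQ (by omega)) fun h => hF (by omega))

/-- Compare a `one` of the input with the current counter. -/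
def cmpOne : Cmd := seq (mv .cnt .cnt') (check (is .one))

/-- The part of the counter already compared is kept on `cnt'`, so that the comparison does not
destroy it. -/
theorem wp_cmpOnes (m n : ℕ)
    (hQ : m ≤ n → Q ⟨some .sep, i, (encNat m).reverse ++ j, c, encNat (n - m) ++ v,
      List.replicate m .one ++ u, p, q, o, e⟩)
    (hF : n < m → F) :
    wp (forOnes rd cmpOne) ⟨r, encNat m ++ i, j, c, encNat n ++ v, u, p, q, o, e⟩ Q F := by
  induction m generalizing r j n u with
  | zero =>
    rw [wp_forOnes_round]
    simpa [encNat_zero] using hQ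
  | succ m ih =>
    rw [wp_forOnes_round, encNat_succ, List.cons_append, wp_rd, if_pos rfl, cmpOne, wp_seq]
    cases n with
    | zero =>
      rw [encNat_zero, List.cons_append, wp_mv_cnt, wp_check]
      simpa [is] using hF
    | succ n =>
      rw [encNat_succ, List.cons_append, wp_mv_cnt, wp_check, if_pos (by simp [is])]
      refine (wp_whl_ones rfl).2 (ih n (fun h => ?_) fun h => hF (by omega))
      have := hQ (by omega)
      simpa [encNat_succ, replicate_append_cons] using this

/-- Read a component of a configuration, or the closing `bar`, and compare it with a counter. -/
def cmpComp : Cmd :=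
  seqs [rd, ite (is .bar) skip (ite (is .omega) (seqs [rd, mvUntil .sep .cnt .cnt'])
    (seqs [ite (is .one) (seq cmpOne (forOnes rd cmpOne)) skip, mv .cnt .cnt', check (is .sep)]))]

theorem sep_notMem_ones (n : ℕ) : Sym.sep ∉ List.replicate n Sym.one := by
  simp [List.mem_replicate]

theorem wp_cmpComp (x : ℕ∞) (n : ℕ)
    (hQ : ∀ j, SqLe n x → Q ⟨some .sep, i, j, c, v, (encNat n).reverse ++ u, p, q, o, e⟩)
    (hF : ¬ SqLe n x → F) :
    wp cmpComp ⟨r, encENat x ++ i, j, c, encNat n ++ v, u, p, q, o, e⟩ Q F := by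
  rw [cmpComp, wp_seqs_cons]
  have hn : (encNat n).reverse = .sep :: List.replicate n .one := by simp [encNat]
  rw [hn] at hQ
  induction x using ENat.recTopCoe with
  | top =>
    simp only [encENat, if_true, List.cons_append, wp_rd, wp_seqs_cons, wp_seqs_nil, wp_ite]
    -- An `ω` component accepts every value, so the counter is moved without inspection.
    rw [if_neg (by simp [is]), if_pos (by simp [is])]
    simp only [List.nil_append, encNat, List.append_assoc, List.singleton_append]
    rw [wp_mvUntil_cnt _ (sep_notMem_ones n)]
    simpa using hQ _ (Or.inr rfl)
  | coe m =>
    have hs : SqLe n (m : ℕ∞) ↔ m = n := by simp [SqLe]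
    rw [hs] at hQ hF
    simp only [encENat, ENat.natCast_ne_top, if_false, ENat.toNat_natCast]
    have hfin : ∀ (k : ℕ) (j' u' : List Sym), (k = 0 → Q ⟨some .sep, i, j', c, v, .sep :: u', p, q, o, e⟩) →
        (k ≠ 0 → F) → wp (seqs [mv .cnt .cnt', check (is .sep)])
          ⟨some .sep, i, j', c, encNat k ++ v, u', p, q, o, e⟩ Q F := by
      intro k j' u' h1 h2
      rw [wp_seqs_cons]
      cases k with
      | zero =>
        rw [encNat_zero, List.cons_append, wp_mv_cnt]
        simpa [is] using h1
      | succ k =>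
        rw [encNat_succ, List.cons_append, wp_mv_cnt]
        simpa [is] using h2
    cases m with
    | zero =>
      rw [encNat_zero, List.cons_append, wp_rd, wp_seqs_cons, wp_ite, if_neg (by simp [is]), wp_ite,
        if_neg (by simp [is]), wp_seqs_cons, wp_ite, if_neg (by simp [is]), wp_skip]
      simp only [wp_seqs_nil, List.nil_append]
      refine hfin n _ _ (fun h => ?_) fun h => hF (Ne.symm h)
      subst h
      simpa using hQ _ rfl
    | succ m =>
      rw [encNat_succ, List.cons_append, wp_rd, wp_seqs_cons, wp_ite, if_neg (by simp [is]), wp_ite,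
        if_neg (by simp [is]), wp_seqs_cons, wp_ite, if_pos (by simp [is]), wp_seq]
      cases n with
      | zero =>
        rw [cmpOne, wp_seq, encNat_zero, List.cons_append, wp_mv_cnt]
        simpa [is] using hF
      | succ n =>
        rw [cmpOne, wp_seq, encNat_succ n, List.cons_append, wp_mv_cnt, wp_check, if_pos (by simp [is])]
        refine wp_cmpOnes m n (fun h => ?_) fun h => hF (by omega)
        simp only [wp_seqs_nil]
        refine hfin (n - m) _ _ (fun h' => ?_) fun h' => hF (by omega)
        have hmn : m = n := by omega
        subst hmn
        simpa [replicate_append_cons] using hQ _ rfl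

/-- The counters with the values `l`. -/
def encVec (l : List ℕ) : List Sym := (l.map encNat).flatten

/-- Compare the counters with a configuration of the input. -/
def cmpConfig : Cmd :=
  seqs [set (some .one), whl (isnt .bar) cmpComp, mvAll .cnt' .cnt]

/-- The counters already compared lie reversed on `cnt'` and are moved back at the end, ready for
the run that follows. -/
theorem wp_cmpConfig (xs : List ℕ∞) (ns : List ℕ) (hlen : xs.length = ns.length)
    (hQ : ∀ j, List.Forall₂ (fun x (n : ℕ) => SqLe n x) xs ns →
      Q ⟨none, i, j, c, encVec ns, [], p, q, o, e⟩)
    (hF : ¬ List.Forall₂ (fun x (n : ℕ) => SqLe n x) xs ns → F) :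
    wp cmpConfig ⟨r, (xs.map encENat).flatten ++ .bar :: i, j, c, encVec ns, [], p, q, o, e⟩ Q F := by
  have loop : ∀ (r : Option Sym) (j u : List Sym) (Q : St → Prop), r ≠ some .bar →
      (∀ j, List.Forall₂ (fun x (n : ℕ) => SqLe n x) xs ns →
        Q ⟨some .bar, i, j, c, [], (encVec ns).reverse ++ u, p, q, o, e⟩) →
      wp (whl (isnt .bar) cmpComp)
        ⟨r, (xs.map encENat).flatten ++ .bar :: i, j, c, encVec ns, u, p, q, o, e⟩ Q F := by
    clear hQ
    induction xs generalizing ns with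
    | nil =>
      intro r j u Q hr hQ
      cases ns with
      | cons => simp at hlen
      | nil =>
        rw [wp_whl, if_pos (by simp [isnt, hr]), cmpComp, wp_seqs_cons]
        simp only [List.map_nil, List.flatten_nil, List.nil_append, wp_rd, wp_seqs_cons, wp_seqs_nil]
        rw [wp_ite, if_pos (by simp [is]), wp_skip, wp_whl, if_neg (by simp [isnt])]
        simpa [encVec] using hQ _ .nil
    | cons x xs ih =>
      intro r j u Q hr hQ
      cases ns with
      | nil => simp at hlen
      | cons n ns =>
        rw [wp_whl, if_pos (by simp [isnt, hr])]
        simp only [encVec, List.map_cons, List.flatten_cons, List.append_assoc] at hQ ⊢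
        refine wp_cmpComp x n (fun j hx => ?_) fun hx => hF fun h => ?_
        · refine ih ns (by simpa using hlen) (fun h => hF fun h' => ?_) _ _ _ _ (by simp) fun j h => ?_
          · cases h' with | cons _ h' => exact h h'
          · simpa [encVec] using hQ j (.cons hx h)
        · cases h with | cons h _ => exact hx h
  rw [cmpConfig, wp_seqs_cons, wp_set, wp_seqs_cons]
  refine loop _ _ _ _ (by simp) fun j h => ?_
  rw [wp_seqs_cons, wp_mvAll_cnt, wp_seqs_nil]
  simpa using hQ j h

theorem wp_plusOnes (n : ℕ)
    (hQ : 2 * n + 1 ≤ c.length → Q ⟨some .sep, i, (encNat n).reverse ++ j, c.drop (2 * n + 1),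
      List.replicate n .one ++ v, u, p, q, (encNat n).reverse ++ o, e⟩)
    (hF : c.length < 2 * n + 1 → F) :
    wp (forOnes rdo (gen .cnt .one)) ⟨r, encNat n ++ i, j, c, v, u, p, q, o, e⟩ Q F := by
  induction n generalizing r j c v o with
  | zero =>
    rw [wp_forOnes_round, encNat_zero, List.cons_append, wp_rdo]
    cases c with
    | nil => exact hF (by simp)
    | cons y c => simpa [encNat_zero] using hQ
  | succ n ih =>
    rw [wp_forOnes_round, encNat_succ, List.cons_append, wp_rdo]
    rcases c with _ | ⟨y, _ | ⟨y', c⟩⟩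
    · exact hF (by simp)
    · simp only [if_true, wp_gen]
      exact hF (by simp)
    · simp only [if_true, wp_gen, St.get, St.set]
      refine (wp_whl_ones rfl).2 (ih (fun h => ?_) fun h => hF (by simp only [List.length_cons]; omega))
      have := hQ (by simp only [List.length_cons]; omega)
      simpa [encNat_succ, St.get, St.set, replicate_append_cons, mul_add] using this

theorem wp_minusOnes (n m : ℕ)
    (hQ : n ≤ m → n + 1 ≤ c.length → Q ⟨some .sep, i, (encNat n).reverse ++ j, c.drop (n + 1),
      encNat (m - n) ++ v, u, p, q, (encNat n).reverse ++ o, e⟩)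
    (hF : m < n ∨ c.length < n + 1 → F) :
    wp (forOnes rdo (seq (pop .cnt) (check (is .one))))
      ⟨r, encNat n ++ i, j, c, encNat m ++ v, u, p, q, o, e⟩ Q F := by
  induction n generalizing r j c m o with
  | zero =>
    rw [wp_forOnes_round, encNat_zero, List.cons_append, wp_rdo]
    cases c with
    | nil => exact hF (by simp)
    | cons y c => simpa [encNat_zero] using hQ
  | succ n ih =>
    rw [wp_forOnes_round, encNat_succ, List.cons_append, wp_rdo]
    cases c with
    | nil => exact hF (by simp)
    | cons y c =>
      simp only [if_true, wp_seq, wp_pop, wp_check, St.get, St.set]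
      cases m with
      | zero =>
        rw [encNat_zero]
        simpa [is] using hF
      | succ m =>
        rw [encNat_succ]
        simp only [List.cons_append, List.tail_cons, List.head?_cons, is, decide_true, if_true]
        refine (wp_whl_ones rfl).2 (ih m (fun h h' => ?_) fun h => hF ?_)
        · have := hQ (by omega) (by simp only [List.length_cons]; omega)
          simpa [encNat_succ] using this
        · simp only [List.length_cons]; omega

/-- Read a component of an action, or the closing `bar`, and add it to a counter. -/
def actComp : Cmd :=
  seqs [rdo, ite (is .bar) skip (seqs [
    ite (is .minus) (forOnes rdo (seq (pop .cnt) (check (is .one))))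
      (ite (is .one) (seq (gen .cnt .one) (forOnes rdo (gen .cnt .one))) skip),
    mvUntil .sep .cnt .cnt'])]

/-- The number of choices spent on a component of an action. -/
def compCost (z : ℤ) : ℕ := (encInt z).length + z.toNat

theorem length_encNat (n : ℕ) : (encNat n).length = n + 1 := by simp [encNat]

/-- Each symbol copied to the result and each increment costs a choice; decrements are free.
Decrementing a counter that is 0 meets its `sep` and fails: this is the test for nonnegativity. -/
theorem wp_actComp (z : ℤ) (m : ℕ)
    (hQ : 0 ≤ m + z → compCost z ≤ c.length → Q ⟨some .sep, i, (encInt z).reverse ++ j,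
      c.drop (compCost z), v, (encNat (m + z).toNat).reverse ++ u, p, q, (encInt z).reverse ++ o, e⟩)
    (hF : m + z < 0 ∨ c.length < compCost z → F) :
    wp actComp ⟨r, encInt z ++ i, j, c, encNat m ++ v, u, p, q, o, e⟩ Q F := by
  have hmv : ∀ (k : ℕ) (j c o : List Sym), wp (seqs [mvUntil .sep .cnt .cnt'])
      ⟨some .sep, i, j, c, encNat k ++ v, u, p, q, o, e⟩ Q F ↔
      Q ⟨some .sep, i, j, c, v, (encNat k).reverse ++ u, p, q, o, e⟩ := by
    intro k j c o
    rw [wp_seqs_cons, encNat, List.append_assoc, List.singleton_append,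
      wp_mvUntil_cnt _ (sep_notMem_ones k)]
    simp
  rw [actComp, wp_seqs_cons]
  rcases lt_or_ge z 0 with hz | hz
  · obtain ⟨n, rfl⟩ : ∃ n : ℕ, z = -(n : ℤ) := ⟨z.natAbs, by omega⟩
    have he : encInt (-(n : ℤ)) = .minus :: encNat n := by
      rw [encInt, if_pos hz]; simp
    have hc : compCost (-(n : ℤ)) = n + 2 := by simp [compCost, he, length_encNat]
    rw [he, hc] at hQ
    rw [hc] at hF
    rw [he, List.cons_append, wp_rdo]
    cases c with
    | nil => exact hF (by simp)
    | cons y c =>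
      simp only [wp_seqs_cons, wp_seqs_nil]
      rw [wp_ite, if_neg (by simp [is]), wp_seqs_cons, wp_ite, if_pos (by simp [is])]
      refine wp_minusOnes n m (fun h h' => ?_) fun h => hF (by simp only [List.length_cons]; omega)
      rw [hmv]
      have := hQ (by omega) (by simp only [List.length_cons]; omega)
      have e1 : (m + -(n : ℤ)).toNat = m - n := by omega
      simpa [e1] using this
  · obtain ⟨n, rfl⟩ : ∃ n : ℕ, z = n := ⟨z.toNat, by omega⟩
    have he : encInt (n : ℤ) = encNat n := by simp [encInt]
    have hc : compCost (n : ℤ) = 2 * n + 1 := by simp [compCost, he, length_encNat]; omega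
    rw [he, hc] at hQ
    rw [hc] at hF
    rw [he]
    have e1 : (m + (n : ℤ)).toNat = m + n := by omega
    rw [e1] at hQ
    cases n with
    | zero =>
      rw [encNat_zero, List.cons_append, wp_rdo]
      cases c with
      | nil => exact hF (by simp)
      | cons y c =>
        simp only [wp_seqs_cons, wp_seqs_nil]
        rw [wp_ite, if_neg (by simp [is]), wp_seqs_cons, wp_ite, if_neg (by simp [is]), wp_ite,
          if_neg (by simp [is]), wp_skip, List.nil_append]
        refine (hmv m _ _ _).2 ?_
        have := hQ (by omega) (by simp)
        simpa [encNat_zero] using this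
    | succ n =>
      rw [encNat_succ, List.cons_append, wp_rdo]
      rcases c with _ | ⟨y, _ | ⟨y', c⟩⟩
      · exact hF (by simp)
      · simp only [wp_seqs_cons, wp_seqs_nil]
        rw [wp_ite, if_neg (by simp [is]), wp_seqs_cons, wp_ite, if_neg (by simp [is]), wp_ite,
          if_pos (by simp [is]), wp_seq, wp_gen]
        exact hF (by simp)
      · simp only [wp_seqs_cons, wp_seqs_nil]
        rw [wp_ite, if_neg (by simp [is]), wp_seqs_cons, wp_ite, if_neg (by simp [is]), wp_ite,
          if_pos (by simp [is]), wp_seq, wp_gen]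
        simp only [St.get, St.set]
        refine wp_plusOnes n (fun h => ?_) fun h => hF (by simp only [List.length_cons]; omega)
        have e2 : List.replicate n .one ++ (.one :: (encNat m ++ v)) = encNat (m + (n + 1)) ++ v := by
          simp only [encNat]
          rw [show m + (n + 1) = n + 1 + m by omega, List.replicate_add, List.replicate_succ']
          simp
        rw [e2]
        refine (hmv _ _ _ _).2 ?_
        have := hQ (by omega) (by simp only [List.length_cons]; omega)
        simpa [encNat_succ, mul_add] using this

/-- Add an action of the input to the counters, and copy it to the result. -/
def applyAct : Cmd :=
  seqs [set (some .one), whl (isnt .bar) actComp, mvAll .cnt' .cnt]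

/-- The number of choices spent on an action. -/
def actCost (as : List ℤ) : ℕ := (as.map compCost).sum + 1

/-- The presentation of an action that is given by a list. -/
def encInts (as : List ℤ) : List Sym := (as.map encInt).flatten ++ [.bar]

theorem wp_applyAct (as : List ℤ) (ns : List ℕ) (hlen : as.length = ns.length)
    (hQ : ∀ ms : List ℕ, List.Forall₂ (fun (p : ℕ × ℤ) (m : ℕ) => (m : ℤ) = p.1 + p.2) (ns.zip as) ms →
      actCost as ≤ c.length → Q ⟨none, i, (encInts as).reverse ++ j, c.drop (actCost as), encVec ms, [],
        p, q, (encInts as).reverse ++ o, e⟩)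
    (hF : (¬ ∃ ms : List ℕ, List.Forall₂ (fun (p : ℕ × ℤ) (m : ℕ) => (m : ℤ) = p.1 + p.2)
      (ns.zip as) ms) ∨ c.length < actCost as → F) :
    wp applyAct ⟨r, encInts as ++ i, j, c, encVec ns, [], p, q, o, e⟩ Q F := by
  have loop : ∀ (r : Option Sym) (j c u o : List Sym) (Q : St → Prop), r ≠ some .bar →
      (∀ ms : List ℕ, List.Forall₂ (fun (p : ℕ × ℤ) (m : ℕ) => (m : ℤ) = p.1 + p.2) (ns.zip as) ms →
        actCost as ≤ c.length → Q ⟨some .bar, i, (encInts as).reverse ++ j, c.drop (actCost as), [],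
          (encVec ms).reverse ++ u, p, q, (encInts as).reverse ++ o, e⟩) →
      ((¬ ∃ ms : List ℕ, List.Forall₂ (fun (p : ℕ × ℤ) (m : ℕ) => (m : ℤ) = p.1 + p.2)
        (ns.zip as) ms) ∨ c.length < actCost as → F) →
      wp (whl (isnt .bar) actComp) ⟨r, encInts as ++ i, j, c, encVec ns, u, p, q, o, e⟩ Q F := by
    clear hQ hF
    induction as generalizing ns with
    | nil =>
      intro r j c u o Q hr hQ hF
      cases ns with
      | cons => simp at hlen
      | nil =>
        rw [wp_whl, if_pos (by simp [isnt, hr]), actComp, wp_seqs_cons]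
        simp only [encInts, List.map_nil, List.flatten_nil, List.nil_append, List.singleton_append, wp_rdo]
        cases c with
        | nil => exact hF (by simp [actCost])
        | cons y c =>
          simp only [wp_seqs_cons, wp_seqs_nil]
          rw [wp_ite, if_pos (by simp [is]), wp_skip, wp_whl, if_neg (by simp [isnt])]
          simpa [encVec, encInts, actCost] using hQ [] .nil
    | cons a as ih =>
      intro r j c u o Q hr hQ hF
      cases ns with
      | nil => simp at hlen
      | cons n ns =>
        rw [wp_whl, if_pos (by simp [isnt, hr])]
        have hea : encInts (a :: as) = encInt a ++ encInts as := by simp [encInts]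
        have hcost : actCost (a :: as) = compCost a + actCost as := by simp [actCost, add_assoc]
        have hev : ∀ (n : ℕ) ns, encVec (n :: ns) = encNat n ++ encVec ns := fun n ns => by simp [encVec]
        rw [hea, hcost] at hQ
        rw [hcost] at hF
        rw [hea, List.append_assoc, hev]
        refine wp_actComp a n (fun hz hc => ?_) fun h => hF ?_
        · refine ih ns (by simpa using hlen) _ _ _ _ _ _ (by simp) (fun ms hms hc' => ?_) fun h => hF ?_
          · have := hQ ((n + a).toNat :: ms) (.cons (by simpa using hz) hms) (by simp at hc'; omega)
            simpa [hev, add_comm] using this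
          · rcases h with h | h
            · left
              rintro ⟨ms, hms⟩
              cases hms with | cons _ hms => exact h ⟨_, hms⟩
            · right; simp at h; omega
        · rcases h with h | h
          · left
            rintro ⟨ms, hms⟩
            cases hms with
            | cons h1 _ => simp only at h1; omega
          · right; omega
  rw [applyAct, wp_seqs_cons, wp_set, wp_seqs_cons]
  refine loop _ _ _ _ _ _ (by simp) (fun ms hms hc => ?_) hF
  rw [wp_seqs_cons, wp_mvAll_cnt, wp_seqs_nil]
  simpa using hQ ms hms hc

end Cmd
end KLMReach

/-! ### Following a path of a VASS under the guidance of choices -/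

namespace KLMReach
namespace Cmd

variable {s : St} {Q Q' : St → Prop} {F : Prop}
variable {r : Option Sym} {i j c v u p q o : List Sym} {e : Store} {x : Sym}
variable {d : ℕ}

/-- The counters with the values of a vector. -/
def encFin (m : Fin d → ℕ) : List Sym := encVec (List.ofFn m)

theorem wp_cmpConfig_fin (x : Config d) (m : Fin d → ℕ)
    (hQ : ∀ j, (∀ i, SqLe (m i) (x i)) → Q ⟨none, i, j, c, encFin m, [], p, q, o, e⟩)
    (hF : (¬ ∀ i, SqLe (m i) (x i)) → F) :
    wp cmpConfig ⟨r, encConfig x ++ i, j, c, encFin m, [], p, q, o, e⟩ Q F := by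
  have h : List.Forall₂ (fun x (n : ℕ) => SqLe n x) (List.ofFn x) (List.ofFn m) ↔
      ∀ i, SqLe (m i) (x i) := by
    rw [List.forall₂_iff_get]
    simp only [List.length_ofFn, List.get_ofFn]
    exact ⟨fun h i => h.2 i i.2 i.2, fun h => ⟨trivial, fun i h1 h2 => h ⟨i, h1⟩⟩⟩
  have := wp_cmpConfig (Q := Q) (F := F) (r := r) (i := i) (j := j) (c := c) (p := p) (q := q) (o := o)
    (e := e) (List.ofFn x) (List.ofFn m) (by simp) (fun j h' => hQ j (h.1 h')) (by rwa [h])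
  simpa [encFin, encConfig, List.map_ofFn, Function.comp_def] using this

theorem encAction_eq (a : Action d) : encAction a = encInts (List.ofFn a) := by
  simp [encAction, encInts, List.map_ofFn, Function.comp_def]

/-- The number of choices spent on an action. -/
def finCost (a : Action d) : ℕ := actCost (List.ofFn a)

theorem finCost_le (a : Action d) : finCost a ≤ 2 * actionNorm a + d + 1 := by
  have h : ∀ z : ℤ, compCost z ≤ 2 * z.natAbs + 1 := by
    intro z
    unfold compCost encInt
    split_ifs with hz
    · simp [length_encNat]; omega
    · simp [length_encNat]; omega
  have : (List.map compCost (List.ofFn a)).sum ≤ ∑ i, (2 * (a i).natAbs + 1) := by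
    rw [List.map_ofFn, List.sum_ofFn]
    exact Finset.sum_le_sum fun i _ => h _
  rw [Finset.sum_add_distrib, ← Finset.mul_sum] at this
  simp only [Finset.sum_const, Finset.card_univ, Fintype.card_fin, smul_eq_mul, mul_one] at this
  unfold finCost actCost actionNorm
  omega

theorem wp_applyAct_fin (a : Action d) (m : Fin d → ℕ)
    (hQ : ∀ m' : Fin d → ℕ, Step (finConfig m) a (finConfig m') → finCost a ≤ c.length →
      Q ⟨none, i, (encAction a).reverse ++ j, c.drop (finCost a), encFin m', [], p, q,
        (encAction a).reverse ++ o, e⟩)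
    (hF : (¬ ∃ m' : Fin d → ℕ, Step (finConfig m) a (finConfig m')) ∨ c.length < finCost a → F) :
    wp applyAct ⟨r, encAction a ++ i, j, c, encFin m, [], p, q, o, e⟩ Q F := by
  have h : ∀ m' : Fin d → ℕ, List.Forall₂ (fun (p : ℕ × ℤ) (m : ℕ) => (m : ℤ) = p.1 + p.2)
      ((List.ofFn m).zip (List.ofFn a)) (List.ofFn m') ↔ Step (finConfig m) a (finConfig m') := by
    intro m'
    rw [List.forall₂_iff_get, KLM.step_finConfig_iff]
    simp only [List.length_zip, List.length_ofFn, List.get_eq_getElem, List.getElem_zip,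
      List.getElem_ofFn, min_self]
    exact ⟨fun h i => h.2 i i.2 i.2, fun h => ⟨trivial, fun i h1 h2 => h ⟨i, h1⟩⟩⟩
  rw [encAction_eq] at hQ ⊢
  refine wp_applyAct _ _ (by simp) (fun ms hms hc => ?_) fun h' => hF ?_
  · have hlen : ms.length = d := by simpa using hms.length_eq.symm
    subst hlen
    have h1 := hQ ms.get ((h _).1 (by rwa [List.ofFn_get])) hc
    rwa [encFin, List.ofFn_get] at h1
  · exact h'.imp_left fun h' ⟨m', hm'⟩ => h' ⟨_, (h m').2 hm'⟩

/-- Take the transition of the input. -/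
def take : Cmd := seqs [matchNat, applyAct, forOnes rd (gen .cur .one), set (some .one)]

/-- Skip the transition of the input. -/
def skipTrans : Cmd := seqs [mvUntil .bar .inp .read, mvUntil .sep .inp .read, set (some .one)]

/-- Take or skip a transition; at the end of the list, go back to its beginning or leave it. -/
def transBody : Cmd :=
  seq rd (ite (is .trans) (seq ch (ite (is .one) take skipTrans))
    (seq ch (ite (is .one) (seq (mvAll .read .inp) (set (some .one))) (set none))))

/-- Follow a path. -/
def transLoop : Cmd := whl Option.isSome transBody

variable {Qs : Type u} {N : ℕ} (ν : Qs ≃ Fin N)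

/-- The presentation of a list of transitions. -/
def encList (l : List (Qs × Action d × Qs)) : List Sym := (l.map (encTrans ν)).flatten

/-- The number of a state. -/
def num (s : Qs) : List Sym := List.replicate (ν s) .one

theorem bar_notMem_encInt (z : ℤ) : Sym.bar ∉ encInt z := by
  unfold encInt encNat
  split_ifs <;> simp [List.mem_replicate]

theorem wp_transLoop_trans (t : Qs × Action d × Qs) :
    wp transLoop ⟨some .one, encTrans ν t ++ i, j, c, v, u, p, q, o, e⟩ Q F ↔
      wp (seq ch (ite (is .one) take skipTrans))
        ⟨some .trans, encNat (ν t.1) ++ encAction t.2.1 ++ encNat (ν t.2.2) ++ i, .trans :: j, c, v, u, p,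
          q, o, e⟩ (fun s => wp transLoop s Q F) F := by
  rw [transLoop, wp_whl, if_pos (by rfl), transBody, wp_seq]
  rw [encTrans, List.cons_append, wp_rd, wp_ite, if_pos (by simp [is])]

/-- At the end of the list a `one` rewinds it from `read`, so that transitions can be taken in any
order and repeatedly; any other choice ends the path. -/
theorem wp_transLoop_close :
    wp transLoop ⟨some .one, .close :: i, j, c, v, u, p, q, o, e⟩ Q F ↔
      match c with
      | [] => F
      | x :: c => if x = .one then
          wp transLoop ⟨some .one, j.reverse ++ .close :: i, [], c, v, u, p, q, o, e⟩ Q F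
        else Q ⟨none, i, .close :: j, c, v, u, p, q, o, e⟩ := by
  rw [transLoop, wp_whl, if_pos (by rfl), transBody, wp_seq, wp_rd, wp_ite, if_neg (by simp [is]), wp_seq,
    wp_ch]
  cases c with
  | nil => rfl
  | cons x c =>
    simp only [wp_ite, is]
    by_cases hx : x = .one
    · simp only [hx, decide_true, if_true, wp_seq, wp_mvAll_read, wp_set]
      simp
    · simp only [hx, Option.some.injEq, decide_false, Bool.false_eq_true, if_false, wp_set]
      rw [wp_whl, if_neg (by simp)]

/-- The first `bar` closes the action, and the next `sep` closes the number of the target state. -/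
theorem wp_skipTrans (t : Qs × Action d × Qs) :
    wp skipTrans ⟨r, encNat (ν t.1) ++ encAction t.2.1 ++ encNat (ν t.2.2) ++ i, .trans :: j, c, v, u, p,
        q, o, e⟩ Q F ↔
      Q ⟨some .one, i, (encTrans ν t).reverse ++ j, c, v, u, p, q, o, e⟩ := by
  have h : encNat (ν t.1) ++ encAction t.2.1 ++ encNat (ν t.2.2) ++ i =
      (encNat (ν t.1) ++ (List.ofFn fun i => encInt (t.2.1 i)).flatten) ++ .bar ::
        (List.replicate (ν t.2.2) .one ++ .sep :: i) := by
    simp [encAction, encNat]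
  have hbar : Sym.bar ∉ encNat (ν t.1) ++ (List.ofFn fun i => encInt (t.2.1 i)).flatten := by
    rw [List.mem_append, not_or]
    constructor
    · simp [encNat, List.mem_replicate]
    · simp only [List.mem_flatten, List.mem_ofFn, not_exists, not_and]
      rintro _ ⟨k, rfl⟩
      exact bar_notMem_encInt _
  rw [skipTrans, wp_seqs_cons, h, wp_mvUntil_rd _ hbar, wp_seqs_cons, wp_mvUntil_rd _ (sep_notMem_ones _),
    wp_seqs_cons, wp_set, wp_seqs_nil]
  simp [encTrans, encAction, encNat]

/-- The stack `cur` holds the current state: it must match the source, and it is refilled with the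
number of the target. -/
theorem wp_take (t : Qs × Action d × Qs) (s : Qs) (m : Fin d → ℕ)
    (hQ : ∀ m' : Fin d → ℕ, t.1 = s → Step (finConfig m) t.2.1 (finConfig m') →
      finCost t.2.1 + ν t.2.2 ≤ c.length →
      Q ⟨some .one, i, (encTrans ν t).reverse ++ j, c.drop (finCost t.2.1 + ν t.2.2), encFin m', [],
        num ν t.2.2, q, (encAction t.2.1).reverse ++ o, e⟩)
    (hF : (t.1 ≠ s ∨ ¬ ∃ m' : Fin d → ℕ, Step (finConfig m) t.2.1 (finConfig m')) ∨
      c.length < finCost t.2.1 + ν t.2.2 → F) :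
    wp take ⟨r, encNat (ν t.1) ++ encAction t.2.1 ++ encNat (ν t.2.2) ++ i, .trans :: j, c, encFin m, [],
      num ν s, q, o, e⟩ Q F := by
  rw [take, wp_seqs_cons, List.append_assoc, List.append_assoc]
  refine wp_matchNat _ _ (fun h1 => ?_) fun h1 => hF (Or.inl (Or.inl fun h => h1 (by rw [h])))
  have h1' : t.1 = s := ν.injective (Fin.ext h1)
  rw [wp_seqs_cons]
  refine wp_applyAct_fin _ _ (fun m' h2 h3 => ?_) fun h => hF ?_
  · rw [wp_seqs_cons]
    refine wp_readNat_cur _ (fun h4 => ?_) fun h => hF (Or.inr ?_)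
    · simp only [List.length_drop] at h4
      have := hQ m' h1' h2 (by omega)
      simpa [encTrans, num] using this
    · simp only [List.length_drop] at h
      omega
  · rcases h with h | h
    · exact Or.inl (Or.inr h)
    · exact Or.inr (by omega)

theorem encList_cons (t : Qs × Action d × Qs) (l : List (Qs × Action d × Qs)) :
    encList ν (t :: l) = encTrans ν t ++ encList ν l := by simp [encList]

/-- The words over `one` and `sep`. -/
def Binary (c : List Sym) : Prop := ∀ x ∈ c, x = .one ∨ x = .sep

theorem binary_replicate (n : ℕ) : Binary (List.replicate n .sep) := fun _ h =>
  Or.inr (List.mem_replicate.1 h).2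

theorem Binary.append {c c' : List Sym} (h : Binary c) (h' : Binary c') : Binary (c ++ c') := fun x hx =>
  (List.mem_append.1 hx).elim (h x) (h' x)

theorem Binary.cons {c : List Sym} (h : Binary c) {x : Sym} (hx : x = .one ∨ x = .sep) :
    Binary (x :: c) := List.forall_mem_cons.2 ⟨hx, h⟩

theorem encWord_cons (a : Action d) (σ : List (Action d)) :
    encWord (a :: σ) = encAction a ++ encWord σ := by simp [encWord]

theorem encWord_append (σ τ : List (Action d)) :
    encWord (σ ++ τ) = encWord σ ++ encWord τ := by simp [encWord]

/-- Each round consumes a choice, so the induction on the number of choices also proves termination.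
The list is split into the part already read, reversed on `read`, and the rest, so that rewinding
restores the whole list. -/
theorem wp_transLoop_sound (G : VASS.{u} d) {N : ℕ} (ν : G.Q ≃ Fin N) (l : List (G.Q × Action d × G.Q))
    (hl : ∀ t ∈ l, t ∈ G.T) (n : ℕ) :
    ∀ (l₁ l₂ : List (G.Q × Action d × G.Q)) (s : G.Q) (m : Fin d → ℕ) (c o : List Sym), l = l₁ ++ l₂ →
      c.length ≤ n →
      (∀ π s' (m' : Fin d → ℕ) j c', G.Path s π s' →
        Run (finConfig m) (G.label π) (finConfig m') →
        Q ⟨none, i, j, c', encFin m', [], num ν s', q, (encWord (G.label π)).reverse ++ o, e⟩) →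
      wp transLoop ⟨some .one, encList ν l₂ ++ .close :: i, (encList ν l₁).reverse, c, encFin m, [],
        num ν s, q, o, e⟩ Q True := by
  induction n with
  | zero =>
    intro l₁ l₂ s m c o hll hc hQ
    have hc : c = [] := by simpa using hc
    subst hc
    cases l₂ with
    | nil => exact wp_transLoop_close.2 trivial
    | cons t l₂ =>
      rw [encList_cons, List.append_assoc, wp_transLoop_trans, wp_seq, wp_ch]
      trivial
  | succ n ih =>
    intro l₁ l₂ s m c o hll hc hQ
    cases l₂ with
    | nil =>
      refine wp_transLoop_close.2 ?_
      cases c with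
      | nil => trivial
      | cons x c =>
        simp only
        split_ifs with hx
        · rw [List.reverse_reverse]
          exact ih [] l₁ s m c o (by simpa using hll) (by simpa using hc) hQ
        · simpa [VASS.label, encWord] using hQ [] s m _ c rfl rfl
    | cons t l₂ =>
      rw [encList_cons, List.append_assoc, wp_transLoop_trans, wp_seq, wp_ch]
      cases c with
      | nil => trivial
      | cons x c =>
        simp only
        have hc' : c.length ≤ n := by simpa using hc
        have hr : (encTrans ν t).reverse ++ (encList ν l₁).reverse = (encList ν (l₁ ++ [t])).reverse := by
          simp [encList]
        have hll' : l = (l₁ ++ [t]) ++ l₂ := by simp [hll]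
        rw [wp_ite]
        split_ifs with hx
        · refine wp_take ν t s m (fun m' h1 h2 h3 => ?_) fun _ => trivial
          rw [hr]
          refine ih _ _ _ _ _ _ hll' (by simp; omega) fun π s' m'' j c' hπ hrun => ?_
          have := hQ (t :: π) s' m'' j c' ⟨hl t (by simp [hll]), h1, hπ⟩ ⟨_, h2, hrun⟩
          simpa [VASS.label, encWord_cons] using this
        · rw [wp_skipTrans, hr]
          exact ih _ _ _ _ _ _ hll' hc' hQ

theorem wp_transLoop_skip (l₁ l₂ : List (Qs × Action d × Qs))
    (h : wp transLoop ⟨some .one, encList ν l₂ ++ i, (encList ν l₁).reverse ++ j, c, v, u, p, q, o, e⟩ Q F) :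
    wp transLoop ⟨some .one, encList ν (l₁ ++ l₂) ++ i, j, List.replicate l₁.length .sep ++ c, v, u, p, q,
      o, e⟩ Q F := by
  induction l₁ generalizing j with
  | nil => simpa [encList] using h
  | cons t l₁ ih =>
    rw [List.cons_append, encList_cons, List.append_assoc, wp_transLoop_trans, wp_seq, wp_ch]
    simp only [List.length_cons, List.replicate_succ, List.cons_append]
    rw [wp_ite, if_neg (by simp [is]), wp_skipTrans]
    refine ih ?_
    simpa [encList] using h

/-- The number of choices spent on a path. -/
def pathCost (n : ℕ) (π : List (Qs × Action d × Qs)) : ℕ :=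
  (π.map fun t => n + 1 + finCost t.2.1 + ν t.2.2).sum + n + 1

/-- Each letter of the path takes one passage through the list: skip to its transition, take it,
skip the rest, rewind. A last passage skips everything and leaves the loop. -/
theorem wp_transLoop_complete (G : VASS.{u} d) {N : ℕ} (ν : G.Q ≃ Fin N)
    (l : List (G.Q × Action d × G.Q)) (hl : ∀ t ∈ G.T, t ∈ l) (π : List (G.Q × Action d × G.Q)) :
    ∀ (s s' : G.Q) (m m' : Fin d → ℕ), G.Path s π s' → Run (finConfig m) (G.label π) (finConfig m') →
      ∃ cs, Binary cs ∧ cs.length = pathCost ν l.length π ∧ ∀ (e : Store) (c o : List Sym),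
        (∀ j, Q ⟨none, i, j, c, encFin m', [], num ν s', q, (encWord (G.label π)).reverse ++ o, e⟩) →
        wp transLoop ⟨some .one, encList ν l ++ .close :: i, [], cs ++ c, encFin m, [], num ν s, q, o, e⟩
          Q False := by
  induction π with
  | nil =>
    intro s s' m m' hπ hrun
    have hss : s = s' := hπ
    have hmm : m = m' := by
      funext k
      exact ENat.natCast_inj.1 (congrFun (show finConfig m = finConfig m' from hrun) k)
    subst hss hmm
    refine ⟨List.replicate l.length .sep ++ [.sep], (binary_replicate _).append (by simp [Binary]),
      by simp [pathCost], fun e c o hQ => ?_⟩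
    have := wp_transLoop_skip (Q := Q) (F := False) (i := .close :: i) (j := []) (c := .sep :: c)
      (v := encFin m) (u := []) (p := num ν s) (q := q) (o := o) (e := e) ν l [] ?_
    · simpa using this
    · refine wp_transLoop_close.2 ?_
      simpa [VASS.label, encWord] using hQ _
  | cons t π ih =>
    intro s s' m m' hπ hrun
    obtain ⟨ht, hts, hπ⟩ := hπ
    obtain ⟨c₁, hstep, hrun⟩ := hrun
    have hc₁ : ∃ m₁ : Fin d → ℕ, c₁ = finConfig m₁ := by
      refine ⟨fun k => (c₁ k).toNat, ?_⟩
      funext k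
      rcases hstep k with ⟨h, -⟩ | ⟨_, n, -, h, -⟩
      · exact absurd h (ENat.natCast_ne_top _)
      · simp [finConfig, h]
    obtain ⟨m₁, rfl⟩ := hc₁
    obtain ⟨cs, hcs, hlen, hwp⟩ := ih t.2.2 s' m₁ m' hπ hrun
    obtain ⟨l₁, l₂, rfl⟩ := List.append_of_mem (hl t ht)
    -- The block of length `finCost + ν` is spent on the symbols written while the transition is
    -- taken, so its contents are irrelevant.
    refine ⟨List.replicate l₁.length .sep ++ (.one :: (List.replicate (finCost t.2.1 + ν t.2.2) .sep ++
      (List.replicate l₂.length .sep ++ (.one :: cs)))), ?_, ?_, fun e c o hQ => ?_⟩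
    · exact (binary_replicate _).append (((binary_replicate _).append ((binary_replicate _).append
        (hcs.cons (Or.inl rfl)))).cons (Or.inl rfl))
    · simp [pathCost] at hlen ⊢
      omega
    · rw [List.append_assoc]
      refine wp_transLoop_skip ν l₁ (t :: l₂) ?_
      rw [encList_cons, List.append_assoc, wp_transLoop_trans, wp_seq, wp_ch]
      simp only [List.cons_append]
      rw [wp_ite, if_pos (by simp [is])]
      have hstep' : Step (finConfig m) t.2.1 (finConfig m₁) := hstep
      refine wp_take ν t s m (fun m'' h1 h2 h3 => ?_) fun h => ?_
      · have hm'' : m'' = m₁ := by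
          funext k
          have e1 := (KLM.step_finConfig_iff _ _ _).1 h2 k
          have e2 := (KLM.step_finConfig_iff _ _ _).1 hstep' k
          omega
        subst hm''
        rw [List.append_assoc, List.drop_left' (by simp)]
        have := wp_transLoop_skip (Q := Q) (F := False) (i := .close :: i)
          (j := (encTrans ν t).reverse ++ ((encList ν l₁).reverse ++ [])) (c := .one :: cs ++ c)
          (v := encFin m'') (u := []) (p := num ν t.2.2) (q := q) (o := (encAction t.2.1).reverse ++ o)
          (e := e) ν l₂ [] ?_
        · simpa using this
        · refine wp_transLoop_close.2 ?_
          simp only [List.cons_append, if_true]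
          have h5 := hwp e c ((encAction t.2.1).reverse ++ o) fun j => by
            have := hQ j
            simpa [VASS.label, encWord_cons] using this
          simpa [encList] using h5
      · rcases h with (h | h) | h
        · exact h hts
        · exact h ⟨_, hstep'⟩
        · simp at h

end Cmd
end KLMReach

/-! ### Guessing the first vector and a word of the action language -/

namespace KLMReach
namespace Cmd

variable {s : St} {Q Q' : St → Prop} {F : Prop}
variable {r : Option Sym} {i j c v u p q o : List Sym} {e : Store} {x : Sym}
variable {d : ℕ}

/-- Follow a complete path of a triple of the input. -/
def triple : Cmd :=
  seqs [cmpConfig, mvUntil .sep .inp .read, forOnes rd (gen .cur .one), forOnes rd (gen .tgt .one),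
    clear .read, set (some .one), transLoop, matchState, cmpConfig]

theorem wp_clear_read : wp (clear .read) ⟨r, i, j, c, v, u, p, q, o, e⟩ Q F ↔
    Q ⟨none, i, [], c, v, u, p, q, o, e⟩ := wp_clear

theorem wp_triple_sound (x y : Config d) (G : VASS.{u} d) {g : List Sym} (hg : G.Encodes g)
    (m : Fin d → ℕ)
    (hQ : ∀ π (m' : Fin d → ℕ) j c', G.Path G.qin π G.qout →
      Run (finConfig m) (G.label π) (finConfig m') → (∀ i, SqLe (m i) (x i)) → (∀ i, SqLe (m' i) (y i)) →
      Q ⟨none, i, j, c', encFin m', [], [], [], (encWord (G.label π)).reverse ++ o, e⟩) :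
    wp triple ⟨r, encConfig x ++ g ++ encConfig y ++ i, j, c, encFin m, [], [], [], o, e⟩ Q True := by
  obtain ⟨ν, l, -, hl, rfl⟩ := hg
  simp only [triple, wp_seqs_cons, wp_seqs_nil, List.append_assoc]
  refine wp_cmpConfig_fin _ _ (fun j hx => ?_) fun _ => trivial
  rw [encNat, List.append_assoc, List.singleton_append, wp_mvUntil_rd _ (sep_notMem_ones _)]
  refine wp_readNat_cur _ (fun _ => ?_) fun _ => trivial
  refine wp_readNat_tgt _ (fun _ => ?_) fun _ => trivial
  -- What precedes the transitions is erased from `read`, so that rewinding stops at the first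
  -- transition.
  rw [wp_clear_read, wp_set, List.append_nil, List.append_nil]
  refine wp_transLoop_sound G ν l (fun t => (hl t).1) _ [] l G.qin m _ o rfl le_rfl
    fun π s' m' j c' hπ hrun => ?_
  refine wp_matchState _ _ (fun hs => ?_) fun _ => trivial
  have hs' : G.qout = s' := ν.injective (Fin.ext hs)
  subst hs'
  exact wp_cmpConfig_fin _ _ (fun j hy => hQ π m' j c' hπ hrun hx hy) fun _ => trivial

/-- The choices first pay for the numbers of the input and output states. Then each letter costs one
traversal of the list of transitions, one action and one state number, in all at most `2 * G.size +
d + 1` choices. -/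
theorem wp_triple_complete (x y : Config d) (G : VASS.{u} d) {g : List Sym} (hg : G.Encodes g)
    (m m' : Fin d → ℕ) (π : List (G.Q × Action d × G.Q)) (hπ : G.Path G.qin π G.qout)
    (hrun : Run (finConfig m) (G.label π) (finConfig m')) (hx : ∀ i, SqLe (m i) (x i))
    (hy : ∀ i, SqLe (m' i) (y i)) :
    ∃ cs, Binary cs ∧ cs.length ≤ π.length * (2 * G.size + d + 1) +
        2 * G.size ∧
      ∀ (e : Store) (r : Option Sym) (j c o : List Sym),
        (∀ j, Q ⟨none, i, j, c, encFin m', [], [], [], (encWord (G.label π)).reverse ++ o, e⟩) →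
        wp triple ⟨r, encConfig x ++ g ++ encConfig y ++ i, j, cs ++ c, encFin m, [], [], [], o, e⟩
          Q False := by
  obtain ⟨ν, l, hnd, hl, rfl⟩ := hg
  obtain ⟨cs, hcs, hlen, hwp⟩ := wp_transLoop_complete (q := num ν G.qout)
    (i := encConfig y ++ i) (Q := fun s => wp matchState s (fun s => wp cmpConfig s Q False) False)
    G ν l (fun t => (hl t).2) π _ _ m m' hπ hrun
  have hcard : l.length = G.T.card := by
    classical
    rw [← List.toFinset_card_of_nodup hnd]
    congr 1
    ext t
    simp [hl]
  refine ⟨List.replicate (ν G.qin + ν G.qout) .sep ++ cs, (binary_replicate _).append hcs, ?_,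
    fun e r j c o hQ => ?_⟩
  · have h1 := (ν G.qin).2
    have h2 := (ν G.qout).2
    have h0 : G.T.card + Nat.card G.Q + ∑ t ∈ G.T, actionNorm t.2.1 = G.size := by
      unfold VASS.size; omega
    have h3 : (π.map fun t => l.length + 1 + finCost t.2.1 + ν t.2.2).sum ≤
        π.length * (2 * G.size + d + 1) := by
      refine (List.sum_le_card_nsmul _ (2 * G.size + d + 1) ?_).trans (by simp)
      simp only [List.mem_map, forall_exists_index, and_imp, forall_apply_eq_imp_iff₂]
      intro t ht
      have h4 := (ν t.2.2).2
      have h5 := finCost_le t.2.1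
      have h6 : actionNorm t.2.1 ≤ ∑ t ∈ G.T, actionNorm t.2.1 :=
        Finset.single_le_sum (f := fun t : G.Q × Action d × G.Q => actionNorm t.2.1)
          (fun _ _ => Nat.zero_le _) (VASS.Path.mem hπ t ht)
      omega
    rw [List.length_append, List.length_replicate, hlen, pathCost]
    omega
  · simp only [triple, wp_seqs_cons, wp_seqs_nil, List.append_assoc]
    refine wp_cmpConfig_fin _ _ (fun j _ => ?_) fun h => h hx
    rw [encNat, List.append_assoc, List.singleton_append, wp_mvUntil_rd _ (sep_notMem_ones _)]
    refine wp_readNat_cur _ (fun _ => ?_) fun h => by simp at h; omega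
    refine wp_readNat_tgt _ (fun _ => ?_) fun h => by simp at h; omega
    rw [wp_clear_read, wp_set, List.append_nil, List.append_nil, List.drop_drop,
      List.drop_left' (by simp)]
    refine hwp e c o fun j => ?_
    refine wp_matchState _ _ (fun _ => ?_) fun h => h rfl
    exact wp_cmpConfig_fin _ _ (fun j _ => hQ j) fun h => h hy

/-- Guess the value of a new counter. -/
def guessOne : Cmd :=
  seqs [gen .cnt .sep, ch, whl (is .one) (seqs [gen .cnt .one, ch]), set (some .one)]

/-- Guess the values of the counters, one for each `one` of the input. -/
def guess : Cmd := forOnes rd guessOne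

/-- Follow a word of the action language, guided by the choices. -/
def follow : Cmd :=
  whl (is .link) (seqs [triple, rd, ite (is .link) (seqs [applyAct, set (some .link)]) skip])

/-- Guess a word of the action language. -/
def trial : Cmd := seqs [guess, set (some .link), follow]

theorem encVec_cons (n : ℕ) (ns : List ℕ) : encVec (n :: ns) = encNat n ++ encVec ns := by simp [encVec]

theorem wp_guessOne_sound (ns : List ℕ)
    (hQ : ∀ n c', Q ⟨some .one, i, j, c', encVec (n :: ns), u, p, q, o, e⟩) :
    wp guessOne ⟨r, i, j, c, encVec ns, u, p, q, o, e⟩ Q True := by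
  have loop : ∀ (c : List Sym) (x : Sym) (n : ℕ),
      wp (whl (is .one) (seqs [gen .cnt .one, ch])) ⟨some x, i, j, c, encVec (n :: ns), u, p, q, o, e⟩
        (fun s => wp (set (some .one)) s Q True) True := by
    intro c
    -- Each unit of the counter consumes two choices: one is spent on the symbol, and one is read to
    -- decide whether to continue.
    induction c using List.twoStepInduction with
    | nil =>
      intro x n
      rw [wp_whl]
      split_ifs
      · rw [wp_seqs_cons, wp_gen]; trivial
      · exact wp_set.2 (hQ n _)
    | singleton y =>
      intro x n
      rw [wp_whl]
      split_ifs
      · rw [wp_seqs_cons, wp_gen]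
        simp only [wp_seqs_cons, St.set, wp_ch]
      · exact wp_set.2 (hQ n _)
    | cons_cons y z c ih _ =>
      intro x n
      rw [wp_whl]
      split_ifs
      · rw [wp_seqs_cons, wp_gen]
        simp only [wp_seqs_cons, St.set, wp_ch, wp_seqs_nil]
        have := ih z (n + 1)
        simpa [encVec_cons, encNat_succ, St.get] using this
      · exact wp_set.2 (hQ n _)
  rw [guessOne, wp_seqs_cons, wp_gen]
  rcases c with _ | ⟨y, _ | ⟨z, c⟩⟩
  · trivial
  · simp only [wp_seqs_cons, St.set, wp_ch]
  · simp only [wp_seqs_cons, St.set, wp_ch, wp_seqs_nil]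
    have := loop c z 0
    simpa [encVec_cons, encNat_zero, St.get] using this

/-- The first `sep` pays for the end marker of the counter, each unit takes two choices, and the
last `sep` stops the loop. -/
theorem wp_guessOne_complete (ns : List ℕ) (n : ℕ)
    (hQ : Q ⟨some .one, i, j, c, encVec (n :: ns), u, p, q, o, e⟩) :
    wp guessOne ⟨r, i, j, .sep :: (List.replicate (2 * n) .one ++ .sep :: c), encVec ns, u, p, q, o, e⟩
      Q False := by
  have loop : ∀ (k n₀ : ℕ), n₀ + k = n →
      wp (seqs [ch, whl (is .one) (seqs [gen .cnt .one, ch]), set (some .one)])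
        ⟨r, i, j, List.replicate (2 * k) .one ++ .sep :: c, encVec (n₀ :: ns), u, p, q, o, e⟩ Q False := by
    intro k
    induction k generalizing r with
    | zero =>
      intro n₀ h
      rw [wp_seqs_cons, wp_ch]
      simp only [Nat.mul_zero, List.replicate_zero, List.nil_append]
      rw [wp_seqs_cons, wp_whl, if_neg (by simp [is])]
      simpa [← h] using hQ
    | succ k ih =>
      intro n₀ h
      rw [wp_seqs_cons, wp_ch, Nat.mul_succ, List.replicate_succ, List.replicate_succ]
      simp only [List.cons_append]
      rw [wp_seqs_cons, wp_whl, if_pos (by simp [is]), wp_seqs_cons, wp_gen]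
      have := ih (r := some .one) (n₀ + 1) (by omega)
      simpa [encVec_cons, encNat_succ, St.set, St.get] using this
  rw [guessOne, wp_seqs_cons, wp_gen]
  exact loop n 0 (by omega)

theorem wp_guess_sound (k : ℕ) (ns : List ℕ)
    (hQ : ∀ ns' : List ℕ, ns'.length = k → ∀ r j c', Q ⟨r, i, j, c', encVec (ns' ++ ns), u, p, q, o, e⟩) :
    wp guess ⟨r, encNat k ++ i, j, c, encVec ns, u, p, q, o, e⟩ Q True := by
  rw [guess]
  induction k generalizing r j c ns with
  | zero =>
    rw [wp_forOnes_round, encNat_zero, List.cons_append, wp_rd, if_neg (by simp)]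
    exact hQ [] rfl _ _ _
  | succ k ih =>
    rw [wp_forOnes_round, encNat_succ, List.cons_append, wp_rd, if_pos rfl]
    refine wp_guessOne_sound ns fun n c' => ?_
    refine (wp_whl_ones rfl).2 (ih _ fun ns' h r j c' => ?_)
    have := hQ (ns' ++ [n]) (by simp [h]) r j c'
    simpa using this

/-- New counters are put before the older ones, hence the reversal. The cost involves the sum of the
values, which is why `exists_realized` also bounds the first vector. -/
theorem wp_guess_complete (ms : List ℕ) (ns : List ℕ) :
    ∃ cs, Binary cs ∧ cs.length = 2 * ms.sum + 2 * ms.length ∧ ∀ (e : Store) (r : Option Sym) (j c : List Sym),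
    (∀ r j, Q ⟨r, i, j, c, encVec (ms.reverse ++ ns), u, p, q, o, e⟩) →
    wp guess ⟨r, encNat ms.length ++ i, j, cs ++ c, encVec ns, u, p, q, o, e⟩ Q False := by
  induction ms generalizing ns with
  | nil =>
    refine ⟨[], by simp [Binary], rfl, fun e r j c hQ => ?_⟩
    rw [guess, wp_forOnes_round, List.length_nil, encNat_zero, List.cons_append, wp_rd, if_neg (by simp)]
    exact hQ _ _
  | cons n ms ih =>
    obtain ⟨cs, hcs, hlen, hwp⟩ := ih (n :: ns)
    refine ⟨.sep :: (List.replicate (2 * n) .one ++ .sep :: cs), ?_, ?_, fun e r j c hQ => ?_⟩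
    · refine Binary.cons (Binary.append (fun x hx => Or.inl (List.mem_replicate.1 hx).2)
        (hcs.cons (Or.inr rfl))) (Or.inr rfl)
    · simp [hlen]; omega
    · rw [guess, wp_forOnes_round, List.length_cons, encNat_succ, List.cons_append, wp_rd, if_pos rfl]
      rw [List.cons_append, List.append_assoc, List.cons_append]
      refine wp_guessOne_complete ns n ?_
      refine (wp_whl_ones rfl).2 (hwp _ _ _ _ fun r j => ?_)
      have := hQ r j
      simpa using this

/-- The part of the presentation of a sequence that follows the dimension. -/
noncomputable def encTail (k : ℕ) (x y : Fin (k + 1) → Config d) (a : Fin k → Action d)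
    (g : Fin (k + 1) → List Sym) : List Sym :=
  (encConfig (x 0) ++ g 0 ++ encConfig (y 0)) ++
    (List.ofFn fun j : Fin k => Sym.link :: (encAction (a j) ++
      encConfig (x j.succ) ++ g j.succ ++ encConfig (y j.succ))).flatten

theorem encTail_zero (x y : Fin 1 → Config d) (a : Fin 0 → Action d) (g : Fin 1 → List Sym) :
    encTail 0 x y a g = encConfig (x 0) ++ g 0 ++ encConfig (y 0) ++ [] := by
  simp [encTail]

theorem encTail_succ (k : ℕ) (x y : Fin (k + 2) → Config d) (a : Fin (k + 1) → Action d)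
    (g : Fin (k + 2) → List Sym) :
    encTail (k + 1) x y a g = encConfig (x 0) ++ g 0 ++ encConfig (y 0) ++ (.link :: (encAction (a 0) ++
      encTail k (fun j => x j.succ) (fun j => y j.succ) (fun j => a j.succ) (fun j => g j.succ))) := by
  simp [encTail, List.ofFn_succ]

/-- The words of the action language with a given first vector. -/
def Words (k : ℕ) (x y : Fin (k + 1) → Config d) (G : Fin (k + 1) → VASS.{u} d) (a : Fin k → Action d)
    (m₀ : Fin d → ℕ) : Set (List (Action d)) :=
  {w | ∃ (σ : Fin (k + 1) → List (Action d)) (m n : Fin (k + 1) → Fin d → ℕ), m 0 = m₀ ∧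
    w = σ 0 ++ (List.ofFn fun j : Fin k => a j :: σ j.succ).flatten ∧
    (∀ j, (G j).IsCompleteLabel (σ j)) ∧
    (∀ j, Run (finConfig (m j)) (σ j) (finConfig (n j))) ∧
    (∀ j : Fin k, Step (finConfig (n j.castSucc)) (a j) (finConfig (m j.succ))) ∧
    (∀ j i, SqLe (m j i : ℕ∞) (x j i)) ∧
    (∀ j i, SqLe (n j i : ℕ∞) (y j i))}

theorem Words.cons {k : ℕ} {x y : Fin (k + 2) → Config d} {G : Fin (k + 2) → VASS.{u} d}
    {a : Fin (k + 1) → Action d} {m₀ n₀ m₁ : Fin d → ℕ} {σ₀ w : List (Action d)}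
    (hσ : (G 0).IsCompleteLabel σ₀) (hrun : Run (finConfig m₀) σ₀ (finConfig n₀))
    (hx : ∀ i, SqLe (m₀ i) (x 0 i)) (hy : ∀ i, SqLe (n₀ i) (y 0 i))
    (ha : Step (finConfig n₀) (a 0) (finConfig m₁))
    (hw : w ∈ Words k (fun j => x j.succ) (fun j => y j.succ) (fun j => G j.succ) (fun j => a j.succ) m₁) :
    σ₀ ++ a 0 :: w ∈ Words (k + 1) x y G a m₀ := by
  obtain ⟨σ, m, n, rfl, rfl, h1, h2, h3, h4, h5⟩ := hw
  refine ⟨Fin.cons σ₀ σ, Fin.cons m₀ m, Fin.cons n₀ n, rfl, by simp [List.ofFn_succ],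
    Fin.cases hσ h1, Fin.cases hrun h2, Fin.cases ha fun j => ?_, Fin.cases hx h4, Fin.cases hy h5⟩
  exact h3 j

/-- After a triple the input is either empty or continues with `link`, an action and the
presentation of a shorter sequence; hence the induction on `k`. -/
theorem wp_follow_sound (k : ℕ) (x y : Fin (k + 1) → Config d) (G : Fin (k + 1) → VASS.{u} d)
    (a : Fin k → Action d) (g : Fin (k + 1) → List Sym) (hg : ∀ j, (G j).Encodes (g j))
    (m : Fin d → ℕ)
    (hQ : ∀ w ∈ Words k x y G a m, ∀ j c v,
      Q ⟨none, [], j, c, v, [], [], [], (encWord w).reverse ++ o, e⟩) :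
    wp follow ⟨some .link, encTail k x y a g, j, c, encFin m, [], [], [], o, e⟩ Q True := by
  induction k generalizing m j c o with
  | zero =>
    rw [follow, wp_whl, if_pos (by simp [is]), encTail_zero, wp_seqs_cons]
    refine wp_triple_sound _ _ _ (hg 0) m fun π m' j c hπ hrun hx hy => ?_
    rw [wp_seqs_cons, wp_rd_nil, wp_seqs_cons, wp_ite, if_neg (by simp [is]), wp_skip, wp_seqs_nil,
      wp_whl, if_neg (by simp [is])]
    refine hQ _ ⟨fun _ => (G 0).label π, fun _ => m, fun _ => m', rfl, by simp, ?_⟩ _ _ _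
    refine ⟨fun j => ?_, fun j => hrun, fun j => j.elim0, fun j => ?_, fun j => ?_⟩ <;>
      obtain rfl : j = 0 := Fin.fin_one_eq_zero j
    · exact ⟨π, hπ, rfl⟩
    · exact hx
    · exact hy
  | succ k ih =>
    rw [follow, wp_whl, if_pos (by simp [is]), encTail_succ, wp_seqs_cons]
    refine wp_triple_sound _ _ _ (hg 0) m fun π m' j c hπ hrun hx hy => ?_
    rw [wp_seqs_cons, wp_rd, wp_seqs_cons, wp_ite, if_pos (by simp [is]), wp_seqs_cons]
    refine wp_applyAct_fin _ _ (fun m₁ hm₁ _ => ?_) fun _ => trivial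
    rw [wp_seqs_cons, wp_set, wp_seqs_nil, wp_seqs_nil]
    refine ih (fun j => x j.succ) (fun j => y j.succ) _ (fun j => a j.succ) _ (fun j => hg j.succ) m₁
      fun w hw j c v => ?_
    have := hQ _ (Words.cons ⟨π, hπ, rfl⟩ hrun hx hy hm₁ hw) j c v
    simpa [encWord_append, encWord_cons] using this

theorem wp_follow_complete (k : ℕ) (x y : Fin (k + 1) → Config d) (G : Fin (k + 1) → VASS.{u} d)
    (a : Fin k → Action d) (g : Fin (k + 1) → List Sym) (hg : ∀ j, (G j).Encodes (g j))
    (m n : Fin (k + 1) → Fin d → ℕ) (π : ∀ j, List ((G j).Q × Action d × (G j).Q))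
    (hπ : ∀ j, (G j).Path (G j).qin (π j) (G j).qout)
    (hrun : ∀ j, Run (finConfig (m j)) ((G j).label (π j)) (finConfig (n j)))
    (hx : ∀ j i, SqLe (m j i) (x j i)) (hy : ∀ j i, SqLe (n j i) (y j i))
    (ha : ∀ j : Fin k, Step (finConfig (n j.castSucc)) (a j) (finConfig (m j.succ))) :
    ∃ cs, Binary cs ∧ cs.length ≤ ∑ j, ((π j).length * (2 * (G j).size + d + 1) + 2 * (G j).size) +
        ∑ j, finCost (a j) ∧
      ∀ (e : Store) (j o : List Sym),
        wp follow ⟨some .link, encTail k x y a g, j, cs, encFin (m 0), [], [], [], o, e⟩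
          (fun _ => True) False := by
  induction k with
  | zero =>
    obtain ⟨cs, hcs, hlen, hwp⟩ := wp_triple_complete (i := [])
      (Q := fun s => s.inp = []) (x 0) (y 0) (G 0) (hg 0)
      (m 0) (n 0) (π 0) (hπ 0) (hrun 0) (hx 0) (hy 0)
    refine ⟨cs, hcs, by simpa using hlen, fun e j o => ?_⟩
    rw [follow, wp_whl, if_pos (by simp [is]), encTail_zero, wp_seqs_cons]
    have h := hwp e (some .link) j [] o fun j => rfl
    rw [List.append_nil] at h ⊢
    rw [List.append_nil] at h
    refine h.mono fun s hs => ?_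
    obtain ⟨r, i, j, c, v, u, p, q, o, e⟩ := s
    obtain rfl : i = [] := hs
    rw [wp_seqs_cons, wp_rd_nil, wp_seqs_cons, wp_ite, if_neg (by simp [is]), wp_skip, wp_seqs_nil,
      wp_whl, if_neg (by simp [is])]
    trivial
  | succ k ih =>
    obtain ⟨cs', hcs', hlen', hwp'⟩ := ih _ _ _ _ _ (fun j => hg j.succ) (fun j => m j.succ)
      (fun j => n j.succ) (fun j => π j.succ) (fun j => hπ j.succ) (fun j => hrun j.succ)
      (fun j => hx j.succ) (fun j => hy j.succ) fun j => ha j.succ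
    obtain ⟨cs, hcs, hlen, hwp⟩ := wp_triple_complete
      (i := .link :: (encAction (a 0) ++
        encTail k (fun j => x j.succ) (fun j => y j.succ) (fun j => a j.succ) (fun j => g j.succ)))
      (Q := fun s => wp (seqs [rd, ite (is .link) (seqs [applyAct, set (some .link)]) skip]) s
        (fun s => wp follow s (fun _ => True) False) False) (x 0) (y 0) (G 0) (hg 0)
      (m 0) (n 0) (π 0) (hπ 0) (hrun 0) (hx 0) (hy 0)
    refine ⟨cs ++ (List.replicate (finCost (a 0)) .sep ++ cs'),
      hcs.append ((binary_replicate _).append hcs'), ?_, fun e j o => ?_⟩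
    · rw [Fin.sum_univ_succ, Fin.sum_univ_succ (f := fun j => finCost (a j))]
      simp only [List.length_append, List.length_replicate]
      omega
    · rw [follow, wp_whl, if_pos (by simp [is]), encTail_succ, wp_seqs_cons]
      refine hwp _ _ _ _ _ fun j => ?_
      rw [wp_seqs_cons, wp_rd, wp_seqs_cons, wp_ite, if_pos (by simp [is]), wp_seqs_cons]
      have h0 : Step (finConfig (n 0)) (a 0) (finConfig (m 1)) := ha 0
      refine wp_applyAct_fin _ _ (fun m₁ hm₁ _ => ?_) fun h => ?_
      · have hmm : m₁ = m 1 := by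
          funext i
          have e1 := (KLM.step_finConfig_iff _ _ _).1 hm₁ i
          have e2 := (KLM.step_finConfig_iff _ _ _).1 h0 i
          omega
        subst hmm
        rw [wp_seqs_cons, wp_set, wp_seqs_nil, wp_seqs_nil, List.drop_left' (by simp)]
        exact hwp' _ _ _
      · rcases h with h | h
        · exact h ⟨_, h0⟩
        · simp at h

end Cmd
end KLMReach

/-! ### Soundness, completeness and space of a trial -/

namespace KLMReach
namespace Cmd

variable {d : ℕ} {ξ : KLM.{u} d} {w c : List Sym} {e : Store}

/-- The state in which a trial starts. -/
def trialSt (r : Option Sym) (w c : List Sym) (e : Store) : St := ⟨r, w, [], c, [], [], [], [], [], e⟩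

/-- Since failure has the condition `True`, a trial halts on every word of choices, and whatever it
accepts is correct. -/
theorem wp_trial_sound (hw : ξ.Encodes w) (r : Option Sym) :
    wp trial (trialSt r w c e) (fun s => ∃ σ ∈ ξ.language, s.res = (encWord σ).reverse) True := by
  obtain ⟨g, hg, rfl⟩ := hw
  rw [trial, wp_seqs_cons, trialSt, List.append_assoc]
  refine wp_guess_sound d [] fun ns hns r j c' => ?_
  have hm : ∃ m : Fin d → ℕ, ns = List.ofFn m := by
    subst hns
    exact ⟨ns.get, (List.ofFn_get ns).symm⟩
  obtain ⟨m, rfl⟩ := hm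
  rw [wp_seqs_cons, wp_set, wp_seqs_cons, List.append_nil]
  refine wp_follow_sound ξ.k ξ.x ξ.y ξ.G ξ.a g hg m fun w hw j c v => ?_
  obtain ⟨σ, m, n, -, hw⟩ := hw
  rw [wp_seqs_nil]
  exact ⟨w, ⟨σ, m, n, hw⟩, by simp⟩

/-- The paths of `exists_realized` are spelled out as choices. A letter costs at most `2 * weight +
d + 1` of them; the second factor in `witness_bound` is there to pay for this and for the first
vector. -/
theorem wp_trial_complete (hξ : ξ.Normal) (hw : ξ.Encodes w) :
    ∃ c, Binary c ∧ c.length ≤ ell ξ.size ∧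
      ∀ e r, wp trial (trialSt r w c e) (fun _ => True) False := by
  obtain ⟨g, hg, rfl⟩ := hw
  obtain ⟨H, π, h, hb⟩ := KLM.exists_realized hξ
  obtain ⟨cs, hcs, hlen, hwp⟩ := wp_follow_complete ξ.k ξ.x ξ.y ξ.G ξ.a g hg H.m H.n π h.path
    (fun j => run_label_of_nonneg (π j) _ _ (h.nonneg j) (h.effect j)) h.model.m_le h.model.n_le
    h.model.link
  obtain ⟨cs', hcs', hlen', hwp'⟩ := wp_guess_complete (u := []) (p := []) (q := []) (o := [])
    (i := encTail ξ.k ξ.x ξ.y ξ.a g)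
    (Q := fun s => wp (seqs [set (some .link), follow]) s (fun _ => True) False)
    (List.ofFn (H.m 0)).reverse []
  refine ⟨cs' ++ cs, hcs'.append hcs, ?_, fun e r => ?_⟩
  · refine le_trans ?_ ξ.witness_bound
    have hsize : ∀ j, (ξ.G j).size ≤ ∑ j, (ξ.G j).size := fun j =>
      Finset.single_le_sum (f := fun j => (ξ.G j).size) (fun _ _ => Nat.zero_le _) (Finset.mem_univ j)
    have hwt : ξ.k + ∑ j, actionNorm (ξ.a j) + ∑ j, (ξ.G j).size ≤ ξ.weight := by
      unfold KLM.weight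
      simp only [Finset.sum_add_distrib]
      omega
    have h1 : ∑ j, ((π j).length * (2 * (ξ.G j).size + d + 1) + 2 * (ξ.G j).size) ≤
        (∑ j, (π j).length) * (2 * ξ.weight + d + 1) + 2 * ∑ j, (ξ.G j).size := by
      rw [Finset.sum_add_distrib, Finset.sum_mul, ← Finset.mul_sum]
      refine Nat.add_le_add_right (Finset.sum_le_sum fun j _ => Nat.mul_le_mul_left _ ?_) _
      have := hsize j
      omega
    have h2 : ∑ j, finCost (ξ.a j) ≤ 2 * ∑ j, actionNorm (ξ.a j) + ξ.k * (d + 1) := by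
      refine (Finset.sum_le_sum fun j _ => finCost_le (ξ.a j)).trans (le_of_eq ?_)
      simp only [Finset.sum_add_distrib, ← Finset.mul_sum, Finset.sum_const, Finset.card_univ,
        Fintype.card_fin, smul_eq_mul]
      ring
    have h3 : (List.ofFn (H.m 0)).reverse.sum = ∑ i, H.m 0 i := by
      rw [List.sum_reverse, List.sum_ofFn]
    rw [h3, List.length_reverse, List.length_ofFn] at hlen'
    have h4 := ξ.one_le_weight
    rw [List.length_append, hlen']
    have h5 : ξ.k * (d + 1) ≤ ξ.weight * (d + 1) := Nat.mul_le_mul_right _ (by omega)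
    have h6 : (∑ j, (π j).length + ∑ i, H.m 0 i) * (2 * ξ.weight + 4 * d + 8) ≤
        (ξ.totalBound * (ξ.reps * ξ.scale + 2)) * (2 * ξ.weight + 4 * d + 8) :=
      Nat.mul_le_mul_right _ hb
    have h7 : d ≤ ξ.weight * d := Nat.le_mul_of_pos_left _ h4
    nlinarith [Nat.zero_le (∑ j, (π j).length), Nat.zero_le (∑ i, H.m 0 i),
      Nat.zero_le ((∑ j, (π j).length) * d), Nat.zero_le ((∑ i, H.m 0 i) * d),
      Nat.zero_le ((∑ i, H.m 0 i) * ξ.weight)]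
  · rw [trial, wp_seqs_cons, trialSt, List.append_assoc]
    have h0 := hwp' e r [] cs fun r j => by
      rw [wp_seqs_cons, wp_set, wp_seqs_cons, List.reverse_reverse, List.append_nil]
      refine (hwp e j []).mono fun s _ => ?_
      rw [wp_seqs_nil]
      trivial
    simpa [encTail, encVec] using h0

/-- By determinism, the run whose existence follows from soundness is the one that completeness
speaks of. -/
theorem _root_.KLMReach.Exec.unique {P P' : St → Prop} {c : Cmd} {s s₁ s₂ : St} {o₁ o₂ : Bool}
    (h₁ : Exec P c s o₁ s₁) (h₂ : Exec P' c s o₂ s₂) : o₁ = o₂ ∧ s₁ = s₂ := by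
  induction h₁ generalizing o₂ s₂ with
  | prim _ => cases h₂; exact ⟨rfl, rfl⟩
  | seq_ok _ _ ih₁ ih₂ =>
    cases h₂ with
    | seq_ok h3 h4 =>
      obtain ⟨-, rfl⟩ := ih₁ h3
      exact ih₂ h4
    | seq_fail h3 => simpa using (ih₁ h3).1
  | seq_fail _ ih =>
    cases h₂ with
    | seq_ok h3 h4 => simpa using (ih h3).1
    | seq_fail h3 => exact ih h3
  | ite_true ht _ ih =>
    cases h₂ with
    | ite_true _ h => exact ih h
    | ite_false ht' _ => simp [ht] at ht'
  | ite_false ht _ ih =>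
    cases h₂ with
    | ite_true ht' _ => simp [ht] at ht'
    | ite_false _ h => exact ih h
  | whl_done ht =>
    cases h₂ with
    | whl_done => exact ⟨rfl, rfl⟩
    | whl_step ht' => simp [ht] at ht'
    | whl_fail ht' => simp [ht] at ht'
  | whl_step ht _ _ ih₁ ih₂ =>
    cases h₂ with
    | whl_done ht' => simp [ht] at ht'
    | whl_step _ h3 h4 =>
      obtain ⟨-, rfl⟩ := ih₁ h3
      exact ih₂ h4
    | whl_fail _ h3 => simpa using (ih₁ h3).1
  | whl_fail ht _ ih =>
    cases h₂ with
    | whl_done ht' => simp [ht] at ht'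
    | whl_step _ h3 h4 => simpa using (ih h3).1
    | whl_fail _ h3 => exact ih h3
  | rescue_ok _ ih =>
    cases h₂ with
    | rescue_ok h => exact ih h
    | rescue_fail h3 h4 => simpa using (ih h3).1
  | rescue_fail _ _ ih₁ ih₂ =>
    cases h₂ with
    | rescue_ok h => simpa using (ih₁ h).1
    | rescue_fail h3 h4 =>
      obtain ⟨-, rfl⟩ := ih₁ h3
      exact ih₂ h4

/-- All the basic instructions of a program satisfy a test. -/
def all (f : Prim → Bool) : Cmd → Bool
  | prim p => f p
  | seq a b => a.all f && b.all f
  | ite _ a b => a.all f && b.all f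
  | whl _ a => a.all f
  | rescue a b => a.all f && b.all f

/-- An invariant of the basic instructions that pass the syntactic test `f` holds throughout, so
space is accounted for by instruction and not by program. -/
theorem _root_.KLMReach.Exec.strengthen {P : St → Prop} {f : Prim → Bool}
    (hf : ∀ p s, f p = true → P s → P (p.sem s).2) {c : Cmd} {s s' : St} {o : Bool}
    (h : Exec (fun _ => True) c s o s') (hc : c.all f = true) (hs : P s) :
    Exec P c s o s' ∧ P s' := by
  induction h with
  | prim _ => exact ⟨.prim (hf _ _ hc hs), hf _ _ hc hs⟩
  | seq_ok _ _ ih₁ ih₂ =>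
    simp only [all, Bool.and_eq_true] at hc
    obtain ⟨h1, h2⟩ := ih₁ hc.1 hs
    obtain ⟨h3, h4⟩ := ih₂ hc.2 h2
    exact ⟨.seq_ok h1 h3, h4⟩
  | seq_fail _ ih =>
    simp only [all, Bool.and_eq_true] at hc
    obtain ⟨h1, h2⟩ := ih hc.1 hs
    exact ⟨.seq_fail h1, h2⟩
  | ite_true ht _ ih =>
    simp only [all, Bool.and_eq_true] at hc
    obtain ⟨h1, h2⟩ := ih hc.1 hs
    exact ⟨.ite_true ht h1, h2⟩
  | ite_false ht _ ih =>
    simp only [all, Bool.and_eq_true] at hc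
    obtain ⟨h1, h2⟩ := ih hc.2 hs
    exact ⟨.ite_false ht h1, h2⟩
  | whl_done ht => exact ⟨.whl_done ht, hs⟩
  | whl_step ht _ _ ih₁ ih₂ =>
    obtain ⟨h1, h2⟩ := ih₁ hc hs
    obtain ⟨h3, h4⟩ := ih₂ hc h2
    exact ⟨.whl_step ht h1 h3, h4⟩
  | whl_fail ht _ ih =>
    obtain ⟨h1, h2⟩ := ih hc hs
    exact ⟨.whl_fail ht h1, h2⟩
  | rescue_ok _ ih =>
    simp only [all, Bool.and_eq_true] at hc
    obtain ⟨h1, h2⟩ := ih hc.1 hs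
    exact ⟨.rescue_ok h1, h2⟩
  | rescue_fail _ _ ih₁ ih₂ =>
    simp only [all, Bool.and_eq_true] at hc
    obtain ⟨h1, h2⟩ := ih₁ hc.1 hs
    obtain ⟨h3, h4⟩ := ih₂ hc.2 h2
    exact ⟨.rescue_fail h1 h3, h4⟩

theorem size_eq (s : St) : s.size = s.inp.length + s.read.length + s.cho.length + s.cnt.length +
    s.cnt'.length + s.cur.length + s.tgt.length + s.res.length + s.e.inp0.length + s.e.cho0.length +
    s.e.aux.length + s.e.out.length := by
  have : (Finset.univ : Finset Stk) =
    {.inp, .read, .cho, .cnt, .cnt', .cur, .tgt, .res, .inp0, .cho0, .aux, .out} := rfl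
  rw [St.size, this]
  repeat rw [Finset.sum_insert (by decide)]
  rw [Finset.sum_singleton]
  simp only [St.get]
  omega

/-- The number of symbols on the stacks that are filled at the price of choices, and the number of
choices. -/
def work (s : St) : ℕ :=
  s.cho.length + s.cnt.length + s.cnt'.length + s.cur.length + s.tgt.length + s.res.length

/-- The instructions that a trial may use. -/
def isLocal : Prim → Bool
  | .pop k => decide (k = .inp ∨ k = .read ∨ k = .cho ∨ k = .cnt ∨ k = .cnt' ∨ k = .cur ∨ k = .tgt)
  | .mv k k' => decide ((k = .inp ∧ k' = .read) ∨ (k = .read ∧ k' = .inp) ∨ (k = .cnt ∧ k' = .cnt') ∨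
      (k = .cnt' ∧ k' = .cnt))
  | .gen k _ => decide (k = .cnt ∨ k = .cur ∨ k = .tgt ∨ k = .res)
  | .push _ _ => false
  | .set _ => true
  | .fail => true

/-- The states reachable by a trial from a given state, at most. -/
def Below (s₀ s : St) : Prop :=
  s.e = s₀.e ∧ work s ≤ work s₀ ∧ s.inp.length + s.read.length ≤ s₀.inp.length + s₀.read.length

/-- A `gen` exchanges one choice for one symbol, and the moves stay within `inp` and `read` or
within the counters, so neither side of the account grows. -/
theorem Below.sem (s₀ : St) (p : Prim) (s : St) (hp : isLocal p = true) (hs : Below s₀ s) :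
    Below s₀ (p.sem s).2 := by
  obtain ⟨h1, h2, h3⟩ := hs
  obtain ⟨r, i, j, c, v, u, p', q, o, e⟩ := s
  simp only [work] at h2
  simp only at h1 h3
  cases p with
  | pop k =>
    simp only [isLocal, decide_eq_true_eq] at hp
    rcases hp with rfl | rfl | rfl | rfl | rfl | rfl | rfl <;>
      refine ⟨h1, ?_, ?_⟩ <;> simp only [Prim.sem, St.get, St.set, work, List.length_tail] <;> omega
  | mv k k' =>
    simp only [isLocal, decide_eq_true_eq] at hp
    rcases hp with ⟨rfl, rfl⟩ | ⟨rfl, rfl⟩ | ⟨rfl, rfl⟩ | ⟨rfl, rfl⟩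
    · cases i <;> exact ⟨h1, h2, by simp [Prim.sem, St.get, St.set] at h3 ⊢; omega⟩
    · cases j <;> exact ⟨h1, h2, by simp [Prim.sem, St.get, St.set] at h3 ⊢; omega⟩
    · cases v <;> exact ⟨h1, by simp [Prim.sem, St.get, St.set, work] at h2 ⊢; omega, h3⟩
    · cases u <;> exact ⟨h1, by simp [Prim.sem, St.get, St.set, work] at h2 ⊢; omega, h3⟩
  | gen k f =>
    simp only [isLocal, decide_eq_true_eq] at hp
    cases c with
    | nil => exact ⟨h1, h2, h3⟩
    | cons x c =>
      simp only [List.length_cons] at h2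
      rcases hp with rfl | rfl | rfl | rfl <;>
        refine ⟨h1, ?_, h3⟩ <;> simp only [Prim.sem, St.get, St.set, work, List.length_cons] <;> omega
  | push k f => simp [isLocal] at hp
  | set f => exact ⟨h1, h2, h3⟩
  | fail => exact ⟨h1, h2, h3⟩

theorem all_isLocal_trial : trial.all isLocal = true := by decide

theorem length_le_length_encWord (σ : List (Action d)) : σ.length ≤ (encWord σ).length := by
  induction σ with
  | nil => simp
  | cons a σ ih =>
    rw [encWord_cons, List.length_append, List.length_cons]
    have : 1 ≤ (encAction a).length := by simp [encAction]
    omega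

end Cmd
end KLMReach

/-! ### Copying stacks and enumerating the words of choices -/

namespace KLMReach
namespace Cmd

/-- The states of bounded size. -/
def Small (B : ℕ) (s : St) : Prop := s.size ≤ B

/-- The instructions that do not add symbols. -/
def noPush : Prim → Bool
  | .push _ _ => false
  | _ => true

theorem size_set (s : St) (k : Stk) (l : List Sym) :
    (s.set k l).size + (s.get k).length = s.size + l.length := by
  obtain ⟨r, i, j, c, v, u, p, q, o, e⟩ := s
  cases k <;> simp only [size_eq, St.set, St.get] <;> omega

theorem Small.sem {B : ℕ} (p : Prim) (s : St) (hp : noPush p = true) (hs : Small B s) :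
    Small B (p.sem s).2 := by
  have hr : ∀ (s : St) r, ({ s with r := r } : St).size = s.size := fun s r => by
    rw [size_eq, size_eq]
  refine le_trans ?_ hs
  cases p with
  | pop k =>
    rw [Prim.sem, hr]
    have := size_set s k (s.get k).tail
    rw [List.length_tail] at this
    omega
  | mv k k' =>
    rw [Prim.sem]
    cases h : s.get k with
    | nil => simp only [hr, le_refl]
    | cons x l =>
      simp only [hr]
      have h1 := size_set s k l
      have h2 := size_set (s.set k l) k' (x :: (s.set k l).get k')
      rw [h] at h1
      simp only [List.length_cons] at h1 h2
      omega
  | gen k f =>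
    rw [Prim.sem]
    cases h : s.cho with
    | nil => exact le_rfl
    | cons x l =>
      have h' : s.get .cho = x :: l := h
      have h1 := size_set s .cho l
      have h2 := size_set (s.set .cho l) k (f s.r :: (s.set .cho l).get k)
      rw [h'] at h1
      simp only [List.length_cons] at h1 h2
      simp only
      omega
  | push k f => simp [noPush] at hp
  | set f => exact (hr s _).le
  | fail => exact le_rfl

variable {s : St} {Q Q' : St → Prop} {F : Prop} {B : ℕ} {a : Cmd}
variable {r : Option Sym} {i j c v u p q o : List Sym} {e : Store} {x : Sym} {i₀ c₀ z t : List Sym}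

/-- Without `push` the total number of symbols never increases, so only the start has to be small.
-/
theorem wpIn_of_wp (ha : a.all noPush = true) (hs : s.size ≤ B) (h : wp a s Q F) :
    wpIn (Small B) a s Q F := by
  obtain ⟨b, s', h1, h2⟩ := h
  exact ⟨b, s', (h1.strengthen Small.sem ha hs).1, h2⟩

@[simp] theorem wpIn_seqs_nil {P : St → Prop} : wpIn P (seqs []) s Q F ↔ P s ∧ Q s := by
  simp [seqs, skip, wpIn_prim, Prim.sem]

@[simp] theorem wpIn_seqs_cons {P : St → Prop} {l : List Cmd} :
    wpIn P (seqs (a :: l)) s Q F ↔ wpIn P a s (fun s₁ => wpIn P (seqs l) s₁ Q F) F := wpIn_seq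

/-- The effect of moving all of a stack to another one, on a family of states indexed by the contents
of the two stacks and of the control. -/
theorem wp_mvAll {k k' : Stk} (f : List Sym → List Sym → Option Sym → St)
    (hr : ∀ l l' r, (f l l' r).r = r)
    (h₀ : ∀ l' r, (Prim.mv k k').sem (f [] l' r) = (true, f [] l' none))
    (h₁ : ∀ x l l' r, (Prim.mv k k').sem (f (x :: l) l' r) = (true, f l (x :: l') (some x)))
    (l l' : List Sym) (r : Option Sym) (h : Q (f [] (l.reverse ++ l') none)) :
    wp (mvAll k k') (f l l' r) Q F := by
  rw [mvAll, wp_seq]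
  induction l generalizing l' r with
  | nil =>
    rw [wp_mv, h₀, wp_whl, hr, if_neg (by simp)]
    simpa using h
  | cons y l ih =>
    rw [wp_mv, h₁, wp_whl, hr, if_pos (by simp)]
    exact ih _ _ (by simpa using h)

/-- Push the symbol in the control. -/
def push (k : Stk) : Cmd := prim (.push k fun r => r.getD .one)

/-- Push a given symbol. -/
def put (k : Stk) (x : Sym) : Cmd := prim (.push k fun _ => x)

theorem wpIn_pop {P : St → Prop} {k : Stk} : wpIn P (pop k) s Q F ↔
    P ((Prim.pop k).sem s).2 ∧ Q ((Prim.pop k).sem s).2 := by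
  rw [pop, wpIn_prim, if_pos (by rfl)]

theorem wpIn_push {P : St → Prop} {k : Stk} : wpIn P (push k) s Q F ↔
    P ((Prim.push k fun r => r.getD .one).sem s).2 ∧ Q ((Prim.push k fun r => r.getD .one).sem s).2 := by
  rw [push, wpIn_prim, if_pos (by rfl)]

theorem wpIn_put {P : St → Prop} {k : Stk} : wpIn P (put k x) s Q F ↔
    P (s.set k (x :: s.get k)) ∧ Q (s.set k (x :: s.get k)) := by
  rw [put, wpIn_prim, if_pos (by rfl)]
  rfl

/-- Put the contents of the auxiliary stack on two stacks. -/
def spread (k k' : Stk) : Cmd :=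
  seqs [pop .aux, whl Option.isSome (seqs [push k, push k', pop .aux])]

/-- Copy the contents of a stack. -/
def copy (k k' : Stk) : Cmd := seqs [mvAll k .aux, spread k k']

/-- In `f a b l r` the lists `a` and `b` lie on the two targets and `l` on `aux`. Each symbol of `l`
is written twice, hence the factor 2 in the space. -/
theorem wpIn_spread {k k' : Stk} (f : List Sym → List Sym → List Sym → Option Sym → St)
    (hr : ∀ a b l r, (f a b l r).r = r)
    (hsize : ∀ a b l r, (f a b l r).size = (f [] [] [] none).size + a.length + b.length + l.length)
    (hpop : ∀ a b l r, (Prim.pop .aux).sem (f a b l r) = (true, f a b l.tail l.head?))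
    (hpush : ∀ x a b l, (Prim.push k fun r => r.getD .one).sem (f a b l (some x)) =
      (true, f (x :: a) b l (some x)))
    (hpush' : ∀ x a b l, (Prim.push k' fun r => r.getD .one).sem (f a b l (some x)) =
      (true, f a (x :: b) l (some x)))
    (a b l : List Sym) (r : Option Sym)
    (hB : (f [] [] [] none).size + a.length + b.length + 2 * l.length ≤ B)
    (h : Q (f (l.reverse ++ a) (l.reverse ++ b) [] none)) :
    wpIn (Small B) (spread k k') (f a b l r) Q F := by
  generalize (f [] [] [] none).size = n at hsize hB
  rw [spread, wpIn_seqs_cons, wpIn_pop, hpop]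
  refine ⟨?_, ?_⟩
  · rw [Small, hsize, List.length_tail]; omega
  rw [wpIn_seqs_cons]
  induction l generalizing a b with
  | nil =>
    rw [wpIn_whl, hr, if_neg (by simp)]
    refine wpIn_seqs_nil.2 ⟨?_, by simpa using h⟩
    rw [Small, hsize]
    simpa using hB
  | cons x l ih =>
    simp only [List.length_cons] at hB
    rw [wpIn_whl, hr, if_pos (by simp)]
    rw [List.head?_cons, List.tail_cons, wpIn_seqs_cons, wpIn_push, hpush, wpIn_seqs_cons, wpIn_push,
      hpush', wpIn_seqs_cons, wpIn_pop, hpop, wpIn_seqs_nil]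
    simp only [Small, hsize, List.length_cons, List.length_tail]
    refine ⟨by omega, by omega, by omega, by omega, ih (x :: a) (x :: b) (by simpa using h) ?_⟩
    simp only [List.length_cons]
    omega

/-- Moving to `aux` reverses the contents and spreading reverses them again, so source and copy both
end in the original order. -/
theorem wpIn_copy_inp (l l' : List Sym)
    (hB : (St.mk r l' j c v u p q o ⟨l, c₀, [], t⟩).size + l.length ≤ B)
    (h : Q ⟨none, l ++ l', j, c, v, u, p, q, o, ⟨l, c₀, [], t⟩⟩) :
    wpIn (Small B) (copy .inp0 .inp) ⟨r, l', j, c, v, u, p, q, o, ⟨l, c₀, [], t⟩⟩ Q F := by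
  rw [copy, wpIn_seqs_cons]
  refine wpIn_of_wp rfl (by omega) (wp_mvAll
    (fun a b r => ⟨r, l', j, c, v, u, p, q, o, ⟨a, c₀, b, t⟩⟩) (fun _ _ _ => rfl) (fun _ _ => rfl)
    (fun _ _ _ _ => rfl) _ _ _ ?_)
  rw [wpIn_seqs_cons]
  refine wpIn_spread (fun a b l r => ⟨r, b, j, c, v, u, p, q, o, ⟨a, c₀, l, t⟩⟩) (fun _ _ _ _ => rfl)
    (fun _ _ _ _ => ?_) (fun _ _ _ _ => rfl) (fun _ _ _ _ => rfl) (fun _ _ _ _ => rfl) _ _ _ _ ?_ ?_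
  · simp only [size_eq, List.length_nil]; omega
  · simp only [size_eq, List.length_nil, List.append_nil, List.length_reverse] at hB ⊢; omega
  · refine wpIn_seqs_nil.2 ⟨?_, ?_⟩
    · simp only [Small, size_eq, List.length_nil, List.append_nil, List.length_reverse,
        List.length_append] at hB ⊢
      omega
    · simpa using h

theorem wpIn_copy_cho (l l' : List Sym)
    (hB : (St.mk r i j l' v u p q o ⟨i₀, l, [], t⟩).size + l.length ≤ B)
    (h : Q ⟨none, i, j, l ++ l', v, u, p, q, o, ⟨i₀, l, [], t⟩⟩) :
    wpIn (Small B) (copy .cho0 .cho) ⟨r, i, j, l', v, u, p, q, o, ⟨i₀, l, [], t⟩⟩ Q F := by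
  rw [copy, wpIn_seqs_cons]
  refine wpIn_of_wp rfl (by omega) (wp_mvAll
    (fun a b r => ⟨r, i, j, l', v, u, p, q, o, ⟨i₀, a, b, t⟩⟩) (fun _ _ _ => rfl) (fun _ _ => rfl)
    (fun _ _ _ _ => rfl) _ _ _ ?_)
  rw [wpIn_seqs_cons]
  refine wpIn_spread (fun a b l r => ⟨r, i, j, b, v, u, p, q, o, ⟨i₀, a, l, t⟩⟩) (fun _ _ _ _ => rfl)
    (fun _ _ _ _ => ?_) (fun _ _ _ _ => rfl) (fun _ _ _ _ => rfl) (fun _ _ _ _ => rfl) _ _ _ _ ?_ ?_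
  · simp only [size_eq, List.length_nil]; omega
  · simp only [size_eq, List.length_nil, List.append_nil, List.length_reverse] at hB ⊢; omega
  · refine wpIn_seqs_nil.2 ⟨?_, ?_⟩
    · simp only [Small, size_eq, List.length_nil, List.append_nil, List.length_reverse,
        List.length_append] at hB ⊢
      omega
    · simpa using h

/-- The successor in the enumeration of the words over `one` and `sep`. -/
def succWord : List Sym → List Sym
  | [] => [.sep]
  | .one :: l => .sep :: succWord l
  | _ :: l => .one :: l

/-- The number of a word over `one` and `sep`. -/
def numWord : List Sym → ℕ
  | [] => 0
  | x :: l => (if x = .one then 2 else 1) + 2 * numWord l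

theorem Binary.of_cons {x : Sym} {l : List Sym} (h : Binary (x :: l)) : (x = .one ∨ x = .sep) ∧ Binary l :=
  List.forall_mem_cons.1 h

/-- The numbering is bijective base 2, least significant digit first, with the digits `sep` for 1
and `one` for 2; `succWord` propagates the carry. -/
theorem numWord_succWord {l : List Sym} (hl : Binary l) : numWord (succWord l) = numWord l + 1 := by
  induction l with
  | nil => rfl
  | cons x l ih =>
    obtain ⟨rfl | rfl, h2⟩ := hl.of_cons
    · simp [succWord, numWord, ih h2]; omega
    · simp [succWord, numWord]; omega

theorem Binary.succWord {l : List Sym} (hl : Binary l) : Binary (succWord l) := by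
  induction l with
  | nil => exact Binary.cons hl (Or.inr rfl)
  | cons x l ih =>
    obtain ⟨rfl | rfl, h2⟩ := hl.of_cons
    · exact (ih h2).cons (Or.inr rfl)
    · exact h2.cons (Or.inl rfl)

theorem length_succWord_le (l : List Sym) : (succWord l).length ≤ l.length + 1 := by
  induction l with
  | nil => simp [succWord]
  | cons x l ih => cases x <;> (simp [succWord]; try omega)

theorem numWord_injective {l l' : List Sym} (hl : Binary l) (hl' : Binary l')
    (h : numWord l = numWord l') : l = l' := by
  induction l generalizing l' with
  | nil =>
    cases l' with
    | nil => rfl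
    | cons y l' => simp only [numWord] at h; split_ifs at h <;> omega
  | cons x l ih =>
    cases l' with
    | nil => simp only [numWord] at h; split_ifs at h <;> omega
    | cons y l' =>
      obtain ⟨hx, hl⟩ := hl.of_cons
      obtain ⟨hy, hl'⟩ := hl'.of_cons
      simp only [numWord] at h
      have h2 := @ih l' hl hl'
      rcases hx with rfl | rfl <;> rcases hy with rfl | rfl <;>
        simp only [if_true, reduceCtorEq, if_false] at h
      · rw [h2 (by omega)]
      · omega
      · omega
      · rw [h2 (by omega)]

/-- With `numWord_lt`, the words of length `n` have numbers between `2 ^ n - 1` and `2 ^ (n + 1) -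
2`, so the enumeration proceeds by length. -/
theorem two_pow_le_numWord (l : List Sym) : 2 ^ l.length ≤ numWord l + 1 := by
  induction l with
  | nil => simp [numWord]
  | cons x l ih =>
    rw [List.length_cons, pow_succ, numWord]
    split_ifs <;> omega

theorem numWord_lt (l : List Sym) : numWord l + 2 ≤ 2 * 2 ^ l.length := by
  induction l with
  | nil => simp [numWord]
  | cons x l ih =>
    rw [List.length_cons, pow_succ, numWord]
    split_ifs <;> omega

/-- No word tried before a successful one is longer than it, so the space for the latter suffices
for all attempts. -/
theorem length_le_of_numWord_le {l l' : List Sym} (h : numWord l ≤ numWord l') :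
    l.length ≤ l'.length := by
  by_contra! h'
  have h1 := two_pow_le_numWord l
  have h2 := numWord_lt l'
  have h3 : 2 ^ (l'.length + 1) ≤ 2 ^ l.length := Nat.pow_le_pow_right (by omega) h'
  rw [pow_succ] at h3
  omega

/-- Replace the choices under trial by the next ones. -/
def inc : Cmd :=
  seqs [pop .cho0, whl (is .one) (seqs [put .aux .sep, pop .cho0]),
    ite (is .sep) (put .cho0 .one) (put .cho0 .sep), mvAll .aux .cho0]

theorem wpIn_mvAll_aux (l z : List Sym) (hB : (St.mk r i j c v u p q o ⟨i₀, l, z, t⟩).size ≤ B)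
    (h : Q ⟨none, i, j, c, v, u, p, q, o, ⟨i₀, z.reverse ++ l, [], t⟩⟩) :
    wpIn (Small B) (seqs [mvAll .aux .cho0]) ⟨r, i, j, c, v, u, p, q, o, ⟨i₀, l, z, t⟩⟩ Q F := by
  refine wpIn_of_wp rfl hB (wp_seqs_cons.2 (wp_mvAll
    (fun a b r => ⟨r, i, j, c, v, u, p, q, o, ⟨i₀, b, a, t⟩⟩) (fun _ _ _ => rfl) (fun _ _ => rfl)
    (fun _ _ _ _ => rfl) z l r (wp_seqs_nil.2 h)))

theorem wpIn_inc (hl : Binary c₀)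
    (hB : (St.mk r i j c v u p q o ⟨i₀, c₀, [], t⟩).size + 1 ≤ B)
    (h : Q ⟨none, i, j, c, v, u, p, q, o, ⟨i₀, succWord c₀, [], t⟩⟩) :
    wpIn (Small B) inc ⟨r, i, j, c, v, u, p, q, o, ⟨i₀, c₀, [], t⟩⟩ Q F := by
  have loop : ∀ (l z : List Sym), Binary l →
      (St.mk none i j c v u p q o ⟨i₀, l, z, t⟩).size + 1 ≤ B →
      Q ⟨none, i, j, c, v, u, p, q, o, ⟨i₀, z.reverse ++ succWord l, [], t⟩⟩ →
      wpIn (Small B) (whl (is .one) (seqs [put .aux .sep, pop .cho0]))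
        ⟨l.head?, i, j, c, v, u, p, q, o, ⟨i₀, l.tail, z, t⟩⟩ (fun s => wpIn (Small B)
          (seqs [ite (is .sep) (put .cho0 .one) (put .cho0 .sep), mvAll .aux .cho0]) s Q F) F := by
    intro l
    induction l with
    | nil =>
      intro z _ hB h
      simp only [size_eq, List.length_nil] at hB
      rw [wpIn_whl, if_neg (by simp [is]), wpIn_seqs_cons, wpIn_ite, if_neg (by simp [is]), wpIn_put]
      simp only [St.set, St.get, List.tail_nil, List.head?_nil]
      have hs : ∀ r, (St.mk r i j c v u p q o ⟨i₀, [.sep], z, t⟩).size ≤ B := fun r => by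
        simp only [size_eq, List.length_cons, List.length_nil]
        omega
      exact ⟨hs _, wpIn_mvAll_aux _ _ (hs _) h⟩
    | cons x l ih =>
      intro z hxl hB h
      obtain ⟨hx, hl⟩ := hxl.of_cons
      simp only [size_eq, List.length_cons] at hB
      rcases hx with rfl | rfl
      · rw [wpIn_whl, if_pos (by simp [is]), wpIn_seqs_cons, wpIn_put, wpIn_seqs_cons, wpIn_pop,
          wpIn_seqs_nil]
        simp only [Prim.sem, St.set, St.get, List.tail_cons, List.head?_cons]
        have hs : ∀ r, (St.mk r i j c v u p q o ⟨i₀, l.tail, .sep :: z, t⟩).size ≤ B := fun r => by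
          simp only [size_eq, List.length_cons, List.length_tail]
          omega
        refine ⟨?_, hs _, hs _, ih (.sep :: z) hl ?_ (by simpa [succWord] using h)⟩
        · simp only [Small, size_eq, List.length_cons]
          omega
        · simp only [size_eq, List.length_cons]
          omega
      · rw [wpIn_whl, if_neg (by simp [is]), wpIn_seqs_cons, wpIn_ite, if_pos (by simp [is]), wpIn_put]
        simp only [St.set, St.get, List.tail_cons, List.head?_cons]
        have hs : ∀ r, (St.mk r i j c v u p q o ⟨i₀, .one :: l, z, t⟩).size ≤ B := fun r => by
          simp only [size_eq, List.length_cons]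
          omega
        exact ⟨hs _, wpIn_mvAll_aux _ _ (hs _) h⟩
  rw [inc, wpIn_seqs_cons, wpIn_pop]
  refine ⟨?_, wpIn_seqs_cons.2 (loop c₀ [] hl ?_ h)⟩
  · simp only [size_eq, Small, Prim.sem, St.set, St.get, List.length_tail] at hB ⊢
    omega
  · simpa only [size_eq] using hB

end Cmd
end KLMReach

/-! ### The exhaustive search and the length of presentations -/

namespace KLMReach
namespace Cmd

variable {s : St} {Q Q' : St → Prop} {F : Prop} {B : ℕ} {a : Cmd}
variable {r : Option Sym} {i j v u p q o : List Sym} {e : Store} {x : Sym} {z t : List Sym}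
variable {d : ℕ} {ξ : KLM.{u} d} {w c : List Sym}

/-- Empty the stacks that a trial uses, except for the result. -/
def clearAll : Cmd :=
  seqs [clear .inp, clear .read, clear .cho, clear .cnt, clear .cnt', clear .cur, clear .tgt]

/-- Restore the state after a failed trial, with the next choices. -/
def reset : Cmd := seqs [clearAll, clear .res, inc, set (some .one)]

/-- Try a word of choices. -/
def attempt : Cmd :=
  seqs [copy .inp0 .inp, copy .cho0 .cho, rescue (seqs [trial, set none]) reset]

/-- Try all the words of choices, until a trial succeeds. -/
def search : Cmd :=
  seqs [set (some .one), whl Option.isSome attempt,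
    seqs [clearAll, clear .inp0, clear .cho0, clear .aux, mvAll .res .out]]

/-- The state in which a word of choices is tried. -/
def attemptSt (w c : List Sym) : St := ⟨some .one, [], [], [], [], [], [], [], [], ⟨w, c, [], []⟩⟩

theorem _root_.KLMReach.Exec.mono {P P' : St → Prop} (hP : ∀ s, P s → P' s) {c : Cmd} {s s' : St} {o : Bool}
    (h : Exec P c s o s') : Exec P' c s o s' := by
  induction h with
  | prim h => exact .prim (hP _ h)
  | seq_ok _ _ ih₁ ih₂ => exact .seq_ok ih₁ ih₂
  | seq_fail _ ih => exact .seq_fail ih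
  | ite_true ht _ ih => exact .ite_true ht ih
  | ite_false ht _ ih => exact .ite_false ht ih
  | whl_done ht => exact .whl_done ht
  | whl_step ht _ _ ih₁ ih₂ => exact .whl_step ht ih₁ ih₂
  | whl_fail ht _ ih => exact .whl_fail ht ih
  | rescue_ok _ ih => exact .rescue_ok ih
  | rescue_fail _ _ ih₁ ih₂ => exact .rescue_fail ih₁ ih₂

theorem wp_clearAll : wp clearAll ⟨r, i, j, c, v, u, p, q, o, e⟩ Q F ↔
    Q ⟨none, [], [], [], [], [], [], [], o, e⟩ := by
  simp only [clearAll, wp_seqs_cons, wp_clear, wp_seqs_nil, St.set]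

theorem wpIn_reset (hc : Binary c) (hs : s.e = ⟨w, c, [], []⟩) (hB : s.size + 1 ≤ B)
    (h : Q (attemptSt w (succWord c))) : wpIn (Small B) reset s Q F := by
  obtain ⟨r, i, j, c', v, u, p, q, o, e⟩ := s
  obtain rfl : e = ⟨w, c, [], []⟩ := hs
  simp only [size_eq, List.length_nil] at hB
  have hlen := length_succWord_le c
  rw [reset, wpIn_seqs_cons]
  refine wpIn_of_wp (by decide) (by rw [size_eq]; simp only [List.length_nil]; omega) ?_
  rw [wp_clearAll, wpIn_seqs_cons]
  refine wpIn_of_wp (by decide) (by rw [size_eq]; simp only [List.length_nil]; omega) ?_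
  rw [wp_clear, wpIn_seqs_cons]
  refine wpIn_inc hc (by rw [size_eq]; simp only [St.set, List.length_nil]; omega) ?_
  have hsmall : ∀ r, Small B ⟨r, [], [], [], [], [], [], [], [], ⟨w, succWord c, [], []⟩⟩ := fun r => by
    simp only [Small, size_eq, List.length_nil]; omega
  rw [wpIn_seqs_cons, set, wpIn_prim, if_pos (by rfl), wpIn_seqs_nil]
  exact ⟨hsmall _, hsmall _, h⟩

/-- The space consists of two copies of the input and two of the choices. The second copy of the
choices is the budget of the trial for its counters, its states and its result. -/
theorem wpIn_attempt (hw : ξ.Encodes w) (hc : Binary c) (hB : 2 * w.length + 2 * c.length + 2 ≤ B)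
    (hacc : ∀ s, (∃ σ ∈ ξ.language, s.res = (encWord σ).reverse) → s.r = none → s.e.out = [] →
      s.res.length ≤ c.length → s.size ≤ B → Q s)
    (hrej : (¬ ∀ r, wp trial (trialSt r w c ⟨w, c, [], []⟩) (fun _ => True) False) →
      Q (attemptSt w (succWord c))) :
    wpIn (Small B) attempt (attemptSt w c) Q F := by
  rw [attempt, wpIn_seqs_cons]
  refine wpIn_copy_inp w [] ?_ ?_
  · simp only [size_eq, List.length_nil]; omega
  rw [wpIn_seqs_cons]
  refine wpIn_copy_cho c [] ?_ ?_
  · simp only [size_eq, List.length_nil, List.append_nil]; omega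
  rw [List.append_nil, List.append_nil]
  have hsmall : ∀ s, Below (trialSt none w c ⟨w, c, [], []⟩) s → s.size + 1 ≤ B := by
    rintro s ⟨h1, h2, h3⟩
    simp only [trialSt, work, List.length_nil] at h1 h2 h3
    rw [size_eq, h1]
    simp only [List.length_nil]
    omega
  -- This is the only run of the trial, and it halts in either case; the invariant `Below` bounds
  -- its space.
  obtain ⟨b, s', hex, hok, -⟩ := wp_trial_sound (e := ⟨w, c, [], []⟩) (c := c) hw none
  obtain ⟨hex', hbel⟩ := hex.strengthen (Below.sem _) all_isLocal_trial ⟨rfl, le_rfl, le_rfl⟩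
  have hex'' := hex'.mono (P' := Small B) fun s hs => by have := hsmall s hs; unfold Small; omega
  have hs' := hsmall s' hbel
  rw [wpIn_seqs_cons]
  have hsz : ∀ r, ({ s' with r := r } : St).size = s'.size := fun r => by rw [size_eq, size_eq]
  cases b with
  | true =>
    refine ⟨true, { s' with r := none }, .rescue_ok (.seq_ok hex'' (.seq_ok (.prim ?_) (.prim ?_))),
      fun _ => wpIn_seqs_nil.2 ⟨?_, hacc _ (hok rfl) rfl ?_ ?_ ?_⟩, fun h => by simp at h⟩
    · have := hsz none
      simp only [Small, Prim.sem]; omega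
    · have := hsz none
      simp only [Small, Prim.sem, id_eq]; omega
    · have := hsz none
      simp only [Small]; omega
    · simp [hbel.1, trialSt]
    · have h2 := hbel.2.1
      simp only [trialSt, work, List.length_nil] at h2 ⊢
      omega
    · have := hsz none
      omega
  | false =>
    obtain ⟨b, s₂, h1, h2, h3⟩ : wpIn (Small B) reset s' (fun s => Small B s ∧ Q s) F := by
      refine wpIn_reset hc hbel.1 hs' ⟨?_, hrej fun h => ?_⟩
      · have := length_succWord_le c
        simp only [Small, attemptSt, size_eq, List.length_nil]
        omega
      · obtain ⟨b, s₃, h1, -, h3⟩ := h none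
        obtain ⟨rfl, -⟩ := hex.unique h1
        exact h3 rfl
    exact ⟨b, s₂, .rescue_fail (.seq_fail hex'') h1, fun hb => wpIn_seqs_nil.2 (h2 hb), h3⟩

/-- Induction on the distance to `c₁`, whose trial cannot fail. An earlier success is just as good:
by soundness its result is correct, and it is no longer than its own choices. -/
theorem wpIn_attempts (hw : ξ.Encodes w) {c₁ : List Sym} (hc₁ : Binary c₁)
    (hacc₁ : ∀ e r, wp trial (trialSt r w c₁ e) (fun _ => True) False)
    (hB : 2 * w.length + 2 * c₁.length + 2 ≤ B)
    (hQ : ∀ s, (∃ σ ∈ ξ.language, s.res = (encWord σ).reverse) → s.e.out = [] →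
      s.res.length ≤ c₁.length → s.size ≤ B → Q s) (n : ℕ) :
    ∀ c, Binary c → numWord c + n = numWord c₁ →
      wpIn (Small B) (whl Option.isSome attempt) (attemptSt w c) Q F := by
  induction n with
  | zero =>
    intro c hc hn
    obtain rfl := numWord_injective hc hc₁ hn
    rw [wpIn_whl, if_pos (by rfl)]
    refine wpIn_attempt hw hc hB (fun s h1 h2 h3 h4 h5 => ?_) fun h => absurd (hacc₁ _) h
    rw [wpIn_whl, h2, if_neg (by simp)]
    exact hQ s h1 h3 h4 h5
  | succ n ih =>
    intro c hc hn
    have hlen := length_le_of_numWord_le (l := c) (l' := c₁) (by omega)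
    rw [wpIn_whl, if_pos (by rfl)]
    refine wpIn_attempt hw hc (by omega) (fun s h1 h2 h3 h4 h5 => ?_) fun _ => ?_
    · rw [wpIn_whl, h2, if_neg (by simp)]
      exact hQ s h1 h3 (by omega) h5
    · exact ih _ hc.succWord (by rw [numWord_succWord hc]; omega)

/-- The result has been paid for with choices, so its presentation is at most as long as `c₁`. Each
action occupies at least one cell, which bounds the number of letters too. -/
theorem search_computes (hξ : ξ.Normal) (hw : ξ.Encodes w)
    (hB : 2 * w.length + 2 * ell ξ.size + 2 ≤ B) :
    ∃ σ ∈ ξ.language, σ.length ≤ ell ξ.size ∧ ComputesInSpace search.machine w (encWord σ) B := by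
  obtain ⟨c₁, hc₁, hlen, hacc⟩ := wp_trial_complete hξ hw
  have hmain : wpIn (Small B) search (initSt w) (fun s => ∃ σ ∈ ξ.language, σ.length ≤ ell ξ.size ∧
      s = finalSt (encWord σ)) False := by
    rw [search, wpIn_seqs_cons, set, wpIn_prim, if_pos (by rfl), wpIn_seqs_cons]
    refine ⟨?_, ?_⟩
    · simp only [Small, size_eq, Prim.sem, initSt, List.length_nil]; omega
    refine wpIn_attempts hw hc₁ hacc (by omega) (fun s h1 h2 h3 h4 => ?_) (numWord c₁) []
      (by simp [Binary]) (by simp [numWord])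
    obtain ⟨σ, hσ, h1⟩ := h1
    have h5 : σ.length ≤ ell ξ.size := by
      have h6 := length_le_length_encWord σ
      rw [h1, List.length_reverse] at h3
      omega
    have hfin : wp (seqs [clearAll, clear .inp0, clear .cho0, clear .aux, mvAll .res .out]) s
        (fun s => s = finalSt (encWord σ)) False := by
      obtain ⟨r, i, j, c', v, u, p, q, o, ⟨i₀, c₀, z, t⟩⟩ := s
      obtain rfl : t = [] := h2
      obtain rfl : o = (encWord σ).reverse := h1
      rw [wp_seqs_cons, wp_clearAll]
      simp only [wp_seqs_cons, wp_clear, wp_seqs_nil, St.set]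
      refine wp_mvAll (fun a b r => ⟨r, [], [], [], [], [], [], [], a, ⟨[], [], [], b⟩⟩)
        (fun _ _ _ => rfl) (fun _ _ => rfl) (fun _ _ _ _ => rfl) _ _ _ ?_
      simp [finalSt]
    rw [wpIn_seqs_cons]
    refine (wpIn_of_wp (by decide) h4 hfin).mono fun s hs => wpIn_seqs_nil.2 ⟨?_, σ, hσ, h5, hs⟩
    rw [hs]
    rw [h1, List.length_reverse] at h3
    simp only [Small, size_eq, finalSt, List.length_nil]
    omega
  obtain ⟨b, s', h1, h2, h3⟩ := hmain
  cases b with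
  | false => exact (h3 rfl).elim
  | true =>
    obtain ⟨σ, hσ, h4, rfl⟩ := h2 rfl
    refine ⟨σ, hσ, h4, computesInSpace h1 ?_⟩
    simp only [size_eq, initSt, List.length_nil]
    omega

theorem length_encConfig (x : Config d) : (encConfig x).length ≤ configNorm x + 2 * d + 1 := by
  have h : ∀ y : ℕ∞, (encENat y).length ≤ y.toNat + 2 := fun y => by
    unfold encENat
    split_ifs <;> simp [length_encNat]
  have : ((List.ofFn fun i => encENat (x i)).flatten).length ≤ ∑ i, ((x i).toNat + 2) := by
    rw [List.length_flatten, List.map_ofFn, List.sum_ofFn]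
    exact Finset.sum_le_sum fun i _ => h _
  rw [Finset.sum_add_distrib, Finset.sum_const, Finset.card_univ, Fintype.card_fin, smul_eq_mul] at this
  rw [encConfig, List.length_append, List.length_singleton, configNorm]
  omega

theorem length_encAction (a : Action d) : (encAction a).length ≤ actionNorm a + 2 * d + 1 := by
  have h : ∀ z : ℤ, (encInt z).length ≤ z.natAbs + 2 := fun z => by
    unfold encInt
    split_ifs <;> simp [length_encNat]
  have : ((List.ofFn fun i => encInt (a i)).flatten).length ≤ ∑ i, ((a i).natAbs + 2) := by
    rw [List.length_flatten, List.map_ofFn, List.sum_ofFn]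
    exact Finset.sum_le_sum fun i _ => h _
  rw [Finset.sum_add_distrib, Finset.sum_const, Finset.card_univ, Fintype.card_fin, smul_eq_mul] at this
  rw [encAction, List.length_append, List.length_singleton, actionNorm]
  omega

/-- Each transition carries two state numbers in unary, so the bound is quadratic in the size. -/
theorem length_encodes_vass (G : VASS.{u} d) {g : List Sym} (hg : G.Encodes g) :
    g.length ≤ G.size * (2 * G.size + 2 * d + 7) := by
  obtain ⟨ν, l, hnd, hl, rfl⟩ := hg
  have hcard : l.length = G.T.card := by
    classical
    rw [← List.toFinset_card_of_nodup hnd]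
    congr 1
    ext t
    simp [hl]
  have h1 : G.T.card + Nat.card G.Q + ∑ t ∈ G.T, actionNorm t.2.1 = G.size := by
    unfold VASS.size; omega
  have h2 : ((l.map (encTrans ν)).flatten).length ≤ l.length * (2 * G.size + 2 * d + 2) := by
    rw [List.length_flatten, List.map_map]
    refine (List.sum_le_card_nsmul _ (2 * G.size + 2 * d + 2) ?_).trans (by simp)
    simp only [List.mem_map, forall_exists_index, and_imp, forall_apply_eq_imp_iff₂]
    intro t ht
    have h3 := length_encAction t.2.1
    have h4 : actionNorm t.2.1 ≤ ∑ t ∈ G.T, actionNorm t.2.1 :=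
      Finset.single_le_sum (f := fun t : G.Q × Action d × G.Q => actionNorm t.2.1)
        (fun _ _ => Nat.zero_le _) ((hl t).1 ht)
    have h5 := (ν t.1).2
    have h6 := (ν t.2.2).2
    simp only [Function.comp_apply, encTrans, List.length_cons, List.length_append, length_encNat]
    omega
  have h5 := (ν G.qin).2
  have h6 := (ν G.qout).2
  simp only [List.length_append, length_encNat, List.length_singleton]
  rw [hcard] at h2
  have h7 : G.T.card * (2 * G.size + 2 * d + 2) ≤ G.size * (2 * G.size + 2 * d + 2) :=
    Nat.mul_le_mul_right _ (by omega)
  have h8 : G.size * (2 * G.size + 2 * d + 7) = G.size * (2 * G.size + 2 * d + 2) + 5 * G.size := by ring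
  omega

/-- A bound that is quadratic in the size is enough, because `ξ.size ^ 2 ≤ ell ξ.size`. -/
theorem length_encodes (hw : ξ.Encodes w) : w.length ≤ 9 * ell ξ.size := by
  obtain ⟨g, hg, rfl⟩ := hw
  set W := ξ.weight with hW
  have hwt : ξ.k + ∑ j, actionNorm (ξ.a j) + (∑ j, configNorm (ξ.x j) + ∑ j, (ξ.G j).size +
      ∑ j, configNorm (ξ.y j)) = W := by
    rw [hW, KLM.weight, Finset.sum_add_distrib, Finset.sum_add_distrib]
  have hsize : ∀ j, (ξ.G j).size ≤ ∑ j, (ξ.G j).size := fun j =>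
    Finset.single_le_sum (f := fun j => (ξ.G j).size) (fun _ _ => Nat.zero_le _) (Finset.mem_univ j)
  have hk : ξ.k + 1 ≤ ∑ j, (ξ.G j).size := by
    have : ∑ _j : Fin (ξ.k + 1), 1 ≤ ∑ j, (ξ.G j).size := Finset.sum_le_sum fun j _ =>
      (KLM.one_le_size_vass (ξ.G j)).trans (by unfold VASS.size; omega)
    simpa using this
  have htriple : ∀ j, (encConfig (ξ.x j)).length + (g j).length + (encConfig (ξ.y j)).length ≤
      configNorm (ξ.x j) + configNorm (ξ.y j) + (4 * d + 2) + (ξ.G j).size * (2 * W + 2 * d + 7) := by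
    intro j
    have h1 := length_encConfig (ξ.x j)
    have h2 := length_encConfig (ξ.y j)
    have h3 := length_encodes_vass _ (hg j)
    have h4 := hsize j
    have h5 : (ξ.G j).size * (2 * (ξ.G j).size + 2 * d + 7) ≤ (ξ.G j).size * (2 * W + 2 * d + 7) :=
      Nat.mul_le_mul_left _ (by omega)
    omega
  have htotal : ∑ j, ((encConfig (ξ.x j)).length + (g j).length + (encConfig (ξ.y j)).length) ≤
      ∑ j, configNorm (ξ.x j) + ∑ j, configNorm (ξ.y j) + (ξ.k + 1) * (4 * d + 2) +
        (∑ j, (ξ.G j).size) * (2 * W + 2 * d + 7) := by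
    refine (Finset.sum_le_sum fun j _ => htriple j).trans (le_of_eq ?_)
    rw [Finset.sum_add_distrib, Finset.sum_add_distrib, Finset.sum_add_distrib, ← Finset.sum_mul,
      Finset.sum_const, Finset.card_univ, Fintype.card_fin, smul_eq_mul]
  rw [Fin.sum_univ_succ] at htotal
  have hact : ∑ j : Fin ξ.k, (1 + (encAction (ξ.a j)).length) ≤
      ∑ j, actionNorm (ξ.a j) + ξ.k * (2 * d + 2) := by
    have : ∑ j : Fin ξ.k, (2 * d + 2) = ξ.k * (2 * d + 2) := by simp
    rw [← this, ← Finset.sum_add_distrib]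
    refine Finset.sum_le_sum fun j _ => ?_
    have := length_encAction (ξ.a j)
    omega
  have hlen : ((List.ofFn fun j : Fin ξ.k => Sym.link :: (encAction (ξ.a j) ++
      encConfig (ξ.x j.succ) ++ g j.succ ++ encConfig (ξ.y j.succ))).flatten).length =
      ∑ j : Fin ξ.k, (1 + (encAction (ξ.a j)).length) + ∑ j : Fin ξ.k,
        ((encConfig (ξ.x j.succ)).length + (g j.succ).length + (encConfig (ξ.y j.succ)).length) := by
    rw [List.length_flatten, List.map_ofFn, List.sum_ofFn, ← Finset.sum_add_distrib]
    refine Finset.sum_congr rfl fun j _ => ?_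
    simp only [Function.comp_apply, List.length_cons, List.length_append]
    omega
  have hX : 2 * (d + 1) * W ≤ ξ.size := by
    have : (d + 1) ^ 1 ≤ (d + 1) ^ (d + 1) := Nat.pow_le_pow_right (by omega) (by omega)
    rw [pow_one] at this
    change _ ≤ 2 * (d + 1) ^ (d + 1) * W
    gcongr
  have hW1 : 1 ≤ W := ξ.one_le_weight
  have hell : ξ.size ^ 2 ≤ ell ξ.size := by
    have h2 : 1 ≤ ξ.size := by
      refine le_trans ?_ hX
      exact Nat.mul_pos (by omega) hW1
    exact Nat.pow_le_pow_right h2 (by omega)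
  have h1 : (ξ.k + 1) * (4 * d + 2) ≤ W * (4 * d + 2) := Nat.mul_le_mul_right _ (by omega)
  have h2 : (∑ j, (ξ.G j).size) * (2 * W + 2 * d + 7) ≤ W * (2 * W + 2 * d + 7) :=
    Nat.mul_le_mul_right _ (by omega)
  have h3 : ξ.k * (2 * d + 2) ≤ W * (2 * d + 2) := Nat.mul_le_mul_right _ (by omega)
  simp only [List.length_append, length_encNat, hlen]
  generalize ξ.size = X at hX hell ⊢
  generalize ell X = L at hell ⊢
  have h4 : (2 * (d + 1) * W) ^ 2 ≤ X ^ 2 := Nat.pow_le_pow_left hX 2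
  have h5 : d ≤ d * W := Nat.le_mul_of_pos_right _ hW1
  have h6 : W ≤ W * W := Nat.le_mul_of_pos_right _ hW1
  have h7 : d * W ≤ d * (W * W) := Nat.mul_le_mul_left _ h6
  have h8 : (2 * (d + 1) * W) ^ 2 = 4 * (d * d * (W * W)) + 8 * (d * (W * W)) + 4 * (W * W) := by ring
  have h9 : W * (4 * d + 2) = 4 * (d * W) + 2 * W := by ring
  have h10 : W * (2 * W + 2 * d + 7) = 2 * (W * W) + 2 * (d * W) + 7 * W := by ring
  have h11 : W * (2 * d + 2) = 2 * (d * W) + 2 * W := by ring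
  omega

end Cmd
end KLMReach

theorem mainTheorem5 :
    (∀ (d : ℕ) (ξ : KLMReach.KLM.{u} d), ξ.Normal →
      ∃ σ ∈ ξ.language, σ.length ≤ KLMReach.ell ξ.size) ∧
    ∃ (M : Turing.TM2ComputableAux KLMReach.Sym KLMReach.Sym) (C : ℕ),
      (∀ k, Finite (M.tm.Γ k)) ∧
      ∀ (d : ℕ) (ξ : KLMReach.KLM.{u} d), ξ.Normal →
        ∀ w, ξ.Encodes w →
          ∃ σ ∈ ξ.language, σ.length ≤ KLMReach.ell ξ.size ∧
            KLMReach.ComputesInSpace M w (KLMReach.encWord σ) (C * KLMReach.ell ξ.size) := by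
  -- The constant is `22 = 2 * 9 + 2 + 2`: two copies of an input of length at most `9 * ell
  -- ξ.size`, two copies of the choices, and 2 further cells, as `ell ξ.size ≥ 1`.
  refine ⟨fun d ξ hξ => KLMReach.KLM.exists_short_word hξ, KLMReach.Cmd.search.machine, 22, fun _ => ?_,
    fun d ξ hξ w hw => KLMReach.Cmd.search_computes hξ hw ?_⟩
  · exact inferInstanceAs (Finite KLMReach.Sym)
  · have h1 := KLMReach.Cmd.length_encodes hw
    have h2 : 1 ≤ KLMReach.ell ξ.size := by
      obtain ⟨σ, -, -⟩ := KLMReach.KLM.exists_short_word hξ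
      refine Nat.one_le_iff_ne_zero.2 fun h => ?_
      obtain ⟨h3, h4⟩ := Nat.pow_eq_zero.1 h
      simp [h3] at h4
    omega
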